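/- **Setting.** A stream of tokens $(q_j,k_j,v_j)_{j=1}^n$ with $q_j,k_j,v_j\in\mathbb R^d$ arrives one by one. Let $K_j,V_j\in\mathbb R^{j\times d}$ have rows $k_1,\dots,k_j$ and $v_1,\dots,v_j$, and let $\mathrm{Attn}(q_j,K_j,V_j)=\mathrm{softmax}(K_jq_j/\sqrt d)^TV_j$. Write $\log$ for the natural logarithm; $\tilde O(X)$ means at most $C(1+\log n)^aX$ with constants $C,a$. **SoftmaxBalance** (radii $r_{\rm key},r_{\rm val}$, failure parameter $\delta$) receives a list of pairs $(k_i,v_i)$, $k_i\in\mathbb R^d$, $v_i\in\mathbb R^s$. With $R=e^{r_{\rm key}^2/(2\sqrt d)}r_{\rm val}$ and $c=30\log(n/\delta)$ it chooses signs one after the other: with $w=\sum_{i<j}\eta_i e^{\langle k_i,k_j\rangle/\sqrt d}\langle v_i,v_j\rangle$ it fails (and the whole run aborts) if $|w|>cR^2$, and otherwise sets $\eta_j=+1$ with probability $\frac12-\frac{w}{2cR^2}$ and $\eta_j=-1$ otherwise. It returns $\{i:\eta_i=1\}$ if this class is not larger than $\{i:\eta_i=-1\}$, and the latter class otherwise.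 **MergeAndReduce** (batch size $t$, number of levels $T$) keeps lists $C^0,\dots,C^T$, initially empty. When its $m$-th pair arrives it is appended to $C^0$; then for $i=0,1,\dots$, as long as $i<T$ and $t2^i$ divides $m$, the output of SoftmaxBalance on $C^i$ is appended to $C^{i+1}$ and $C^i$ is emptied. **BalanceKV** (parameters $n,r,\varepsilon,t,T,\delta$) keeps $v_{\max}$ (initially $0$), an instance $\mathrm{Num}_i$ of MergeAndReduce for each bucket $i\in\mathbb Z$ in use (with $r_{\rm key}=r$, $r_{\rm val}=2^i$), and one instance $\mathrm{Den}$ with one-dimensional values (with $r_{\rm key}=r$, $r_{\rm val}=1$). At step $j$ it sends $(k_j,v_j)$ to $\mathrm{Num}_i$ with $2^{i-1}<\|v_j\|_2\le 2^i$ (nothing is sent if $v_j=0$), sets $v_{\max}\leftarrow\max(v_{\max},\|v_j\|_2)$, erases every $\mathrm{Num}_i$ with $2^i\le\frac{\varepsilon}{2n}e^{-r^2/\sqrt d}v_{\max}$, sends $(k_j,1)$ to $\mathrm{Den}$, and outputs $$z_j=\frac{\sum_i\sum_{l=0}^T2^l\sum_{(k,v)\in C^l(\mathrm{Num}_i)}e^{\langle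 k,q_j\rangle/\sqrt d}\,v}{\sum_{l=0}^T2^l\sum_{(k,v)\in C^l(\mathrm{Den})}e^{\langle k,q_j\rangle/\sqrt d}}$$ (the run aborts if the denominator is not positive). **Cost model.** A randomized real RAM: a memory word holds a real number, an integer or a sign; arithmetic and powers, $\exp$, $\log$, square root, comparison, rounding up, pointer and counter operations and biased coin flips take one step each; allocating $w$ words takes $w$ steps. Memory is the largest number of words in use at any time. **Theorem.** For every $\kappa\in\mathbb N$ there are constants $C,C'>0$ and $a,a',b\in\mathbb N$ such that the following holds for all integers $n,d\ge1$, all $r>0$ and $0<\varepsilon\le1$. Let $$t=\Big\lceil C(1+\log n)^a\,\sqrt d\,e^{2r^2/\sqrt d}/\varepsilon\Big\rceil,\qquad T=\max\big(0,\lceil\log_2(n/t)\rceil\big),\qquad\delta=(n+1)^{-b}.$$ For every stream of tokens $(q_j,k_j,v_j)\in(\mathbb R^d)^3$, $j=1,\dots,n$, with $\|q_j\|_2,\|k_j\|_2\le r$ for all $j$, with probability at least $1-n^{-\kappa}$ BalanceKV outputs at all steps $j$ a vector $z_j$ with $$\|z_j-\mathrm{Attn}(q_j,K_j,V_j)\|_2\le\varepsilon\,\big\|\mathrm{softmax}(K_jq_j/\sqrt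 d)\big\|_2\,\|V_j\|_F .$$ In every run, its memory over the whole stream is at most $C'(1+\log n)^{a'}\,d^{1.5}e^{2r^2/\sqrt d}/\varepsilon$ words, and its running time in every step of the stream is at most $C'(1+\log n)^{a'}\,d^2e^{4r^2/\sqrt d}/\varepsilon^2$. -/

import Mathlib

open scoped ENNReal NNReal Matrix

noncomputable section

namespace BalanceKV

/-! ### Cost model: a randomized real RAM

A word of memory holds one real number, integer, sign or pointer. Every elementary operation below
takes one step: real arithmetic, `exp`, `log`, `sqrt`, comparison, rounding up, one step of integer
or pointer work, a biased coin flip. Allocating `w` words takes `w` steps (they are written) and the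
meter records the number of words in use and its peak. -/

/-- Binary operations on real words. -/
inductive BinOp
  | add | sub | mul | div | pow

/-- Unary operations on real words. -/
inductive UnOp
  | exp | log | sqrt

def BinOp.eval : BinOp → ℝ → ℝ → ℝ
  | .add, x, y => x + y
  | .sub, x, y => x - y
  | .mul, x, y => x * y
  | .div, x, y => x / y
  | .pow, x, y => x ^ y

def UnOp.eval : UnOp → ℝ → ℝ
  | .exp, x => Real.exp x
  | .log, x => Real.log x
  | .sqrt, x => Real.sqrt x

/-- Programs of the randomized real RAM returning a value of type `α`. -/
inductive Prog (α : Type) : Type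
  | ret (a : α)
  | abort
  | bin (o : BinOp) (x y : ℝ) (next : ℝ → Prog α)
  | un (o : UnOp) (x : ℝ) (next : ℝ → Prog α)
  | le (x y : ℝ) (next : Bool → Prog α)
  | ceil (x : ℝ) (next : ℤ → Prog α)
  | flip (p : ℝ) (next : Bool → Prog α)
  | work (w : ℕ) (next : Prog α)
  | alloc (w : ℕ) (next : Prog α)
  | free (w : ℕ) (next : Prog α)

namespace Prog

protected def bind {α β : Type} : Prog α → (α → Prog β) → Prog β
  | .ret a, f => f a
  | .abort, _ => .abort
  | .bin o x y k, f => .bin o x y fun z => (k z).bind f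
  | .un o x k, f => .un o x fun z => (k z).bind f
  | .le x y k, f => .le x y fun b => (k b).bind f
  | .ceil x k, f => .ceil x fun z => (k z).bind f
  | .flip p k, f => .flip p fun b => (k b).bind f
  | .work w k, f => .work w (k.bind f)
  | .alloc w k, f => .alloc w (k.bind f)
  | .free w k, f => .free w (k.bind f)

instance : Monad Prog where
  pure := Prog.ret
  bind := Prog.bind

def addR (x y : ℝ) : Prog ℝ := .bin .add x y .ret
def subR (x y : ℝ) : Prog ℝ := .bin .sub x y .ret
def mulR (x y : ℝ) : Prog ℝ := .bin .mul x y .ret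
def divR (x y : ℝ) : Prog ℝ := .bin .div x y .ret
def powR (x y : ℝ) : Prog ℝ := .bin .pow x y .ret
def expR (x : ℝ) : Prog ℝ := .un .exp x .ret
def logR (x : ℝ) : Prog ℝ := .un .log x .ret
def sqrtR (x : ℝ) : Prog ℝ := .un .sqrt x .ret
def leR (x y : ℝ) : Prog Bool := .le x y .ret
def ceilR (x : ℝ) : Prog ℤ := .ceil x .ret
def flipR (p : ℝ) : Prog Bool := .flip p .ret
def doWork (w : ℕ) : Prog Unit := .work w (.ret ())
def allocW (w : ℕ) : Prog Unit := .alloc w (.ret ())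
def freeW (w : ℕ) : Prog Unit := .free w (.ret ())

end Prog

/-- Steps taken, words in use, and the largest number of words that were in use at any time. -/
structure Meter where
  time : ℕ
  used : ℕ
  peak : ℕ

def Meter.tick (m : Meter) (w : ℕ) : Meter := { m with time := m.time + w }

def Meter.alloc (m : Meter) (w : ℕ) : Meter :=
  { time := m.time + w, used := m.used + w, peak := max m.peak (m.used + w) }

def Meter.free (m : Meter) (w : ℕ) : Meter :=
  { m with time := m.time + 1, used := m.used - w }

/-- A coin that shows `true` with probability `p` (for `p ∈ [0, 1]`). -/
def coin (p : ℝ) : PMF Bool :=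
  PMF.ofFintype
    (fun b => if b then ENNReal.ofReal (max 0 (min p 1)) else ENNReal.ofReal (1 - max 0 (min p 1)))
    (by
      have h0 : (0 : ℝ) ≤ max 0 (min p 1) := le_max_left _ _
      have h1 : max 0 (min p 1) ≤ (1 : ℝ) := max_le zero_le_one (min_le_right _ _)
      rw [Fintype.sum_bool]
      simp only [if_true, Bool.false_eq_true, if_false]
      rw [← ENNReal.ofReal_add h0 (sub_nonneg.2 h1)]
      simp)

/-- The joint law of the result (`none` if the program aborted) and the final meter. -/
def Prog.exec {α : Type} : Prog α → Meter → PMF (Option α × Meter)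
  | .ret a, m => PMF.pure (some a, m)
  | .abort, m => PMF.pure (none, m)
  | .bin o x y k, m => (k (o.eval x y)).exec (m.tick 1)
  | .un o x k, m => (k (o.eval x)).exec (m.tick 1)
  | .le x y k, m => (k (@decide (x ≤ y) (Classical.dec _))).exec (m.tick 1)
  | .ceil x k, m => (k ⌈x⌉).exec (m.tick 1)
  | .flip p k, m => (coin p).bind fun b => (k b).exec (m.tick 1)
  | .work w k, m => k.exec (m.tick w)
  | .alloc w k, m => k.exec (m.alloc w)
  | .free w k, m => k.exec (m.free w)

open Prog

/-! ### Vector subroutines -/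

/-- `acc + ∑ xᵢ yᵢ` over the listed coordinates. -/
def dotAux {d : ℕ} (x y : EuclideanSpace ℝ (Fin d)) : List (Fin d) → ℝ → Prog ℝ
  | [], acc => pure acc
  | i :: is, acc => do
      let p ← mulR (x i) (y i)
      let a ← addR acc p
      dotAux x y is a

def dot {d : ℕ} (x y : EuclideanSpace ℝ (Fin d)) : Prog ℝ := dotAux x y (List.finRange d) 0

/-- `acc + a • x` on the listed coordinates. -/
def axpyAux {d : ℕ} (a : ℝ) (x : EuclideanSpace ℝ (Fin d)) :
    List (Fin d) → (Fin d → ℝ) → Prog (Fin d → ℝ)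
  | [], acc => pure acc
  | i :: is, acc => do
      let p ← mulR a (x i)
      let b ← addR (acc i) p
      axpyAux a x is (Function.update acc i b)

def axpy {d : ℕ} (a : ℝ) (x : EuclideanSpace ℝ (Fin d)) (acc : Fin d → ℝ) : Prog (Fin d → ℝ) :=
  axpyAux a x (List.finRange d) acc

/-- Divide the listed coordinates by `a`. -/
def divAux {d : ℕ} (a : ℝ) : List (Fin d) → (Fin d → ℝ) → Prog (Fin d → ℝ)
  | [], acc => pure acc
  | i :: is, acc => do
      let b ← divR (acc i) a
      divAux a is (Function.update acc i b)

/-- `exp (⟨x, y⟩ / √d)`. -/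
def expScore {d : ℕ} (x y : EuclideanSpace ℝ (Fin d)) : Prog ℝ := do
  let a ← dot x y
  let b ← sqrtR d
  let c ← divR a b
  expR c

/-- A key in `ℝ^d` with a value in `ℝ^s`; it occupies `d + s` words. -/
structure KV (d s : ℕ) where
  key : EuclideanSpace ℝ (Fin d)
  val : EuclideanSpace ℝ (Fin s)

/-! ### SoftmaxBalance -/

/-- `yᵀη + acc`, where `y` has the entries `exp (⟨kᵢ, kⱼ⟩ / √d) ⟨vᵢ, vⱼ⟩` for the earlier pairs
`(kᵢ, vᵢ)`, listed with their signs `ηᵢ` (`true` is `+1`). The entry of the current pair itself is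
left out, since its sign is still `0`. -/
def signedSum {d s : ℕ} (x : KV d s) : List (KV d s × Bool) → ℝ → Prog ℝ
  | [], acc => pure acc
  | (u, b) :: us, acc => do
      let e ← expScore u.key x.key
      let g ← dot u.val x.val
      let y ← mulR e g
      let a ← if b then addR acc y else subR acc y
      signedSum x us a

/-- The main loop: choose the signs of the pairs one after the other; `B = c R²`. -/
def chooseSigns {d s : ℕ} (B : ℝ) :
    List (KV d s) → List (KV d s × Bool) → Prog (List (KV d s × Bool))
  | [], done => pure done
  | x :: xs, done => do
      let w ← signedSum x done 0
      let nB ← subR 0 B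
      let hi ← leR w B
      let lo ← leR nB w
      if hi && lo then do
        let B2 ← mulR 2 B
        let u ← divR w B2
        let p ← subR (1 / 2) u
        let b ← flipR p
        allocW 1
        chooseSigns B xs (done ++ [(x, b)])
      else
        Prog.abort

/-- The pairs whose sign is `b`. -/
def withSign {d s : ℕ} (b : Bool) (l : List (KV d s × Bool)) : List (KV d s) :=
  (l.filter fun u => u.2 == b).map Prod.fst

/-- SoftmaxBalance on the batch `C`, with the bound `n` on the length of the stream, radii `rkey`
and `rval`, and failure parameter `δ`. It returns the smaller of the two sign classes. -/
def softmaxBalance {d s : ℕ} (n : ℕ) (rkey rval δ : ℝ) (C : List (KV d s)) :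
    Prog (List (KV d s)) := do
  -- R = exp (rkey² / (2 √d)) · rval
  let r2 ← mulR rkey rkey
  let sd ← sqrtR d
  let sd2 ← mulR 2 sd
  let ex ← divR r2 sd2
  let E ← expR ex
  let R ← mulR E rval
  -- c = 30 log (n / δ)
  let nδ ← divR n δ
  let lg ← logR nδ
  let c ← mulR 30 lg
  let R2 ← mulR R R
  let B ← mulR c R2
  let l ← chooseSigns B C []
  let out := if (withSign true l).length ≤ (withSign false l).length
    then withSign true l else withSign false l
  -- one pass over the signs to count; the selected pairs are copied and the signs discarded
  doWork C.length
  allocW (out.length * (d + s))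
  freeW C.length
  pure out

/-! ### MergeAndReduce -/

/-- The parameters of an invocation: length `n` of the stream, radius `r`, precision `ε`, batch size
`t`, number `T` of levels (compression rate `2⁻ᵀ`), failure parameter `δ` of SoftmaxBalance. -/
structure Params where
  n : ℕ
  r : ℝ
  ε : ℝ
  t : ℕ
  T : ℕ
  δ : ℝ

/-- State of an instance: the number of pairs received so far and the levels `C⁰, …, Cᵀ`. -/
structure MR (d s : ℕ) where
  count : ℕ
  level : ℕ → List (KV d s)

def MR.empty {d s : ℕ} : MR d s := ⟨0, fun _ => []⟩

/-- Words that an instance needs besides its pairs: pointers to its levels, counter, bucket index. -/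
def MR.overhead (P : Params) : ℕ := P.T + 3

/-- Words occupied by an instance. -/
def MR.words {d s : ℕ} (P : Params) (m : MR d s) : ℕ :=
  MR.overhead P + ∑ l ∈ Finset.range (P.T + 1), (m.level l).length * (d + s)

/-- The loop `while p = count / (t 2ⁱ) is an integer and i < T`; the first number is `T - i`. -/
def MR.reduce {d s : ℕ} (P : Params) (rval : ℝ) : ℕ → ℕ → MR d s → Prog (MR d s)
  | 0, _, m => pure m
  | k + 1, i, m => do
      doWork 3
      if P.t * 2 ^ i ∣ m.count then do
        let out ← softmaxBalance P.n P.r rval P.δ (m.level i)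
        -- append the output to the next level and empty the present one
        freeW ((m.level i).length * (d + s))
        MR.reduce P rval k (i + 1)
          ⟨m.count,
            Function.update (Function.update m.level (i + 1) (m.level (i + 1) ++ out)) i []⟩
      else
        pure m

/-- One iteration: the pair `x` arrives. -/
def MR.step {d s : ℕ} (P : Params) (rval : ℝ) (m : MR d s) (x : KV d s) : Prog (MR d s) := do
  allocW (d + s)
  doWork 1
  MR.reduce P rval P.T 0
    ⟨m.count + 1, Function.update m.level 0 (m.level 0 ++ [x])⟩

/-- `acc + c ∑ exp (⟨k, q⟩ / √d) v` over the listed pairs. -/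
def addPairs {d s : ℕ} (q : EuclideanSpace ℝ (Fin d)) (c : ℝ) :
    List (KV d s) → (Fin s → ℝ) → Prog (Fin s → ℝ)
  | [], acc => pure acc
  | x :: xs, acc => do
      let e ← expScore x.key q
      let w ← mulR c e
      let acc' ← axpy w x.val acc
      addPairs q c xs acc'

/-- `acc + ∑ₗ 2ˡ ∑ exp (⟨k, q⟩ / √d) v` over the listed levels `l` and the pairs in `Cˡ`. -/
def addLevels {d s : ℕ} (q : EuclideanSpace ℝ (Fin d)) (m : MR d s) :
    List ℕ → (Fin s → ℝ) → Prog (Fin s → ℝ)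
  | [], acc => pure acc
  | l :: ls, acc => do
      let c ← powR 2 l
      let acc' ← addPairs q c (m.level l) acc
      addLevels q m ls acc'

/-! ### BalanceKV -/

/-- A token: query, key and value. -/
structure Token (d : ℕ) where
  query : EuclideanSpace ℝ (Fin d)
  key : EuclideanSpace ℝ (Fin d)
  val : EuclideanSpace ℝ (Fin d)

/-- State: `v_max`, the living numerator instances with their bucket indices, the denominator
instance (whose values are one-dimensional). -/
structure State (d : ℕ) where
  vmax : ℝ
  num : List (ℤ × MR d d)
  den : MR d 1

/-- Send `x` to the numerator instance with index `i`, which is created if it does not exist. The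
values in this instance have norm at most `2 ^ i`. -/
def sendNum {d : ℕ} (P : Params) (i : ℤ) (x : KV d d) :
    List (ℤ × MR d d) → Prog (List (ℤ × MR d d))
  | [] => do
      allocW (MR.overhead P)
      let rval ← powR 2 i
      let m ← MR.step P rval MR.empty x
      pure [(i, m)]
  | (i', m) :: rest => do
      doWork 1
      if i' = i then do
        let rval ← powR 2 i
        let m' ← MR.step P rval m x
        pure ((i', m') :: rest)
      else do
        let rest' ← sendNum P i x rest
        pure ((i', m) :: rest')

/-- Find the index `i` with `2 ^ (i - 1) < ‖v‖ ≤ 2 ^ i` and send the pair there. If `v = 0` there is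
no such index, the token does not contribute to the numerator, and nothing is sent. -/
def bucketAndSend {d : ℕ} (P : Params) (x : KV d d) (nv : ℝ) (l : List (ℤ × MR d d)) :
    Prog (List (ℤ × MR d d)) := do
  let z ← leR nv 0
  if z then
    pure l
  else do
    let a ← logR nv
    let b ← logR 2
    let c ← divR a b
    let i ← ceilR c
    sendNum P i x l

/-- Erase all numerator instances with `2 ^ i ≤ θ`. -/
def eraseSmall {d : ℕ} (P : Params) (θ : ℝ) :
    List (ℤ × MR d d) → Prog (List (ℤ × MR d d))
  | [] => pure []
  | (i, m) :: rest => do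
      let w ← powR 2 i
      let b ← leR w θ
      let rest' ← eraseSmall P θ rest
      if b then do
        freeW (m.words P)
        pure rest'
      else
        pure ((i, m) :: rest')

/-- The sum over all living numerator instances. -/
def addBuckets {d : ℕ} (P : Params) (q : EuclideanSpace ℝ (Fin d)) :
    List (ℤ × MR d d) → (Fin d → ℝ) → Prog (Fin d → ℝ)
  | [], acc => pure acc
  | (_, m) :: rest, acc => do
      let acc' ← addLevels q m (List.range (P.T + 1)) acc
      addBuckets P q rest acc'

/-- The threshold `(ε / (2n)) exp (-r² / √d) v_max`. -/
def threshold (d : ℕ) (P : Params) (vmax : ℝ) : Prog ℝ := do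
  let n2 ← mulR 2 P.n
  let e ← divR P.ε n2
  let r2 ← mulR P.r P.r
  let sd ← sqrtR d
  let x ← divR r2 sd
  let nx ← subR 0 x
  let E ← expR nx
  let f ← mulR e E
  mulR f vmax

/-- The quotient of the two estimates; the run aborts if the denominator is not positive. -/
def output {d : ℕ} (P : Params) (S : State d) (q : EuclideanSpace ℝ (Fin d)) :
    Prog (EuclideanSpace ℝ (Fin d)) := do
  allocW (d + 1)
  let N ← addBuckets P q S.num 0
  let D ← addLevels q S.den (List.range (P.T + 1)) 0
  let b ← leR (D 0) 0
  if b then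
    Prog.abort
  else do
    let z ← divAux (D 0) (List.finRange d) N
    freeW (d + 1)
    pure (WithLp.toLp 2 z)

/-- One iteration of BalanceKV, from the arrival of a token to the output of the estimate. -/
def step {d : ℕ} (P : Params) (S : State d) (x : Token d) :
    Prog (State d × EuclideanSpace ℝ (Fin d)) := do
  -- the token is read into a buffer
  allocW (3 * d)
  let v2 ← dot x.val x.val
  let nv ← sqrtR v2
  let num ← bucketAndSend P ⟨x.key, x.val⟩ nv S.num
  let b ← leR nv S.vmax
  let vmax := if b then S.vmax else nv
  let θ ← threshold d P vmax
  let num' ← eraseSmall P θ num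
  let den ← MR.step P 1 S.den ⟨x.key, !₂[1]⟩
  let z ← output P ⟨vmax, num', den⟩ x.query
  freeW (3 * d)
  pure (⟨vmax, num', den⟩, z)

/-- Initialization; the constant accounts for parameters and scalar registers. -/
def start (d : ℕ) (P : Params) : Prog (State d) := do
  allocW 64
  allocW (MR.overhead P)
  pure ⟨0, [], MR.empty⟩

/-- What is observed at one step of the stream: the estimate (`none` if the run has aborted), the
number of machine steps, the largest number of words in use at any time since the beginning. -/
structure Report (d : ℕ) where
  estimate : Option (EuclideanSpace ℝ (Fin d))
  time : ℕ
  space : ℕ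

/-- Run on the remaining tokens. After an abort nothing more is computed. -/
def runFrom {d : ℕ} (P : Params) : List (Token d) → State d → Meter → PMF (List (Report d))
  | [], _, _ => PMF.pure []
  | x :: xs, S, m => ((step P S x).exec m).bind fun res =>
      match res with
      | (some (S', z), m') =>
          (runFrom P xs S' { m' with time := 0 }).map (⟨some z, m'.time, m'.peak⟩ :: ·)
      | (none, m') =>
          PMF.pure (⟨none, m'.time, m'.peak⟩ :: xs.map fun _ => ⟨none, 0, m'.peak⟩)

/-- BalanceKV on a stream of tokens: the law of the sequence of reports, one for every step. The
time of the initialization is charged to the first step. -/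
def run {d : ℕ} (P : Params) (stream : List (Token d)) : PMF (List (Report d)) :=
  ((start d P).exec ⟨0, 0, 0⟩).bind fun res =>
    match res with
    | (some S, m) => runFrom P stream S m
    | (none, m) => PMF.pure (stream.map fun _ => ⟨none, m.time, m.peak⟩)

/-! ### Attention -/

def softmax {m : ℕ} (x : Fin m → ℝ) : Fin m → ℝ :=
  fun i => Real.exp (x i) / ∑ l, Real.exp (x l)

/-- The matrix of the rows `x₀, …, xⱼ` of the stream. -/
def prefixMatrix {n d : ℕ} (x : Fin n → EuclideanSpace ℝ (Fin d)) (j : Fin n) :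
    Matrix (Fin (j + 1)) (Fin d) ℝ :=
  Matrix.of fun i c => x (Fin.castLE j.isLt i) c

/-- `softmax (K q / √d)`. -/
def attnWeights {m d : ℕ} (q : EuclideanSpace ℝ (Fin d)) (K : Matrix (Fin m) (Fin d) ℝ) :
    EuclideanSpace ℝ (Fin m) :=
  WithLp.toLp 2 (softmax fun i => (K *ᵥ q.ofLp) i / Real.sqrt d)

/-- `Attn (q, K, V) = softmax (K q / √d)ᵀ V`. -/
def attn {m d : ℕ} (q : EuclideanSpace ℝ (Fin d)) (K V : Matrix (Fin m) (Fin d) ℝ) :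
    EuclideanSpace ℝ (Fin d) :=
  WithLp.toLp 2 ((attnWeights q K).ofLp ᵥ* V)

def frobenius {m d : ℕ} (A : Matrix (Fin m) (Fin d) ℝ) : ℝ :=
  Real.sqrt (∑ i, ∑ c, A i c ^ 2)

/-- The quantity `√d exp (2r² / √d) / ε`. -/
def baseSize (d : ℕ) (r ε : ℝ) : ℝ :=
  Real.sqrt d * Real.exp (2 * r ^ 2 / Real.sqrt d) / ε

/-- The factor `C (1 + log n)ᵃ` hidden in the notation `Õ`. -/
def polylog (C : ℝ) (a n : ℕ) : ℝ := C * (1 + Real.log n) ^ a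

/-- The parameters with batch size `t = ⌈C (1 + log n)ᵃ √d exp (2r² / √d) / ε⌉`,
`T = max (0, ⌈log₂ (n / t)⌉)` and failure parameter `δ = (n + 1) ^ (-b)`. -/
def params (C : ℝ) (a b n d : ℕ) (r ε : ℝ) : Params where
  n := n
  r := r
  ε := ε
  t := ⌈polylog C a n * baseSize d r ε⌉₊
  T := ⌈Real.logb 2 ((n : ℝ) / ⌈polylog C a n * baseSize d r ε⌉₊)⌉₊
  δ := 1 / ((n : ℝ) + 1) ^ b

end BalanceKV

end

open scoped ENNReal NNReal Matrix

noncomputable section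

namespace BalanceKV

open Prog

/-! ### A program logic for the randomized real RAM -/

/-! The attention vector is a quotient `N / D` of the kernel sums `N = ∑ Wᵢ vᵢ` and `D = ∑ Wᵢ`,
where `Wᵢ = exp (⟨kᵢ, q⟩ / √d)`, and MergeAndReduce estimates such sums. If a batch is replaced by
one of its two sign classes with double weight, the error is, up to sign, `∑ ηᵢ Wᵢ vᵢ`
(`norm_two_smul_sub_smallerClass`). The kernel is an inner product `⟨φ k, φ q⟩` of tensor-power
features (`inner_feature`), so every coordinate of this error is the inner product of a single
vector, the walk `w = ∑ ηᵢ φ(kᵢ) ⊗ vᵢ`, with a test vector `φ(q) ⊗ e_c` (`signedPairSum_apply`).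

The bias of the coins pulls the walk back: with `B = c R²` and aborted runs counted as `0`, `E exp
⟨θ, w⟩ ≤ exp (B ‖θ‖² / 2)` for every `θ` and every length of the batch (`mean_expWalk_le`). Tested
on the features of the batch, this bounds the probability of an abort (`mean_aborted_le`); tested on
the queries, it bounds the error (`holds_chooseSigns`). There, convexity of `y ↦ cosh √y` makes the
failure probability independent of the number `s` of coordinates. One call on values of norm at most
`ρ` thus errs by about `√s · exp (r² / √d) · ρ`, up to logarithms.

After `N` arrivals level `l` has been reduced at most `N / (t 2ˡ)` times, each time with weight
`2ˡ`, so the total error is at most `T N / t` times that of one call (`callWeight_zero_le`). In a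
bucket `ρ = 2ⁱ < 2 ‖v‖`; hence the error of the numerator is proportional to `∑ ‖vᵢ‖`. Because `Wᵢ ≥
exp (-r² / √d)`, Cauchy–Schwarz gives `∑ ‖vᵢ‖ ≤ exp (r² / √d) ‖W‖₂ ‖V‖_F`: this second exponential
is the reason for `exp (2r² / √d)` in `t`. The denominator has a small relative error for the same
reason, erased buckets only contain values below the threshold (`State.GoodInv.num_error`), and a
quotient is stable under such errors (`norm_quotient_sub_le`). The stream is fixed in advance, so a
union bound over all calls and all `n` queries suffices.

The resource bounds hold in every run. A parity count shows that no level holds more than `t` pairs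
between arrivals (`LevelCap.le`); if `T > 0` the living buckets lie in a window of `O(1 + log n)`
indices (`params_wf`), and if `T = 0` the whole stream fits into one batch. The predicate `Runs`
carries these deterministic bounds through the programs, `Holds` the probabilistic ones. -/

theorem Prog.exec_bind {α β : Type} (p : Prog α) (f : α → Prog β) (m : Meter) :
    (p >>= f).exec m = (p.exec m).bind fun x =>
      match x.1 with
      | none => PMF.pure (none, x.2)
      | some a => (f a).exec x.2 := by
  change (p.bind f).exec m = _
  induction p generalizing m with
  | ret a => simp [Prog.bind, Prog.exec]
  | abort => simp [Prog.bind, Prog.exec]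
  | bin o x y k ih => simp only [Prog.bind, Prog.exec, ih]
  | un o x k ih => simp only [Prog.bind, Prog.exec, ih]
  | le x y k ih => simp only [Prog.bind, Prog.exec, ih]
  | ceil x k ih => simp only [Prog.bind, Prog.exec, ih]
  | flip p k ih => simp only [Prog.bind, Prog.exec, ih, PMF.bind_bind]
  | work w k ih => simp only [Prog.bind, Prog.exec, ih]
  | alloc w k ih => simp only [Prog.bind, Prog.exec, ih]
  | free w k ih => simp only [Prog.bind, Prog.exec, ih]

theorem Prog.exec_pure {α : Type} (a : α) (m : Meter) :
    (pure a : Prog α).exec m = PMF.pure (some a, m) := rfl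

/-- `p` deterministically returns `a` in `τ` steps, without touching the memory meter. -/
def Computes {α : Type} (p : Prog α) (a : α) (τ : ℕ) : Prop :=
  ∀ m, p.exec m = PMF.pure (some a, m.tick τ)

theorem Meter.tick_tick (m : Meter) (a b : ℕ) : (m.tick a).tick b = m.tick (a + b) := by
  simp [Meter.tick, add_assoc]

theorem Computes.pure {α : Type} (a : α) : Computes (pure a : Prog α) a 0 := fun _ => rfl

theorem Computes.bind {α β : Type} {p : Prog α} {a : α} {τ : ℕ} {f : α → Prog β} {b : β} {τ' : ℕ}
    (hp : Computes p a τ) (hf : Computes (f a) b τ') : Computes (p >>= f) b (τ + τ') := by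
  intro m
  rw [Prog.exec_bind, hp m, PMF.pure_bind]
  simp only [hf _, Meter.tick_tick]

theorem Computes.of_eq {α : Type} {p : Prog α} {a b : α} {τ τ' : ℕ} (h : Computes p a τ)
    (ha : a = b) (hτ : τ = τ') : Computes p b τ' := ha ▸ hτ ▸ h

theorem computes_addR (x y : ℝ) : Computes (addR x y) (x + y) 1 := fun _ => rfl
theorem computes_subR (x y : ℝ) : Computes (subR x y) (x - y) 1 := fun _ => rfl
theorem computes_mulR (x y : ℝ) : Computes (mulR x y) (x * y) 1 := fun _ => rfl
theorem computes_divR (x y : ℝ) : Computes (divR x y) (x / y) 1 := fun _ => rfl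
theorem computes_powR (x y : ℝ) : Computes (powR x y) (x ^ y) 1 := fun _ => rfl
theorem computes_expR (x : ℝ) : Computes (expR x) (Real.exp x) 1 := fun _ => rfl
theorem computes_logR (x : ℝ) : Computes (logR x) (Real.log x) 1 := fun _ => rfl
theorem computes_sqrtR (x : ℝ) : Computes (sqrtR x) (Real.sqrt x) 1 := fun _ => rfl
theorem computes_ceilR (x : ℝ) : Computes (ceilR x) ⌈x⌉ 1 := fun _ => rfl
theorem computes_leR (x y : ℝ) :
    Computes (leR x y) (@decide (x ≤ y) (Classical.dec _)) 1 := fun _ => rfl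
theorem computes_doWork (w : ℕ) : Computes (doWork w) () w := fun _ => rfl

/-- In every run of `p` from a memory of `u` words, at most `τ` steps are made and at most `π` words
are in use at any time; if `p` returns `a` with `u'` words in use then `Q a u'`. -/
def Runs {α : Type} (u τ π : ℕ) (p : Prog α) (Q : α → ℕ → Prop) : Prop :=
  ∀ m : Meter, m.used = u → ∀ x ∈ (p.exec m).support,
    x.2.time ≤ m.time + τ ∧ x.2.peak ≤ max m.peak π ∧ ∀ a, x.1 = some a → Q a x.2.used

theorem Runs.pure {α : Type} {u τ π : ℕ} {a : α} {Q : α → ℕ → Prop} (h : Q a u) :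
    Runs u τ π (pure a : Prog α) Q := by
  intro m hm x hx
  rw [Prog.exec_pure, PMF.mem_support_pure_iff] at hx
  subst hx
  refine ⟨by simp, by simp, ?_⟩
  rintro b ⟨⟩
  simpa [hm] using h

theorem Runs.abort {α : Type} {u τ π : ℕ} {Q : α → ℕ → Prop} :
    Runs u τ π (Prog.abort : Prog α) Q := by
  intro m hm x hx
  have hx : x ∈ (PMF.pure (none, m) : PMF (Option α × Meter)).support := hx
  rw [PMF.mem_support_pure_iff] at hx
  subst hx
  exact ⟨by simp, by simp, by simp⟩

theorem Runs.mono {α : Type} {u τ τ' π π' : ℕ} {p : Prog α} {Q Q' : α → ℕ → Prop}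
    (h : Runs u τ π p Q) (hτ : τ ≤ τ') (hπ : π ≤ π') (hQ : ∀ a u', Q a u' → Q' a u') :
    Runs u τ' π' p Q' := by
  intro m hm x hx
  obtain ⟨h1, h2, h3⟩ := h m hm x hx
  exact ⟨by omega, by omega, fun a ha => hQ _ _ (h3 a ha)⟩

theorem Runs.bind {α β : Type} {u τ τ' π : ℕ} {p : Prog α} {f : α → Prog β} {Q : α → ℕ → Prop}
    {Q' : β → ℕ → Prop} (hp : Runs u τ π p Q) (hf : ∀ a u', Q a u' → Runs u' τ' π (f a) Q') :
    Runs u (τ + τ') π (p >>= f) Q' := by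
  intro m hm x hx
  rw [Prog.exec_bind, PMF.mem_support_bind_iff] at hx
  obtain ⟨⟨o, m'⟩, hy, hx⟩ := hx
  obtain ⟨h1, h2, h3⟩ := hp m hm _ hy
  cases o with
  | none =>
    simp only [PMF.mem_support_pure_iff] at hx
    subst hx
    simp only at h1 h2
    exact ⟨by simp only; omega, h2, by simp⟩
  | some a =>
    obtain ⟨g1, g2, g3⟩ := hf a m'.used (h3 a rfl) m' rfl x hx
    simp only at h1 h2
    exact ⟨by omega, by omega, g3⟩

theorem Computes.runs {α : Type} {u τ π : ℕ} {p : Prog α} {a : α} {Q : α → ℕ → Prop}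
    (hp : Computes p a τ) (h : Q a u) : Runs u τ π p Q := by
  intro m hm x hx
  rw [hp m, PMF.mem_support_pure_iff] at hx
  subst hx
  refine ⟨by simp [Meter.tick], by simp [Meter.tick], ?_⟩
  rintro b ⟨⟩
  simpa [hm, Meter.tick] using h

theorem Runs.step {α β : Type} {u τ τ' π : ℕ} {p : Prog α} {a : α} {f : α → Prog β}
    {Q : β → ℕ → Prop} (hp : Computes p a τ) (hf : Runs u τ' π (f a) Q) :
    Runs u (τ + τ') π (p >>= f) Q :=
  Runs.bind (hp.runs (Q := fun b u' => b = a ∧ u' = u) ⟨rfl, rfl⟩) fun b u' h => by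
    rw [h.1, h.2]; exact hf

theorem Runs.alloc {β : Type} {u τ π w : ℕ} {f : Unit → Prog β} {Q : β → ℕ → Prop}
    (hw : u + w ≤ π) (hf : Runs (u + w) τ π (f ()) Q) :
    Runs u (w + τ) π (allocW w >>= f) Q := by
  refine Runs.bind (Q := fun _ u' => u' = u + w) ?_ (fun _ u' h => h ▸ hf)
  intro m hm x hx
  have hx : x ∈ (PMF.pure (some (), m.alloc w) : PMF (Option Unit × Meter)).support := hx
  rw [PMF.mem_support_pure_iff] at hx
  subst hx
  refine ⟨by simp [Meter.alloc], ?_, by simp [Meter.alloc, hm]⟩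
  simp only [Meter.alloc]
  omega

/-- The subtraction is truncated; whoever frees words has to know that they are among the `u` in use
to get an exact balance. -/
theorem Runs.free {β : Type} {u τ π w : ℕ} {f : Unit → Prog β} {Q : β → ℕ → Prop}
    (hf : Runs (u - w) τ π (f ()) Q) :
    Runs u (1 + τ) π (freeW w >>= f) Q := by
  refine Runs.bind (Q := fun _ u' => u' = u - w) ?_ (fun _ u' h => h ▸ hf)
  intro m hm x hx
  have hx : x ∈ (PMF.pure (some (), m.free w) : PMF (Option Unit × Meter)).support := hx
  rw [PMF.mem_support_pure_iff] at hx
  subst hx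
  exact ⟨by simp [Meter.free], by simp [Meter.free], by simp [Meter.free, hm]⟩

theorem Runs.flip {β : Type} {u τ π : ℕ} {p : ℝ} {f : Bool → Prog β} {Q : β → ℕ → Prop}
    (hf : ∀ b, Runs u τ π (f b) Q) : Runs u (1 + τ) π (flipR p >>= f) Q := by
  refine Runs.bind (Q := fun _ u' => u' = u) ?_ (fun b u' h => h ▸ hf b)
  intro m hm x hx
  have hx : x ∈ ((coin p).bind fun b =>
    (PMF.pure (some b, m.tick 1) : PMF (Option Bool × Meter))).support := hx
  rw [PMF.mem_support_bind_iff] at hx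
  obtain ⟨b, -, hx⟩ := hx
  rw [PMF.mem_support_pure_iff] at hx
  subst hx
  exact ⟨by simp [Meter.tick], by simp [Meter.tick], by simp [Meter.tick, hm]⟩

/-- Whatever `p` returns satisfies `Q`. -/
def Ensures {α : Type} (p : Prog α) (Q : α → Prop) : Prop :=
  ∀ m : Meter, ∀ x ∈ (p.exec m).support, ∀ a, x.1 = some a → Q a

theorem Ensures.pure {α : Type} {a : α} {Q : α → Prop} (h : Q a) :
    Ensures (pure a : Prog α) Q := by
  intro m x hx b hb
  rw [Prog.exec_pure, PMF.mem_support_pure_iff] at hx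
  subst hx
  cases hb
  exact h

theorem Ensures.abort {α : Type} {Q : α → Prop} : Ensures (Prog.abort : Prog α) Q := by
  intro m x hx b hb
  have hx : x ∈ (PMF.pure (none, m) : PMF (Option α × Meter)).support := hx
  rw [PMF.mem_support_pure_iff] at hx
  subst hx
  cases hb

theorem Ensures.bind {α β : Type} {p : Prog α} {f : α → Prog β} {Q : α → Prop} {Q' : β → Prop}
    (hp : Ensures p Q) (hf : ∀ a, Q a → Ensures (f a) Q') : Ensures (p >>= f) Q' := by
  intro m x hx b hb
  rw [Prog.exec_bind, PMF.mem_support_bind_iff] at hx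
  obtain ⟨⟨o, m'⟩, hy, hx⟩ := hx
  cases o with
  | none =>
    simp only [PMF.mem_support_pure_iff] at hx
    subst hx
    cases hb
  | some a => exact hf a (hp m _ hy a rfl) m' x hx b hb

theorem Ensures.trivial {α : Type} (p : Prog α) : Ensures p fun _ => True :=
  fun _ _ _ _ _ => True.intro

theorem Ensures.skip {α β : Type} {p : Prog α} {f : α → Prog β} {Q' : β → Prop}
    (hf : ∀ a, Ensures (f a) Q') : Ensures (p >>= f) Q' :=
  (Ensures.trivial p).bind fun a _ => hf a

theorem Runs.and_ensures {α : Type} {u τ π : ℕ} {p : Prog α} {Q : α → ℕ → Prop} {E : α → Prop}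
    (h : Runs u τ π p Q) (he : Ensures p E) : Runs u τ π p fun a u' => Q a u' ∧ E a := by
  intro m hm x hx
  obtain ⟨h1, h2, h3⟩ := h m hm x hx
  exact ⟨h1, h2, fun a ha => ⟨h3 a ha, he m x hx a ha⟩⟩

/-- With probability at least `1 - β`, `p` returns a value that satisfies `Q`. -/
def Holds {α : Type} (β : ℝ≥0∞) (p : Prog α) (Q : α → Prop) : Prop :=
  ∀ m : Meter, (p.exec m).toOuterMeasure {x | ¬ ∃ a, x.1 = some a ∧ Q a} ≤ β

/-- A union bound along sequential composition: on `A` the continuation is given up, off `A` it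
fails with probability at most `ε`. It makes failure probabilities add up in `Holds.bind`. -/
theorem _root_.PMF.toOuterMeasure_bind_le {α β : Type} (p : PMF α) (f : α → PMF β) (A : Set α)
    (s : Set β) (ε : ℝ≥0∞) (h : ∀ a ∈ p.support, a ∉ A → (f a).toOuterMeasure s ≤ ε) :
    (p.bind f).toOuterMeasure s ≤ p.toOuterMeasure A + ε := by
  classical
  rw [PMF.toOuterMeasure_bind_apply, PMF.toOuterMeasure_apply]
  calc ∑' a, p a * (f a).toOuterMeasure s
      ≤ ∑' a, (A.indicator p a + p a * ε) := by
        refine ENNReal.tsum_le_tsum fun a => ?_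
        by_cases ha : a ∈ A
        · rw [Set.indicator_of_mem ha]
          refine le_trans ?_ le_self_add
          calc p a * (f a).toOuterMeasure s ≤ p a * 1 := by
                gcongr
                rw [← (f a).toOuterMeasure_apply_eq_one_iff (s := Set.univ) |>.2 (Set.subset_univ _)]
                exact (f a).toOuterMeasure.mono (Set.subset_univ _)
            _ = p a := mul_one _
        · rw [Set.indicator_of_notMem ha, zero_add]
          by_cases h0 : p a = 0
          · simp [h0]
          · gcongr
            exact h a h0 ha
    _ = ∑' a, A.indicator p a + ε := by
        rw [ENNReal.tsum_add, ENNReal.tsum_mul_right, p.tsum_coe, one_mul]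

theorem Holds.pure {α : Type} {β : ℝ≥0∞} {a : α} {Q : α → Prop} (h : Q a) :
    Holds β (pure a : Prog α) Q := by
  intro m
  rw [Prog.exec_pure, PMF.toOuterMeasure_pure_apply, if_neg (by simpa using h)]
  exact zero_le

theorem Holds.bind {α β : Type} {ε ε' : ℝ≥0∞} {p : Prog α} {f : α → Prog β} {Q : α → Prop}
    {Q' : β → Prop} (hp : Holds ε p Q) (hf : ∀ a, Q a → Holds ε' (f a) Q') :
    Holds (ε + ε') (p >>= f) Q' := by
  intro m
  rw [Prog.exec_bind]
  refine (PMF.toOuterMeasure_bind_le _ _ _ _ ε' ?_).trans (add_le_add_left (hp m) ε')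
  rintro ⟨o, m'⟩ - h
  simp only [Set.mem_ofPred_eq, not_not] at h
  obtain ⟨a, rfl, ha⟩ := h
  exact hf a ha m'

theorem Holds.mono {α : Type} {ε ε' : ℝ≥0∞} {p : Prog α} {Q Q' : α → Prop}
    (h : Holds ε p Q) (hε : ε ≤ ε') (hQ : ∀ a, Q a → Q' a) : Holds ε' p Q' := by
  intro m
  refine ((p.exec m).toOuterMeasure.mono ?_).trans ((h m).trans hε)
  intro x hx hx'
  obtain ⟨a, ha, h'⟩ := hx'
  exact hx ⟨a, ha, hQ a h'⟩

theorem Computes.holds {α : Type} {p : Prog α} {a : α} {τ : ℕ} {Q : α → Prop}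
    (hp : Computes p a τ) (h : Q a) : Holds 0 p Q := by
  intro m
  rw [hp m, PMF.toOuterMeasure_pure_apply, if_neg (by simpa using h)]

theorem Holds.step {α β : Type} {ε : ℝ≥0∞} {p : Prog α} {a : α} {τ : ℕ} {f : α → Prog β}
    {Q : β → Prop} (hp : Computes p a τ) (hf : Holds ε (f a) Q) : Holds ε (p >>= f) Q := by
  have := Holds.bind (hp.holds (Q := fun b => b = a) rfl) (fun b hb => by rw [hb]; exact hf)
  rwa [zero_add] at this

theorem Holds.skip {β : Type} {ε : ℝ≥0∞} {p : Prog Unit} {f : Unit → Prog β} {Q : β → Prop}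
    (hp : Holds 0 p fun _ => True) (hf : Holds ε (f ()) Q) : Holds ε (p >>= f) Q := by
  have := Holds.bind hp (fun b _ => hf)
  rwa [zero_add] at this

theorem holds_allocW (w : ℕ) : Holds 0 (allocW w) fun _ => True := by
  intro m
  have : (allocW w).exec m = PMF.pure (some (), m.alloc w) := rfl
  rw [this, PMF.toOuterMeasure_pure_apply, if_neg (by simp)]

theorem holds_freeW (w : ℕ) : Holds 0 (freeW w) fun _ => True := by
  intro m
  have : (freeW w).exec m = PMF.pure (some (), m.free w) := rfl
  rw [this, PMF.toOuterMeasure_pure_apply, if_neg (by simp)]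

theorem Holds.and_ensures {α : Type} {ε : ℝ≥0∞} {p : Prog α} {Q E : α → Prop}
    (h : Holds ε p Q) (he : Ensures p E) : Holds ε p fun a => Q a ∧ E a := by
  intro m
  refine le_trans (PMF.toOuterMeasure_mono _ ?_) (h m)
  rintro x ⟨hx, hs⟩ ⟨a, ha, hq⟩
  exact hx ⟨a, ha, hq, he m x hs a ha⟩


/-! ### The coin and Hoeffding's lemma -/

theorem coin_true {p : ℝ} (h0 : 0 ≤ p) (h1 : p ≤ 1) : coin p true = ENNReal.ofReal p := by
  simp [coin, h0, h1]

theorem coin_false {p : ℝ} (h0 : 0 ≤ p) (h1 : p ≤ 1) : coin p false = ENNReal.ofReal (1 - p) := by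
  simp [coin, h0, h1]

/-- Hoeffding's lemma for a sign of mean `μ`. The values lie in an interval of length 2, so the
variance proxy is `1`; multiplying by `exp (μ y)` undoes the centering. -/
theorem two_point_mgf_le {μ : ℝ} (hμ : |μ| ≤ 1) (y : ℝ) :
    (1 + μ) / 2 * Real.exp y + (1 - (1 + μ) / 2) * Real.exp (-y) ≤
      Real.exp (μ * y + y ^ 2 / 2) := by
  obtain ⟨hl, hu⟩ := abs_le.1 hμ
  have h0 : 0 ≤ (1 + μ) / 2 := by linarith
  have h1 : (1 + μ) / 2 ≤ 1 := by linarith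
  set X : Bool → ℝ := fun b => if b then 1 else -1 with hX
  have hsg := ProbabilityTheory.hasSubgaussianMGF_of_mem_Icc (a := -1) (b := 1)
    (μ := (coin ((1 + μ) / 2)).toMeasure) (X := X)
    (measurable_of_finite X).aemeasurable
    (Filter.Eventually.of_forall fun b => by cases b <;> simp [hX])
  have hmean : ∫ b, X b ∂(coin ((1 + μ) / 2)).toMeasure = μ := by
    rw [PMF.integral_eq_sum]
    simp only [Fintype.sum_bool, coin_true h0 h1, coin_false h0 h1, hX, smul_eq_mul,
      ENNReal.toReal_ofReal h0, ENNReal.toReal_ofReal (sub_nonneg.2 h1), if_true,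
      Bool.false_eq_true, if_false]
    ring
  have := hsg.mgf_le y
  rw [hmean, ProbabilityTheory.mgf, PMF.integral_eq_sum] at this
  simp only [Fintype.sum_bool, coin_true h0 h1, coin_false h0 h1, hX, smul_eq_mul,
      ENNReal.toReal_ofReal h0, ENNReal.toReal_ofReal (sub_nonneg.2 h1), if_true,
      Bool.false_eq_true, if_false] at this
  have hc : (((‖(1 : ℝ) - -1‖₊ / 2) ^ 2 : ℝ≥0) : ℝ) = 1 := by
    push_cast
    norm_num
  rw [hc] at this
  have key := mul_le_mul_of_nonneg_left this (Real.exp_pos (μ * y)).le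
  calc _ = Real.exp (μ * y) * ((1 + μ) / 2 * Real.exp (y * (1 - μ)) +
        (1 - (1 + μ) / 2) * Real.exp (y * (-1 - μ))) := by
        rw [mul_add, mul_left_comm, mul_left_comm (Real.exp (μ * y)), ← Real.exp_add,
          ← Real.exp_add]
        ring_nf
    _ ≤ _ := key
    _ = _ := by rw [← Real.exp_add]; ring_nf

/-- The tangent of the convex function `y ↦ cosh √y` at `L²`. -/
theorem cosh_tangent_le {L : ℝ} (hL : 0 < L) (x : ℝ) :
    Real.cosh L + (x ^ 2 - L ^ 2) * (Real.sinh L / (2 * L)) ≤ Real.cosh x := by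
  wlog hx : 0 ≤ x generalizing x
  · simpa using this (-x) (by linarith)
  have hconv : ConvexOn ℝ (Set.Ici (0 : ℝ)) Real.sinh := by
    refine convexOn_of_deriv2_nonneg (convex_Ici 0) Real.continuous_sinh.continuousOn
      Real.differentiable_sinh.differentiableOn ?_ ?_
    · rw [Real.deriv_sinh]; exact Real.differentiable_cosh.differentiableOn
    · intro y hy
      rw [interior_Ici] at hy
      simp only [Function.iterate_succ, Function.iterate_zero, Function.comp_apply, id,
        Real.deriv_sinh, Real.deriv_cosh]
      exact Real.sinh_nonneg_iff.2 (le_of_lt hy)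
  -- The claim is that `f` is minimal at `L` on the half-line. Its derivative has the sign of `sinh
  -- y / y - sinh L / L`, and this ratio is increasing because `sinh` is convex and vanishes at `0`.
  set f : ℝ → ℝ := fun y => Real.cosh y - y ^ 2 * (Real.sinh L / (2 * L)) with hf
  have hd : ∀ y, HasDerivAt f (Real.sinh y - y * (Real.sinh L / L)) y := by
    intro y
    have h1 := (Real.hasDerivAt_cosh y).sub (((hasDerivAt_id y).pow 2).mul_const
      (Real.sinh L / (2 * L)))
    refine h1.congr_deriv ?_
    simp only [id]
    field_simp
    ring
  have hcont : Continuous f := by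
    refine continuous_iff_continuousAt.2 fun y => (hd y).continuousAt
  have hle : f L ≤ f x := by
    rcases le_total x L with h | h
    · have : AntitoneOn f (Set.Icc 0 L) := by
        refine antitoneOn_of_deriv_nonpos (convex_Icc 0 L) hcont.continuousOn
          (fun y _ => (hd y).differentiableAt.differentiableWithinAt) fun y hy => ?_
        rw [interior_Icc] at hy
        rw [(hd y).deriv, sub_nonpos]
        have h2 := hconv.2 Set.self_mem_Ici (Set.mem_Ici.2 hL.le)
          (show 0 ≤ 1 - y / L by rw [sub_nonneg, div_le_one hL]; exact hy.2.le)
          (show 0 ≤ y / L from div_nonneg hy.1.le hL.le) (by ring)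
        simp only [smul_eq_mul, Real.sinh_zero, mul_zero, zero_add] at h2
        rw [div_mul_cancel₀ _ hL.ne'] at h2
        calc _ ≤ _ := h2
          _ = _ := by ring
      exact this ⟨hx, h⟩ ⟨hL.le, le_rfl⟩ h
    · have : MonotoneOn f (Set.Ici L) := by
        refine monotoneOn_of_deriv_nonneg (convex_Ici L) hcont.continuousOn
          (fun y _ => (hd y).differentiableAt.differentiableWithinAt) fun y hy => ?_
        rw [interior_Ici] at hy
        have hy : L < y := hy
        have hy0 : 0 < y := hL.trans hy
        rw [(hd y).deriv, sub_nonneg]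
        have h2 := hconv.2 Set.self_mem_Ici (Set.mem_Ici.2 hy0.le)
          (show 0 ≤ 1 - L / y by rw [sub_nonneg, div_le_one hy0]; exact hy.le)
          (show 0 ≤ L / y from div_nonneg hL.le hy0.le) (by ring)
        simp only [smul_eq_mul, Real.sinh_zero, mul_zero, zero_add] at h2
        rw [div_mul_cancel₀ _ hy0.ne'] at h2
        rw [mul_div_assoc', div_le_iff₀ hL]
        calc y * Real.sinh L ≤ y * (L / y * Real.sinh y) := by gcongr
          _ = _ := by field_simp
      exact this Set.self_mem_Ici h h
  simp only [hf] at hle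
  linarith

/-- Markov's inequality in a form without exponential dependence on the dimension. -/
theorem cosh_le_sum_cosh {s : ℕ} {L : ℝ} (hL : 0 < L) (x : Fin s → ℝ)
    (h : s * L ^ 2 ≤ ∑ c, x c ^ 2) : s * Real.cosh L ≤ ∑ c, Real.cosh (x c) := by
  -- Jensen's inequality through the tangent at `L²`; since its slope is nonnegative, a mean square
  -- above `L²` only helps.
  have h1 : ∑ c, (Real.cosh L + (x c ^ 2 - L ^ 2) * (Real.sinh L / (2 * L))) ≤
      ∑ c, Real.cosh (x c) := Finset.sum_le_sum fun c _ => cosh_tangent_le hL (x c)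
  rw [Finset.sum_add_distrib, ← Finset.sum_mul, Finset.sum_sub_distrib] at h1
  simp only [Finset.sum_const, Finset.card_univ, Fintype.card_fin, nsmul_eq_mul] at h1
  have : 0 ≤ (∑ c, x c ^ 2 - s * L ^ 2) * (Real.sinh L / (2 * L)) :=
    mul_nonneg (sub_nonneg.2 h) (div_nonneg (Real.sinh_nonneg_iff.2 hL.le) (by linarith))
  linarith

/-! ### The feature map of the kernel `exp (⟨k, k'⟩ / √d)` -/

/-- The coordinates of the tensor powers `k^{⊗ m} / √(√dᵐ m!)`. -/
def featureFun {d : ℕ} (k : EuclideanSpace ℝ (Fin d)) (i : Σ m : ℕ, (Fin m → Fin d)) : ℝ :=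
  (∏ j, k (i.2 j)) / Real.sqrt (Real.sqrt d ^ i.1 * (i.1).factorial)

/-- Expanding the `m`-th power of `∑ k_c k'_c` gives `⟨k^{⊗m}, k'^{⊗m}⟩ = ⟨k, k'⟩ᵐ`, and the
normalization of the coordinates turns this into the `m`-th term of the exponential series. -/
theorem sum_featureFun_mul {d : ℕ} (k k' : EuclideanSpace ℝ (Fin d)) (m : ℕ) :
    ∑ f : Fin m → Fin d, featureFun k ⟨m, f⟩ * featureFun k' ⟨m, f⟩ =
      (inner ℝ k k' / Real.sqrt d) ^ m / m.factorial := by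
  have h0 : 0 ≤ Real.sqrt d ^ m * (m.factorial : ℝ) := by positivity
  simp only [featureFun, div_mul_div_comm, Real.mul_self_sqrt h0, ← Finset.prod_mul_distrib]
  rw [← Finset.sum_div, ← Fintype.sum_pow (fun c => k c * k' c) m, div_pow, div_div,
    PiLp.inner_apply]
  simp [mul_comm]

theorem hasSum_exp_kernel (x : ℝ) : HasSum (fun m : ℕ => x ^ m / m.factorial) (Real.exp x) := by
  rw [Real.exp_eq_exp_ℝ]
  exact NormedSpace.expSeries_div_hasSum_exp x

theorem memℓp_featureFun {d : ℕ} (k : EuclideanSpace ℝ (Fin d)) :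
    Memℓp (fun i : Σ m : ℕ, (Fin m → Fin d) => featureFun k i) 2 := by
  refine memℓp_gen ?_
  have h : ∀ i : Σ m : ℕ, (Fin m → Fin d),
      ‖featureFun k i‖ ^ (2 : ℝ≥0∞).toReal = featureFun k i * featureFun k i := by
    intro i
    simp [← pow_two]
  simp only [h]
  refine (summable_sigma_of_nonneg fun i => mul_self_nonneg _).2 ⟨fun m => ?_, ?_⟩
  · exact (hasSum_fintype _).summable
  · simp only [tsum_fintype, sum_featureFun_mul]
    exact (hasSum_exp_kernel _).summable

/-- A Hilbert space that carries the feature map. -/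
abbrev FeatureSpace (d : ℕ) : Type := lp (fun _ : Σ m : ℕ, (Fin m → Fin d) => ℝ) 2

def feature {d : ℕ} (k : EuclideanSpace ℝ (Fin d)) : FeatureSpace d :=
  ⟨featureFun k, memℓp_featureFun k⟩

/-- The degrees add up to the exponential series. A query thereby becomes a vector against which the
walk can be tested. -/
theorem inner_feature {d : ℕ} (k k' : EuclideanSpace ℝ (Fin d)) :
    inner ℝ (feature k) (feature k') = Real.exp (inner ℝ k k' / Real.sqrt d) := by
  have h1 := lp.hasSum_inner (𝕜 := ℝ) (feature k) (feature k')
  have h2 : ∀ m : ℕ, HasSum (fun f : Fin m → Fin d =>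
      inner ℝ (feature k ⟨m, f⟩) (feature k' ⟨m, f⟩))
      ((inner ℝ k k' / Real.sqrt d) ^ m / m.factorial) := by
    intro m
    rw [← sum_featureFun_mul]
    convert hasSum_fintype _ using 3 with f
    simp [feature, mul_comm]
  exact (h1.sigma h2).unique (hasSum_exp_kernel _)

/-- The tensor product of the feature of the key with the value. -/
def KV.feature {d s : ℕ} (x : KV d s) : PiLp 2 fun _ : Fin s => FeatureSpace d :=
  WithLp.toLp 2 fun c => x.val c • BalanceKV.feature x.key

theorem KV.inner_feature {d s : ℕ} (x y : KV d s) :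
    inner ℝ x.feature y.feature =
      Real.exp (inner ℝ x.key y.key / Real.sqrt d) * inner ℝ x.val y.val := by
  rw [PiLp.inner_apply, PiLp.inner_apply x.val, Finset.mul_sum]
  refine Finset.sum_congr rfl fun c _ => ?_
  simp only [KV.feature, inner_smul_left, inner_smul_right, BalanceKV.inner_feature]
  simp
  ring

/-- The right-hand side is the `R²` of SoftmaxBalance when `ρ` is its value radius. -/
theorem KV.norm_sq_feature_le {d s : ℕ} (x : KV d s) {r ρ : ℝ} (hk : ‖x.key‖ ≤ r)
    (hv : ‖x.val‖ ≤ ρ) :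
    ‖x.feature‖ ^ 2 ≤ Real.exp (r ^ 2 / Real.sqrt d) * ρ ^ 2 := by
  rw [← real_inner_self_eq_norm_sq, KV.inner_feature, real_inner_self_eq_norm_sq,
    real_inner_self_eq_norm_sq]
  gcongr


/-! ### Values and running times of the vector subroutines -/

theorem computes_dotAux {d : ℕ} (x y : EuclideanSpace ℝ (Fin d)) (l : List (Fin d)) (acc : ℝ) :
    Computes (dotAux x y l acc) (acc + (l.map fun i => x i * y i).sum) (2 * l.length) := by
  induction l generalizing acc with
  | nil => simpa [dotAux] using Computes.pure acc
  | cons i l ih =>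
    rw [dotAux]
    refine Computes.of_eq ((computes_mulR _ _).bind ((computes_addR _ _).bind (ih _))) ?_ ?_
    · simp [add_assoc]
    · simp only [List.length_cons]; ring

theorem computes_dot {d : ℕ} (x y : EuclideanSpace ℝ (Fin d)) :
    Computes (dot x y) (inner ℝ x y) (2 * d) := by
  have := computes_dotAux x y (List.finRange d) 0
  rw [List.length_finRange, zero_add, ← List.ofFn_eq_map, List.sum_ofFn] at this
  refine this.of_eq ?_ rfl
  simp [PiLp.inner_apply, mul_comm]

/-- Without `Nodup` the closed form would be false, since a coordinate listed twice is incremented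
twice. -/
theorem computes_axpyAux {d : ℕ} (a : ℝ) (x : EuclideanSpace ℝ (Fin d)) (l : List (Fin d))
    (hl : l.Nodup) (acc : Fin d → ℝ) :
    Computes (axpyAux a x l acc) (fun i => if i ∈ l then acc i + a * x i else acc i)
      (2 * l.length) := by
  induction l generalizing acc with
  | nil => simpa [axpyAux] using Computes.pure acc
  | cons i l ih =>
    rw [List.nodup_cons] at hl
    rw [axpyAux]
    refine Computes.of_eq ((computes_mulR _ _).bind ((computes_addR _ _).bind (ih hl.2 _))) ?_ ?_
    · funext j
      by_cases h : j = i
      · subst h; simp [hl.1]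
      · simp [h]
    · simp only [List.length_cons]; ring

theorem computes_axpy {d : ℕ} (a : ℝ) (x : EuclideanSpace ℝ (Fin d)) (acc : Fin d → ℝ) :
    Computes (axpy a x acc) (acc + a • x.ofLp) (2 * d) := by
  have := computes_axpyAux a x (List.finRange d) (List.nodup_finRange d) acc
  rw [List.length_finRange] at this
  refine this.of_eq ?_ rfl
  funext i
  simp

theorem computes_divAux {d : ℕ} (a : ℝ) (l : List (Fin d)) (hl : l.Nodup) (acc : Fin d → ℝ) :
    Computes (divAux a l acc) (fun i => if i ∈ l then acc i / a else acc i) l.length := by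
  induction l generalizing acc with
  | nil => simpa [divAux] using Computes.pure acc
  | cons i l ih =>
    rw [List.nodup_cons] at hl
    rw [divAux]
    refine Computes.of_eq ((computes_divR _ _).bind (ih hl.2 _)) ?_ ?_
    · funext j
      by_cases h : j = i
      · subst h; simp [hl.1]
      · simp [h]
    · simp only [List.length_cons]; ring

theorem computes_divAll {d : ℕ} (a : ℝ) (acc : Fin d → ℝ) :
    Computes (divAux a (List.finRange d) acc) (a⁻¹ • acc) d := by
  have := computes_divAux a (List.finRange d) (List.nodup_finRange d) acc
  rw [List.length_finRange] at this
  refine this.of_eq ?_ rfl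
  funext i
  simp [div_eq_inv_mul]

/-- The kernel `exp (⟨x, y⟩ / √d)`. -/
def kernel {d : ℕ} (x y : EuclideanSpace ℝ (Fin d)) : ℝ := Real.exp (inner ℝ x y / Real.sqrt d)

theorem kernel_pos {d : ℕ} (x y : EuclideanSpace ℝ (Fin d)) : 0 < kernel x y := Real.exp_pos _

theorem computes_expScore {d : ℕ} (x y : EuclideanSpace ℝ (Fin d)) :
    Computes (expScore x y) (kernel x y) (2 * d + 3) := by
  rw [expScore]
  exact Computes.of_eq ((computes_dot x y).bind ((computes_sqrtR d).bind
    ((computes_divR _ _).bind (computes_expR _)))) rfl rfl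

/-- The sign that a Boolean stands for. -/
def sgn (b : Bool) : ℝ := if b then 1 else -1

theorem computes_signedSum {d s : ℕ} (x : KV d s) (us : List (KV d s × Bool)) (acc : ℝ) :
    Computes (signedSum x us acc)
      (acc + (us.map fun u => sgn u.2 * (kernel u.1.key x.key * inner ℝ u.1.val x.val)).sum)
      (us.length * (2 * d + 2 * s + 5)) := by
  induction us generalizing acc with
  | nil => simpa [signedSum] using Computes.pure acc
  | cons u us ih =>
    obtain ⟨u, b⟩ := u
    rw [signedSum]
    cases b
    · simp only [Bool.false_eq_true, if_false]
      refine Computes.of_eq ((computes_expScore _ _).bind ((computes_dot _ _).bind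
        ((computes_mulR _ _).bind ((computes_subR _ _).bind (ih _))))) ?_ ?_
      · simp [sgn]; ring
      · simp only [List.length_cons]; ring
    · simp only [if_true]
      refine Computes.of_eq ((computes_expScore _ _).bind ((computes_dot _ _).bind
        ((computes_mulR _ _).bind ((computes_addR _ _).bind (ih _))))) ?_ ?_
      · simp [sgn]; ring
      · simp only [List.length_cons]; ring

/-- `∑ exp (⟨k, q⟩ / √d) v` over the listed pairs. -/
def pairSum {d s : ℕ} (q : EuclideanSpace ℝ (Fin d)) (C : List (KV d s)) :
    EuclideanSpace ℝ (Fin s) :=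
  (C.map fun x => kernel x.key q • x.val).sum

theorem pairSum_append {d s : ℕ} (q : EuclideanSpace ℝ (Fin d)) (C C' : List (KV d s)) :
    pairSum q (C ++ C') = pairSum q C + pairSum q C' := by
  simp [pairSum]

theorem computes_addPairs {d s : ℕ} (q : EuclideanSpace ℝ (Fin d)) (c : ℝ) (xs : List (KV d s))
    (acc : Fin s → ℝ) :
    Computes (addPairs q c xs acc) (acc + c • (pairSum q xs).ofLp)
      (xs.length * (2 * d + 2 * s + 4)) := by
  induction xs generalizing acc with
  | nil => simpa [addPairs, pairSum] using Computes.pure acc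
  | cons x xs ih =>
    rw [addPairs]
    refine Computes.of_eq ((computes_expScore _ _).bind ((computes_mulR _ _).bind
      ((computes_axpy _ _ _).bind (ih _)))) ?_ ?_
    · simp [pairSum, add_assoc, smul_smul, smul_add]
    · simp only [List.length_cons]; ring

theorem computes_addLevels {d s : ℕ} (q : EuclideanSpace ℝ (Fin d)) (m : MR d s) (ls : List ℕ)
    (acc : Fin s → ℝ) :
    Computes (addLevels q m ls acc)
      (acc + ((ls.map fun l => (2 : ℝ) ^ l • pairSum q (m.level l)).sum).ofLp)
      ((ls.map fun l => 1 + (m.level l).length * (2 * d + 2 * s + 4)).sum) := by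
  induction ls generalizing acc with
  | nil => simpa [addLevels] using Computes.pure acc
  | cons l ls ih =>
    rw [addLevels]
    refine Computes.of_eq ((computes_powR _ _).bind ((computes_addPairs _ _ _ _).bind (ih _)))
      ?_ ?_
    · simp [add_assoc]
    · simp [add_assoc]

/-- The number of pairs that an instance stores on its levels `0, …, T`. -/
def MR.size {d s : ℕ} (P : Params) (m : MR d s) : ℕ :=
  ∑ l ∈ Finset.range (P.T + 1), (m.level l).length

/-- The estimate that an instance gives for `∑ exp (⟨k, q⟩ / √d) v` over the received pairs. -/
def MR.estimate {d s : ℕ} (P : Params) (m : MR d s) (q : EuclideanSpace ℝ (Fin d)) :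
    EuclideanSpace ℝ (Fin s) :=
  ∑ l ∈ Finset.range (P.T + 1), (2 : ℝ) ^ l • pairSum q (m.level l)

theorem MR.words_eq {d s : ℕ} (P : Params) (m : MR d s) :
    m.words P = P.T + 3 + m.size P * (d + s) := by
  rw [MR.words, MR.size, Finset.sum_mul, MR.overhead]

theorem computes_estimate {d s : ℕ} (P : Params) (q : EuclideanSpace ℝ (Fin d)) (m : MR d s)
    (acc : Fin s → ℝ) :
    Computes (addLevels q m (List.range (P.T + 1)) acc) (acc + (m.estimate P q).ofLp)
      (P.T + 1 + m.size P * (2 * d + 2 * s + 4)) := by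
  have := computes_addLevels q m (List.range (P.T + 1)) acc
  refine this.of_eq rfl ?_
  change ∑ l ∈ Finset.range (P.T + 1), (1 + (m.level l).length * (2 * d + 2 * s + 4)) = _
  rw [Finset.sum_add_distrib, MR.size, Finset.sum_mul]
  simp

theorem computes_addBuckets {d : ℕ} (P : Params) (q : EuclideanSpace ℝ (Fin d))
    (l : List (ℤ × MR d d)) (acc : Fin d → ℝ) :
    Computes (addBuckets P q l acc) (acc + ((l.map fun x : ℤ × MR d d => x.2.estimate P q).sum).ofLp)
      (l.length * (P.T + 1) + (l.map fun x : ℤ × MR d d => x.2.size P).sum * (4 * d + 4)) := by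
  induction l generalizing acc with
  | nil => simpa [addBuckets] using Computes.pure acc
  | cons x l ih =>
    obtain ⟨i, m⟩ := x
    rw [addBuckets]
    refine Computes.of_eq ((computes_estimate _ _ _ _).bind (ih _)) ?_ ?_
    · simp [add_assoc]
    · simp only [List.length_cons, List.map_cons, List.sum_cons]; ring

/-- The value of the erasure threshold. -/
def thresholdVal (d : ℕ) (P : Params) (vmax : ℝ) : ℝ :=
  P.ε / (2 * P.n) * Real.exp (-(P.r ^ 2 / Real.sqrt d)) * vmax

theorem computes_threshold (d : ℕ) (P : Params) (vmax : ℝ) :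
    Computes (threshold d P vmax) (thresholdVal d P vmax) 9 := by
  rw [threshold]
  refine Computes.of_eq ((computes_mulR _ _).bind ((computes_divR _ _).bind
    ((computes_mulR _ _).bind ((computes_sqrtR _).bind ((computes_divR _ _).bind
      ((computes_subR _ _).bind ((computes_expR _).bind ((computes_mulR _ _).bind
        (computes_mulR _ _))))))))) ?_ rfl
  simp only [thresholdVal, pow_two, zero_sub]


/-! ### The self-balancing walk -/

theorem Prog.bind_assoc {α β γ : Type} (p : Prog α) (f : α → Prog β) (g : β → Prog γ) :
    p >>= f >>= g = p >>= fun a => f a >>= g := by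
  change (p.bind f).bind g = p.bind fun a => (f a).bind g
  induction p with
  | ret a => rfl
  | abort => rfl
  | bin o x y k ih => simp only [Prog.bind, ih]
  | un o x k ih => simp only [Prog.bind, ih]
  | le x y k ih => simp only [Prog.bind, ih]
  | ceil x k ih => simp only [Prog.bind, ih]
  | flip p k ih => simp only [Prog.bind, ih]
  | work w k ih => simp only [Prog.bind, ih]
  | alloc w k ih => simp only [Prog.bind, ih]
  | free w k ih => simp only [Prog.bind, ih]

/-- The expected value of `g` of the result of `p`. -/
def mean {α : Type} (p : Prog α) (m : Meter) (g : Option α → ℝ≥0∞) : ℝ≥0∞ :=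
  ∑' x, p.exec m x * g x.1

theorem tsum_pure_mul {α : Type} (a : α) (g : α → ℝ≥0∞) : ∑' x, PMF.pure a x * g x = g a := by
  rw [tsum_eq_single a]
  · simp [PMF.pure_apply]
  · intro b hb; simp [PMF.pure_apply, hb]

theorem mean_pure {α : Type} (a : α) (m : Meter) (g : Option α → ℝ≥0∞) :
    mean (pure a : Prog α) m g = g (some a) :=
  tsum_pure_mul (some a, m) fun x => g x.1

theorem mean_abort {α : Type} (m : Meter) (g : Option α → ℝ≥0∞) :
    mean (Prog.abort : Prog α) m g = g none :=
  tsum_pure_mul (none, m) fun x => g x.1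

theorem tsum_bind_mul {α β : Type} (p : PMF α) (f : α → PMF β) (g : β → ℝ≥0∞) :
    ∑' x, p.bind f x * g x = ∑' a, p a * ∑' x, f a x * g x := by
  simp only [PMF.bind_apply, ← ENNReal.tsum_mul_right, ← ENNReal.tsum_mul_left]
  rw [ENNReal.tsum_comm]
  simp only [mul_assoc]

theorem mean_bind {α β : Type} (p : Prog α) (f : α → Prog β) (m : Meter) (g : Option β → ℝ≥0∞) :
    mean (p >>= f) m g = ∑' x, p.exec m x * (match x.1 with
      | none => g none
      | some a => mean (f a) x.2 g) := by
  rw [mean, Prog.exec_bind, tsum_bind_mul]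
  refine tsum_congr fun x => ?_
  obtain ⟨o, m'⟩ := x
  cases o with
  | none => simp only [tsum_pure_mul]
  | some a => rfl

/-- The tower property as an inequality: `h` bounds the conditional expectation of `g` given the
result of `p`. -/
theorem mean_bind_le {α β : Type} (p : Prog α) (f : α → Prog β) (m : Meter)
    (g : Option β → ℝ≥0∞) (h : Option α → ℝ≥0∞) (h0 : g none ≤ h none)
    (h1 : ∀ a m', mean (f a) m' g ≤ h (some a)) : mean (p >>= f) m g ≤ mean p m h := by
  rw [mean_bind, mean]
  refine ENNReal.tsum_le_tsum fun x => ?_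
  obtain ⟨o, m'⟩ := x
  cases o with
  | none => exact mul_le_mul_right h0 _
  | some a => exact mul_le_mul_right (h1 a m') _

theorem Computes.mean_bind {α β : Type} {p : Prog α} {a : α} {τ : ℕ} (hp : Computes p a τ)
    (f : α → Prog β) (m : Meter) (g : Option β → ℝ≥0∞) :
    mean (p >>= f) m g = mean (f a) (m.tick τ) g := by
  rw [BalanceKV.mean_bind, hp m, tsum_pure_mul]

theorem mean_alloc_bind {β : Type} (w : ℕ) (f : Unit → Prog β) (m : Meter)
    (g : Option β → ℝ≥0∞) : mean (allocW w >>= f) m g = mean (f ()) (m.alloc w) g := rfl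

theorem mean_flip_bind {β : Type} {p : ℝ} (h0 : 0 ≤ p) (h1 : p ≤ 1) (f : Bool → Prog β)
    (m : Meter) (g : Option β → ℝ≥0∞) :
    mean (flipR p >>= f) m g = ENNReal.ofReal p * mean (f true) (m.tick 1) g +
      ENNReal.ofReal (1 - p) * mean (f false) (m.tick 1) g := by
  have : mean (flipR p >>= f) m g =
      ∑' x, ((coin p).bind fun b => (f b).exec (m.tick 1)) x * g x.1 := rfl
  rw [this, tsum_bind_mul, tsum_fintype, Fintype.sum_bool, coin_true h0 h1, coin_false h0 h1]
  rfl

theorem mean_add {α : Type} (p : Prog α) (m : Meter) (g h : Option α → ℝ≥0∞) :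
    mean p m (fun o => g o + h o) = mean p m g + mean p m h := by
  simp only [mean, mul_add, ENNReal.tsum_add]

theorem mean_const_mul {α : Type} (p : Prog α) (m : Meter) (c : ℝ≥0∞) (g : Option α → ℝ≥0∞) :
    mean p m (fun o => c * g o) = c * mean p m g := by
  simp only [mean, ← ENNReal.tsum_mul_left]
  exact tsum_congr fun x => by ring

theorem mean_sum {α ι : Type} (p : Prog α) (m : Meter) (s : Finset ι)
    (g : ι → Option α → ℝ≥0∞) :
    mean p m (fun o => ∑ i ∈ s, g i o) = ∑ i ∈ s, mean p m (g i) := by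
  classical
  induction s using Finset.induction_on with
  | empty => simp [mean]
  | insert i s hi ih => simp only [Finset.sum_insert hi, mean_add, ih]

/-- The signed sum of the features. -/
def walk {d s : ℕ} (l : List (KV d s × Bool)) : PiLp 2 fun _ : Fin s => FeatureSpace d :=
  (l.map fun u => sgn u.2 • u.1.feature).sum

theorem walk_snoc {d s : ℕ} (l : List (KV d s × Bool)) (x : KV d s) (b : Bool) :
    walk (l ++ [(x, b)]) = walk l + sgn b • x.feature := by
  simp [walk]

theorem inner_walk {d s : ℕ} (l : List (KV d s × Bool)) (x : KV d s) :
    inner ℝ (walk l) x.feature =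
      (l.map fun u => sgn u.2 * (kernel u.1.key x.key * inner ℝ u.1.val x.val)).sum := by
  induction l with
  | nil => simp [walk]
  | cons u l ih =>
    have : walk (u :: l) = sgn u.2 • u.1.feature + walk l := by simp [walk]
    rw [this, inner_add_left, ih, inner_smul_left, KV.inner_feature]
    simp [kernel]

theorem computes_signedSum_walk {d s : ℕ} (x : KV d s) (l : List (KV d s × Bool)) :
    Computes (signedSum x l 0) (inner ℝ (walk l) x.feature) (l.length * (2 * d + 2 * s + 5)) := by
  rw [inner_walk, ← zero_add (List.sum _)]
  exact computes_signedSum x l 0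

/-- One step of the main loop when the walk has not left the admissible slab. -/
theorem mean_chooseSigns_cons_le {d s : ℕ} {B : ℝ} (hB : 0 < B) (x : KV d s) (xs : List (KV d s))
    (l : List (KV d s × Bool)) (m : Meter) (g : Option (List (KV d s × Bool)) → ℝ≥0∞)
    (h : |inner ℝ (walk l) x.feature| ≤ B) {G : Bool → ℝ}  (hG : ∀ b, 0 ≤ G b)
    (hg : ∀ b m', mean (chooseSigns B xs (l ++ [(x, b)])) m' g ≤ ENNReal.ofReal (G b)) :
    mean (chooseSigns B (x :: xs) l) m g ≤
      ENNReal.ofReal ((1 + -inner ℝ (walk l) x.feature / B) / 2 * G true +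
        (1 - (1 + -inner ℝ (walk l) x.feature / B) / 2) * G false) := by
  classical
  set w : ℝ := inner ℝ (walk l) x.feature with hw
  obtain ⟨hl, hu⟩ := abs_le.1 h
  -- The coin of the algorithm is a sign with mean `-w / B`, in the parametrization of
  -- `two_point_mgf_le`.
  have hp : 1 / 2 - w / (2 * B) = (1 + -w / B) / 2 := by field_simp; ring
  have h0 : 0 ≤ (1 + -w / B) / 2 := by
    have : -1 ≤ -w / B := by rw [le_div_iff₀ hB]; linarith
    linarith
  have h1 : (1 + -w / B) / 2 ≤ 1 := by
    have : -w / B ≤ 1 := by rw [div_le_iff₀ hB]; linarith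
    linarith
  rw [chooseSigns, (computes_signedSum_walk x l).mean_bind, (computes_subR _ _).mean_bind,
    (computes_leR _ _).mean_bind, (computes_leR _ _).mean_bind, if_pos (by simp [← hw, hu]; linarith),
    (computes_mulR _ _).mean_bind, (computes_divR _ _).mean_bind, (computes_subR _ _).mean_bind,
    ← hw, hp, mean_flip_bind h0 h1, mean_alloc_bind, mean_alloc_bind,
    ENNReal.ofReal_add (mul_nonneg h0 (hG _)) (mul_nonneg (sub_nonneg.2 h1) (hG _)),
    ENNReal.ofReal_mul h0, ENNReal.ofReal_mul (sub_nonneg.2 h1)]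
  gcongr
  · exact hg true _
  · exact hg false _

theorem mean_chooseSigns_cons_of_lt {d s : ℕ} {B : ℝ} (x : KV d s) (xs : List (KV d s))
    (l : List (KV d s × Bool)) (m : Meter) (g : Option (List (KV d s × Bool)) → ℝ≥0∞)
    (h : B < |inner ℝ (walk l) x.feature|) :
    mean (chooseSigns B (x :: xs) l) m g = g none := by
  rw [chooseSigns, (computes_signedSum_walk x l).mean_bind, (computes_subR _ _).mean_bind,
    (computes_leR _ _).mean_bind, (computes_leR _ _).mean_bind, if_neg, mean_abort]
  simp only [Bool.and_eq_true, decide_eq_true_eq, not_and, not_le]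
  intro h1
  rcases lt_abs.1 h with h2 | h2
  · exact absurd h1 (not_le.2 h2)
  · linarith

/-- Splits off the last pair of a batch: its abort test depends on the walk through the earlier
pairs, whose exponential moments are known. -/
theorem chooseSigns_append {d s : ℕ} (B : ℝ) (xs ys : List (KV d s))
    (l : List (KV d s × Bool)) :
    chooseSigns B (xs ++ ys) l = chooseSigns B xs l >>= chooseSigns B ys := by
  induction xs generalizing l with
  | nil => rfl
  | cons x xs ih =>
    simp only [List.cons_append, chooseSigns, Prog.bind_assoc, ih]
    congr 1; funext w; congr 1; funext nB; congr 1; funext hi; congr 1; funext lo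
    split_ifs
    · simp only [Prog.bind_assoc]
    · rfl

/-- `exp ⟨θ, w⟩` where `w` is the final position of the walk, and `0` if the run has aborted. -/
def expWalk {d s : ℕ} (θ : PiLp 2 fun _ : Fin s => FeatureSpace d) :
    Option (List (KV d s × Bool)) → ℝ≥0∞
  | none => 0
  | some l => ENNReal.ofReal (Real.exp (inner ℝ θ (walk l)))

/-- Backward induction on the pairs. The mean `-⟨w, x⟩ / B` of the next sign produces a drift that
is linear in `w`, so it is absorbed by moving the test vector from `θ₁` to `θ₁ - (y / B) x` with `y
= ⟨θ₁, x⟩`. This vector does not depend on the coins. The term `y² / 2` from Hoeffding's lemma is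
paid for by the loss of norm: as `‖x‖² ≤ B`, the quantity `B / 2 · ‖θ‖²` drops by at least `y² - y²
/ 2`. An abort contributes `0` and only helps. -/
theorem exists_mean_expWalk_le {d s : ℕ} {B : ℝ} (hB : 0 < B) (xs : List (KV d s))
    (hxs : ∀ x ∈ xs, ‖x.feature‖ ^ 2 ≤ B) (θ : PiLp 2 fun _ : Fin s => FeatureSpace d) :
    ∃ θ' : PiLp 2 fun _ : Fin s => FeatureSpace d, ∀ l m,
      mean (chooseSigns B xs l) m (expWalk θ) ≤ ENNReal.ofReal
        (Real.exp (inner ℝ θ' (walk l) + B / 2 * (‖θ‖ ^ 2 - ‖θ'‖ ^ 2))) := by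
  induction xs with
  | nil =>
    refine ⟨θ, fun l m => ?_⟩
    rw [chooseSigns, mean_pure]
    simp [expWalk]
  | cons x xs ih =>
    obtain ⟨θ₁, h₁⟩ := ih fun y hy => hxs y (List.mem_cons_of_mem _ hy)
    set y : ℝ := inner ℝ θ₁ x.feature with hy
    refine ⟨θ₁ - (y / B) • x.feature, fun l m => ?_⟩
    rcases lt_or_ge B |inner ℝ (walk l) x.feature| with h | h
    · rw [mean_chooseSigns_cons_of_lt x xs l m _ h]
      exact zero_le
    refine (mean_chooseSigns_cons_le hB x xs l m _ h (fun b => (Real.exp_pos _).le)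
      (fun b m' => h₁ _ m')).trans (ENNReal.ofReal_le_ofReal ?_)
    set w : ℝ := inner ℝ (walk l) x.feature with hw
    have hμ : |-w / B| ≤ 1 := by rw [abs_div, abs_neg, abs_of_pos hB, div_le_one hB]; exact h
    have hx := hxs x List.mem_cons_self
    set A : ℝ := inner ℝ θ₁ (walk l) with hA
    have e : ∀ b, inner ℝ θ₁ (walk (l ++ [(x, b)])) = A + sgn b * y := by
      intro b
      rw [walk_snoc, inner_add_right, inner_smul_right]
    have e2 : inner ℝ (θ₁ - (y / B) • x.feature) (walk l) = A - y / B * w := by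
      rw [inner_sub_left, real_inner_smul_left, real_inner_comm (walk l) x.feature]
    have e3 : ‖θ₁ - (y / B) • x.feature‖ ^ 2 =
        ‖θ₁‖ ^ 2 - 2 * (y / B) * y + (y / B) ^ 2 * ‖x.feature‖ ^ 2 := by
      rw [norm_sub_sq_real, real_inner_smul_right, norm_smul, mul_pow, Real.norm_eq_abs, sq_abs]
      ring
    have h3 := two_point_mgf_le hμ y
    set Z := A + B / 2 * (‖θ‖ ^ 2 - ‖θ₁‖ ^ 2) with hZ
    simp only [e, sgn, if_true, Bool.false_eq_true, if_false]
    calc (1 + -w / B) / 2 * Real.exp (A + 1 * y + B / 2 * (‖θ‖ ^ 2 - ‖θ₁‖ ^ 2)) +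
          (1 - (1 + -w / B) / 2) * Real.exp (A + -1 * y + B / 2 * (‖θ‖ ^ 2 - ‖θ₁‖ ^ 2))
        = Real.exp Z * ((1 + -w / B) / 2 * Real.exp y +
          (1 - (1 + -w / B) / 2) * Real.exp (-y)) := by
          rw [mul_add, mul_left_comm, mul_left_comm (Real.exp Z), ← Real.exp_add, ← Real.exp_add,
            hZ]
          ring_nf
      _ ≤ Real.exp Z * Real.exp (-w / B * y + y ^ 2 / 2) :=
          mul_le_mul_of_nonneg_left h3 (Real.exp_pos _).le
      _ ≤ _ := by
          rw [← Real.exp_add, Real.exp_le_exp, e2, e3, hZ]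
          have h4 : B / 2 * ((y / B) ^ 2 * ‖x.feature‖ ^ 2) ≤ B / 2 * ((y / B) ^ 2 * B) := by
            gcongr
          have h5 : B / 2 * ((y / B) ^ 2 * B) = y ^ 2 / 2 := by field_simp
          have h6 : B / 2 * (2 * (y / B) * y) = y ^ 2 := by field_simp
          have h7 : -w / B * y = -(y / B * w) := by ring
          rw [h7]
          nlinarith [h4, h5, h6]

/-- The walk starts at `0`, so only the norms survive and the negative one is dropped. The result is
sub-Gaussian with variance proxy `B` in all directions, regardless of the number of steps. -/
theorem mean_expWalk_le {d s : ℕ} {B : ℝ} (hB : 0 < B) (xs : List (KV d s))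
    (hxs : ∀ x ∈ xs, ‖x.feature‖ ^ 2 ≤ B) (θ : PiLp 2 fun _ : Fin s => FeatureSpace d)
    (m : Meter) :
    mean (chooseSigns B xs []) m (expWalk θ) ≤ ENNReal.ofReal (Real.exp (B / 2 * ‖θ‖ ^ 2)) := by
  obtain ⟨θ', h⟩ := exists_mean_expWalk_le hB xs hxs θ
  refine (h [] m).trans (ENNReal.ofReal_le_ofReal (Real.exp_le_exp.2 ?_))
  simp only [walk, List.map_nil, List.sum_nil, inner_zero_right, zero_add]
  gcongr
  linarith [sq_nonneg ‖θ'‖]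

/-- The indicator of an aborted run. -/
def aborted {α : Type} : Option α → ℝ≥0∞
  | none => 1
  | some _ => 0

/-- An abort at `x` means `|⟨w, x⟩| > c ρ`. The test vectors `±x / ρ` have squared norm at most `1 /
ρ` and hence exponential moment at most `exp (c / 2)`; Markov's inequality at level `exp c` costs `2
exp (-c / 2)` for each pair. -/
theorem mean_aborted_le {d s : ℕ} {c ρ : ℝ} (hc : 1 ≤ c) (hρ : 0 < ρ) (xs : List (KV d s))
    (hxs : ∀ x ∈ xs, ‖x.feature‖ ^ 2 ≤ ρ) (m : Meter) :
    mean (chooseSigns (c * ρ) xs []) m aborted ≤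
      xs.length * ENNReal.ofReal (2 * Real.exp (-c / 2)) := by
  have hB : 0 < c * ρ := by positivity
  induction xs using List.reverseRecOn with
  | nil => rw [chooseSigns, mean_pure]; simp [aborted]
  | append_singleton xs x ih =>
    have hx := hxs x (by simp)
    have hxs' : ∀ y ∈ xs, ‖y.feature‖ ^ 2 ≤ ρ := fun y hy => hxs y (by simp [hy])
    have hxs'' : ∀ y ∈ xs, ‖y.feature‖ ^ 2 ≤ c * ρ := fun y hy =>
      (hxs' y hy).trans (by nlinarith)
    rw [chooseSigns_append]
    set E : ℝ≥0∞ := ENNReal.ofReal (Real.exp (-c)) with hE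
    -- The two exponentials multiplied by `exp (-c)` sum to at least `1` whenever the test at `x`
    -- fails, so they dominate the indicator of an abort at `x`; `aborted o` accounts for earlier
    -- aborts.
    refine (mean_bind_le _ _ _ _ (fun o => aborted o + E * (expWalk (ρ⁻¹ • x.feature) o +
      expWalk (-(ρ⁻¹ • x.feature)) o)) (by simp [aborted]) ?_).trans ?_
    · intro l m'
      rcases lt_or_ge (c * ρ) |inner ℝ (walk l) x.feature| with h | h
      · rw [mean_chooseSigns_cons_of_lt _ _ _ _ _ h]
        simp only [aborted, expWalk, zero_add, hE]
        rw [← ENNReal.ofReal_add (Real.exp_pos _).le (Real.exp_pos _).le,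
          ← ENNReal.ofReal_mul (Real.exp_pos _).le, ← ENNReal.ofReal_one]
        refine ENNReal.ofReal_le_ofReal ?_
        rw [inner_neg_left, real_inner_smul_left, real_inner_comm, mul_add, ← Real.exp_add,
          ← Real.exp_add]
        rcases lt_abs.1 h with h | h
        · have : 0 ≤ -c + ρ⁻¹ * inner ℝ (walk l) x.feature := by
            rw [inv_mul_eq_div]
            have := (lt_div_iff₀ hρ).2 h
            linarith
          linarith [Real.one_le_exp this, Real.exp_pos (-c + -(ρ⁻¹ * inner ℝ (walk l) x.feature))]
        · have : 0 ≤ -c + -(ρ⁻¹ * inner ℝ (walk l) x.feature) := by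
            rw [inv_mul_eq_div, ← neg_div]
            have := (lt_div_iff₀ hρ).2 h
            linarith
          linarith [Real.one_le_exp this, Real.exp_pos (-c + ρ⁻¹ * inner ℝ (walk l) x.feature)]
      · refine (mean_chooseSigns_cons_le hB x [] l m' _ h (G := fun _ => 0) (fun _ => le_rfl)
          fun b m'' => ?_).trans (by simp)
        rw [chooseSigns, mean_pure]
        simp [aborted]
    · rw [mean_add, mean_const_mul, mean_add]
      have hn : ‖ρ⁻¹ • x.feature‖ ^ 2 ≤ ρ⁻¹ := by
        rw [norm_smul, mul_pow, Real.norm_eq_abs, sq_abs]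
        calc ρ⁻¹ ^ 2 * ‖x.feature‖ ^ 2 ≤ ρ⁻¹ ^ 2 * ρ := by gcongr
          _ = ρ⁻¹ := by field_simp
      have hq : ∀ θ : PiLp 2 fun _ : Fin s => FeatureSpace d, ‖θ‖ ^ 2 ≤ ρ⁻¹ →
          mean (chooseSigns (c * ρ) xs []) m (expWalk θ) ≤
            ENNReal.ofReal (Real.exp (c / 2)) := by
        intro θ hθ
        refine (mean_expWalk_le hB xs hxs'' θ m).trans
          (ENNReal.ofReal_le_ofReal (Real.exp_le_exp.2 ?_))
        calc c * ρ / 2 * ‖θ‖ ^ 2 ≤ c * ρ / 2 * ρ⁻¹ := by gcongr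
          _ = c / 2 := by field_simp
      calc _ ≤ xs.length * ENNReal.ofReal (2 * Real.exp (-c / 2)) +
            E * (ENNReal.ofReal (Real.exp (c / 2)) + ENNReal.ofReal (Real.exp (c / 2))) := by
            gcongr
            · exact ih hxs'
            · exact hq _ hn
            · exact hq _ (by rwa [norm_neg])
        _ = _ := by
            rw [hE, ← ENNReal.ofReal_add (Real.exp_pos _).le (Real.exp_pos _).le,
              ← ENNReal.ofReal_mul (Real.exp_pos _).le, ← two_mul, mul_left_comm, ← Real.exp_add,
              List.length_append, List.length_singleton]
            push_cast
            rw [add_mul, one_mul]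
            ring_nf


/-! ### SoftmaxBalance -/

theorem holds_of_mean_le {α : Type} {β : ℝ≥0∞} {p : Prog α} {Q : α → Prop}
    (g : Option α → ℝ≥0∞) (hg : ∀ o : Option α, (¬ ∃ a, o = some a ∧ Q a) → 1 ≤ g o)
    (h : ∀ m, mean p m g ≤ β) : Holds β p Q := by
  intro m
  refine le_trans ?_ (h m)
  rw [PMF.toOuterMeasure_apply, mean]
  refine ENNReal.tsum_le_tsum fun x => ?_
  by_cases hx : ∃ a, x.1 = some a ∧ Q a
  · rw [Set.indicator_of_notMem (by simpa using hx)]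
    exact zero_le
  · rw [Set.indicator_of_mem (by exact hx)]
    calc p.exec m x = p.exec m x * 1 := (mul_one _).symm
      _ ≤ _ := mul_le_mul_right (hg _ hx) _

/-! ### Resources of SoftmaxBalance and the error of a halved batch -/

theorem chooseSigns_ensures {d s : ℕ} (B : ℝ) (xs : List (KV d s)) (l : List (KV d s × Bool)) :
    Ensures (chooseSigns B xs l) fun l' => l'.map Prod.fst = l.map Prod.fst ++ xs := by
  induction xs generalizing l with
  | nil => exact Ensures.pure (by simp)
  | cons x xs ih =>
    rw [chooseSigns]
    refine Ensures.skip fun w => Ensures.skip fun nB => Ensures.skip fun hi =>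
      Ensures.skip fun lo => ?_
    split_ifs
    · refine Ensures.skip fun _ => Ensures.skip fun _ => Ensures.skip fun _ =>
        Ensures.skip fun b => Ensures.skip fun _ => ?_
      simpa using ih (l ++ [(x, b)])
    · exact Ensures.abort

theorem chooseSigns_runs {d s : ℕ} (B : ℝ) (N π : ℕ) (xs : List (KV d s))
    (l : List (KV d s × Bool)) (u : ℕ) (hN : l.length + xs.length ≤ N)
    (hπ : u + xs.length ≤ π) :
    Runs u (xs.length * (N * (2 * d + 2 * s + 5) + 8)) π (chooseSigns B xs l)
      fun _ u' => u' = u + xs.length := by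
  induction xs generalizing l u with
  | nil => exact Runs.pure (by simp)
  | cons x xs ih =>
    rw [List.length_cons] at hN hπ
    rw [chooseSigns]
    have hl : l.length * (2 * d + 2 * s + 5) ≤ N * (2 * d + 2 * s + 5) :=
      Nat.mul_le_mul_right _ (by omega)
    refine Runs.mono (Runs.step (computes_signedSum_walk x l) (Runs.step (computes_subR _ _)
      (Runs.step (computes_leR _ _) (Runs.step (computes_leR _ _)
        (τ' := 5 + xs.length * (N * (2 * d + 2 * s + 5) + 8)) (π := π)
        (Q := fun _ u' => u' = u + (x :: xs).length) ?_)))) ?_ le_rfl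
        (fun _ _ h => h)
    · split_ifs
      · refine Runs.mono (Runs.step (computes_mulR _ _) (Runs.step (computes_divR _ _)
          (Runs.step (computes_subR _ _) (Runs.flip fun b => Runs.alloc (by omega)
            (ih (l ++ [(x, b)]) (u + 1) (by simp; omega) (by omega)))))) ?_ le_rfl ?_
        · omega
        · intro _ u' h
          simp only [List.length_cons]
          omega
      · exact Runs.abort
    · simp only [List.length_cons, add_mul, one_mul]
      omega

theorem length_withSign {d s : ℕ} (l : List (KV d s × Bool)) :
    (withSign true l).length + (withSign false l).length = l.length := by
  induction l with
  | nil => rfl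
  | cons u l ih =>
    obtain ⟨u, b⟩ := u
    simp only [withSign, List.length_map] at ih ⊢
    cases b <;> simp at ih ⊢ <;> omega

theorem withSign_subset {d s : ℕ} (b : Bool) (l : List (KV d s × Bool)) :
    withSign b l ⊆ l.map Prod.fst :=
  List.map_subset _ (List.filter_subset_self _)

/-- The smaller sign class. -/
def smallerClass {d s : ℕ} (l : List (KV d s × Bool)) : List (KV d s) :=
  if (withSign true l).length ≤ (withSign false l).length
    then withSign true l else withSign false l

theorem two_mul_length_smallerClass_le {d s : ℕ} (l : List (KV d s × Bool)) :
    2 * (smallerClass l).length ≤ l.length := by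
  have := length_withSign l
  unfold smallerClass
  split_ifs <;> omega

theorem smallerClass_subset {d s : ℕ} (l : List (KV d s × Bool)) :
    smallerClass l ⊆ l.map Prod.fst := by
  unfold smallerClass
  split_ifs <;> exact withSign_subset _ _

/-- `∑ ηᵢ exp (⟨kᵢ, q⟩ / √d) vᵢ`. -/
def signedPairSum {d s : ℕ} (q : EuclideanSpace ℝ (Fin d)) (l : List (KV d s × Bool)) :
    EuclideanSpace ℝ (Fin s) :=
  (l.map fun u => sgn u.2 • kernel u.1.key q • u.1.val).sum

theorem pairSum_withSign {d s : ℕ} (q : EuclideanSpace ℝ (Fin d)) (l : List (KV d s × Bool)) :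
    pairSum q (l.map Prod.fst) = pairSum q (withSign true l) + pairSum q (withSign false l) ∧
    signedPairSum q l = pairSum q (withSign true l) - pairSum q (withSign false l) := by
  induction l with
  | nil => simp [pairSum, signedPairSum, withSign]
  | cons u l ih =>
    obtain ⟨u, b⟩ := u
    have h1 : pairSum q (((u, b) :: l).map Prod.fst) =
      kernel u.key q • u.val + pairSum q (l.map Prod.fst) := by simp [pairSum]
    have h2 : signedPairSum q ((u, b) :: l) =
      sgn b • kernel u.key q • u.val + signedPairSum q l := by simp [signedPairSum]
    rw [h1, h2, ih.1, ih.2]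
    cases b
    · have h3 : withSign true ((u, false) :: l) = withSign true l := by simp [withSign]
      have h4 : withSign false ((u, false) :: l) = u :: withSign false l := by simp [withSign]
      have h5 : pairSum q (u :: withSign false l) =
        kernel u.key q • u.val + pairSum q (withSign false l) := by simp [pairSum]
      rw [h3, h4, h5]
      constructor
      · abel
      · simp [sgn]; abel
    · have h3 : withSign false ((u, true) :: l) = withSign false l := by simp [withSign]
      have h4 : withSign true ((u, true) :: l) = u :: withSign true l := by simp [withSign]
      have h5 : pairSum q (u :: withSign true l) =
        kernel u.key q • u.val + pairSum q (withSign true l) := by simp [pairSum]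
      rw [h3, h4, h5]
      constructor
      · abel
      · simp [sgn]; abel

/-- Doubling the positive class overshoots by the signed sum, doubling the negative class by its
opposite. The choice of the smaller class, made for the sake of memory, therefore does not affect
the accuracy. -/
theorem norm_two_smul_sub_smallerClass {d s : ℕ} (q : EuclideanSpace ℝ (Fin d))
    (l : List (KV d s × Bool)) :
    ‖(2 : ℝ) • pairSum q (smallerClass l) - pairSum q (l.map Prod.fst)‖ =
      ‖signedPairSum q l‖ := by
  obtain ⟨h1, h2⟩ := pairSum_withSign q l
  rw [h1, h2, two_smul, smallerClass]
  split_ifs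
  · congr 1; abel
  · rw [← norm_neg]; congr 1; abel

/-- The error at the query `q` is a finite family of linear functionals of the walk; this is how the
sub-Gaussian bound reaches it. -/
theorem signedPairSum_apply {d s : ℕ} (q : EuclideanSpace ℝ (Fin d)) (l : List (KV d s × Bool))
    (c : Fin s) : signedPairSum q l c =
      inner ℝ (⟨q, EuclideanSpace.single c 1⟩ : KV d s).feature (walk l) := by
  rw [real_inner_comm, inner_walk]
  induction l with
  | nil => simp [signedPairSum]
  | cons u l ih =>
    have h2 : signedPairSum q (u :: l) =
      sgn u.2 • kernel u.1.key q • u.1.val + signedPairSum q l := by simp [signedPairSum]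
    rw [h2, PiLp.add_apply, ih, List.map_cons, List.sum_cons, EuclideanSpace.inner_single_right]
    simp

/-- The concentration of the self-balancing walk, seen from finitely many queries at a time. -/
theorem holds_chooseSigns {d s : ℕ} (hs : 0 < s) {r ρ c L : ℝ} (hρ : 0 < ρ) (hc : 1 ≤ c)
    (hL : 0 < L) (C : List (KV d s)) (hC : ∀ x ∈ C, ‖x.feature‖ ^ 2 ≤ ρ) {ι : Type} [Fintype ι]
    (q : ι → EuclideanSpace ℝ (Fin d)) (hq : ∀ j, ‖q j‖ ≤ r) :
    Holds (C.length * ENNReal.ofReal (2 * Real.exp (-c / 2)) +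
        Fintype.card ι * ENNReal.ofReal (Real.exp (1 / 2) / Real.cosh L))
      (chooseSigns (c * ρ) C []) fun l => ∀ j, ‖signedPairSum (q j) l‖ ≤
        Real.sqrt s * (L * Real.sqrt (c * ρ * Real.exp (r ^ 2 / Real.sqrt d))) := by
  have hB : 0 < c * ρ := by positivity
  set e : ℝ := Real.exp (r ^ 2 / Real.sqrt d) with he
  have he0 : 0 < e := Real.exp_pos _
  set σ : ℝ := Real.sqrt (c * ρ * e) with hσ
  have hσ0 : 0 < σ := Real.sqrt_pos.2 (by positivity)
  have hσ2 : σ ^ 2 = c * ρ * e := Real.sq_sqrt (by positivity)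
  have hs' : (0 : ℝ) < s := by exact_mod_cast hs
  have hcosh := Real.cosh_pos L
  -- The scale `σ` makes `‖θ‖² ≤ (c ρ)⁻¹`, for which the exponential moment is at most `exp (1 /
  -- 2)`.
  let θ : ι → Fin s → PiLp 2 fun _ : Fin s => FeatureSpace d := fun j i =>
    σ⁻¹ • (⟨q j, EuclideanSpace.single i 1⟩ : KV d s).feature
  have hθ : ∀ j i, ‖θ j i‖ ^ 2 ≤ (c * ρ)⁻¹ := by
    intro j i
    rw [norm_smul, mul_pow, Real.norm_eq_abs, sq_abs]
    have := KV.norm_sq_feature_le (⟨q j, EuclideanSpace.single i 1⟩ : KV d s) (hq j) (ρ := 1)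
      (by simp)
    rw [one_pow, mul_one, ← he] at this
    calc σ⁻¹ ^ 2 * _ ≤ σ⁻¹ ^ 2 * e := by gcongr
      _ = (c * ρ)⁻¹ := by rw [inv_pow, hσ2]; field_simp
  -- If the error at some query exceeds the bound, the `s` hyperbolic cosines of its scaled
  -- coordinates sum to at least `s cosh L`. With the weight `a` the corresponding exponentials then
  -- sum to at least `1`; in expectation they cost `exp (1 / 2) / cosh L`, where `s` has cancelled.
  set a : ℝ := 1 / (2 * s * Real.cosh L) with ha
  have ha0 : 0 < a := by positivity
  refine holds_of_mean_le (fun o => aborted o + ∑ j : ι, ∑ i : Fin s,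
    ENNReal.ofReal a * (expWalk (θ j i) o + expWalk (-θ j i) o)) ?_ ?_
  · intro o ho
    cases o with
    | none => simp [aborted]
    | some l =>
      simp only [Option.some.injEq, exists_eq_left', not_forall, not_le] at ho
      obtain ⟨j, hj⟩ := ho
      have hx : ∀ i, inner ℝ (θ j i) (walk l) = signedPairSum (q j) l i / σ := by
        intro i
        rw [signedPairSum_apply, real_inner_smul_left, inv_mul_eq_div]
      have h1 : s * L ^ 2 ≤ ∑ i, (signedPairSum (q j) l i / σ) ^ 2 := by
        have h2 : (Real.sqrt s * (L * σ)) ^ 2 ≤ ‖signedPairSum (q j) l‖ ^ 2 := by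
          gcongr
        rw [mul_pow, Real.sq_sqrt hs'.le, EuclideanSpace.norm_sq_eq, mul_pow] at h2
        simp only [div_pow, ← Finset.sum_div]
        rw [le_div_iff₀ (by positivity)]
        simpa [mul_assoc] using h2
      have h3 := cosh_le_sum_cosh hL _ h1
      calc (1 : ℝ≥0∞) = ENNReal.ofReal 1 := ENNReal.ofReal_one.symm
        _ ≤ ENNReal.ofReal (∑ i, a * (Real.exp (inner ℝ (θ j i) (walk l)) +
              Real.exp (inner ℝ (-θ j i) (walk l)))) := by
            refine ENNReal.ofReal_le_ofReal ?_
            simp only [inner_neg_left, hx]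
            have h4 : ∀ y : ℝ, Real.exp y + Real.exp (-y) = 2 * Real.cosh y := by
              intro y; rw [Real.cosh_eq]; ring
            simp only [h4, ← Finset.mul_sum]
            rw [ha, div_mul_eq_mul_div, one_mul, le_div_iff₀ (by positivity)]
            linarith
        _ = ∑ i : Fin s, ENNReal.ofReal a * (expWalk (θ j i) (some l) +
              expWalk (-θ j i) (some l)) := by
            rw [ENNReal.ofReal_sum_of_nonneg (fun i _ => by positivity)]
            refine Finset.sum_congr rfl fun i _ => ?_
            rw [ENNReal.ofReal_mul ha0.le, ENNReal.ofReal_add (Real.exp_pos _).le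
              (Real.exp_pos _).le]
            rfl
        _ ≤ ∑ j : ι, ∑ i : Fin s, ENNReal.ofReal a * (expWalk (θ j i) (some l) +
              expWalk (-θ j i) (some l)) :=
            Finset.single_le_sum (f := fun j => ∑ i : Fin s, ENNReal.ofReal a *
              (expWalk (θ j i) (some l) + expWalk (-θ j i) (some l)))
              (fun _ _ => zero_le) (Finset.mem_univ j)
        _ ≤ _ := le_add_self
  · intro m
    have hC' : ∀ x ∈ C, ‖x.feature‖ ^ 2 ≤ c * ρ := fun x hx => (hC x hx).trans (by nlinarith)
    have hq : ∀ θ : PiLp 2 fun _ : Fin s => FeatureSpace d, ‖θ‖ ^ 2 ≤ (c * ρ)⁻¹ →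
        mean (chooseSigns (c * ρ) C []) m (expWalk θ) ≤ ENNReal.ofReal (Real.exp (1 / 2)) := by
      intro θ hθ
      refine (mean_expWalk_le hB C hC' θ m).trans
        (ENNReal.ofReal_le_ofReal (Real.exp_le_exp.2 ?_))
      calc c * ρ / 2 * ‖θ‖ ^ 2 ≤ c * ρ / 2 * (c * ρ)⁻¹ := by gcongr
        _ = 1 / 2 := by field_simp
    rw [mean_add, mean_sum]
    refine add_le_add (mean_aborted_le hc hρ C hC m) ?_
    calc _ ≤ ∑ j : ι, ∑ i : Fin s, ENNReal.ofReal a * (ENNReal.ofReal (Real.exp (1 / 2)) +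
          ENNReal.ofReal (Real.exp (1 / 2))) := by
          refine Finset.sum_le_sum fun j _ => ?_
          rw [mean_sum]
          refine Finset.sum_le_sum fun i _ => ?_
          rw [mean_const_mul, mean_add]
          gcongr
          · exact hq _ (hθ j i)
          · exact hq _ (by rw [norm_neg]; exact hθ j i)
      _ = _ := by
          rw [Finset.sum_const, Finset.sum_const, Finset.card_univ, Finset.card_univ,
            Fintype.card_fin, nsmul_eq_mul, nsmul_eq_mul, ← ENNReal.ofReal_add
            (Real.exp_pos _).le (Real.exp_pos _).le, ← ENNReal.ofReal_mul ha0.le,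
            ← ENNReal.ofReal_natCast s, ← ENNReal.ofReal_mul hs'.le]
          congr 2
          rw [ha]
          field_simp
          norm_num

theorem softmaxBalance_ensures {d s : ℕ} (n : ℕ) (rkey rval δ : ℝ) (C : List (KV d s)) :
    Ensures (softmaxBalance n rkey rval δ C) fun out => out ⊆ C ∧ 2 * out.length ≤ C.length := by
  rw [softmaxBalance]
  -- Eleven arithmetic operations precede the main loop.
  iterate 11 refine Ensures.skip fun _ => ?_
  refine Ensures.bind (chooseSigns_ensures _ C []) fun l hl => ?_
  rw [List.map_nil, List.nil_append] at hl
  refine Ensures.skip fun _ => Ensures.skip fun _ => Ensures.skip fun _ => Ensures.pure ?_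
  have h1 := smallerClass_subset l
  have h2 := two_mul_length_smallerClass_le l
  rw [hl] at h1
  rw [← List.length_map (f := Prod.fst), hl] at h2
  exact ⟨h1, h2⟩

theorem softmaxBalance_runs {d s : ℕ} (n : ℕ) (rkey rval δ : ℝ) (C : List (KV d s)) (u π : ℕ)
    (hπ : u + C.length + C.length * (d + s) ≤ π) :
    Runs u (12 + C.length * (C.length * (2 * d + 2 * s + 5) + 9 + (d + s))) π
      (softmaxBalance n rkey rval δ C) fun out u' => u' = u + out.length * (d + s) ∧
        out ⊆ C ∧ 2 * out.length ≤ C.length := by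
  refine Runs.and_ensures ?_ (softmaxBalance_ensures n rkey rval δ C)
  rw [softmaxBalance]
  have hsub : ∀ l : List (KV d s × Bool), l.map Prod.fst = ([] : List (KV d s × Bool)).map Prod.fst ++ C →
      (smallerClass l).length * (d + s) ≤ C.length * (d + s) := by
    intro l hl
    have h2 := two_mul_length_smallerClass_le l
    rw [← List.length_map (f := Prod.fst), hl] at h2
    simp only [List.map_nil, List.nil_append] at h2
    exact Nat.mul_le_mul_right _ (by omega)
  refine Runs.mono (Runs.step (computes_mulR _ _) (Runs.step (computes_sqrtR _)
    (Runs.step (computes_mulR _ _) (Runs.step (computes_divR _ _) (Runs.step (computes_expR _)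
    (Runs.step (computes_mulR _ _) (Runs.step (computes_divR _ _) (Runs.step (computes_logR _)
    (Runs.step (computes_mulR _ _) (Runs.step (computes_mulR _ _) (Runs.step (computes_mulR _ _)
    (Runs.bind (τ' := C.length + (C.length * (d + s) + 1))
      (Q' := fun out u' => u' = u + out.length * (d + s))
      ((chooseSigns_runs _ C.length π C [] u (by simp) (by omega)).and_ensures
      (chooseSigns_ensures _ C [])) ?_)))))))))))) ?_ le_rfl (fun _ _ h => h)
  · rintro l u' ⟨rfl, hl⟩
    have := hsub l hl
    refine Runs.mono (Runs.step (computes_doWork _) (Runs.alloc (w := (smallerClass l).length *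
      (d + s)) (by omega) (Runs.free (w := C.length) (Runs.pure (a := smallerClass l)
      (Q := fun out u' => u' = u + out.length * (d + s)) (by omega)) (τ := 0))))
      (by omega) le_rfl (fun _ _ h => h)
  · have : C.length * (C.length * (2 * d + 2 * s + 5) + 9 + (d + s)) =
        C.length * (C.length * (2 * d + 2 * s + 5) + 8) + C.length + C.length * (d + s) := by ring
    omega

theorem holds_softmaxBalance {d s : ℕ} (hs : 0 < s) (n : ℕ) {r rval δ L : ℝ} (hv : 0 < rval)
    (hc : 1 ≤ 30 * Real.log (n / δ)) (hL : 0 < L) (C : List (KV d s))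
    (hC : ∀ x ∈ C, ‖x.key‖ ≤ r ∧ ‖x.val‖ ≤ rval) {ι : Type} [Fintype ι]
    (q : ι → EuclideanSpace ℝ (Fin d)) (hq : ∀ j, ‖q j‖ ≤ r) :
    Holds (C.length * ENNReal.ofReal (2 * Real.exp (-(30 * Real.log (n / δ)) / 2)) +
        Fintype.card ι * ENNReal.ofReal (Real.exp (1 / 2) / Real.cosh L))
      (softmaxBalance n r rval δ C) fun out =>
        ∀ j, ‖(2 : ℝ) • pairSum (q j) out - pairSum (q j) C‖ ≤
          Real.sqrt s * (L * (Real.sqrt (30 * Real.log (n / δ)) *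
            (Real.exp (r ^ 2 / Real.sqrt d) * rval))) := by
  rw [softmaxBalance]
  refine Holds.step (computes_mulR _ _) (Holds.step (computes_sqrtR _)
    (Holds.step (computes_mulR _ _) (Holds.step (computes_divR _ _) (Holds.step (computes_expR _)
    (Holds.step (computes_mulR _ _) (Holds.step (computes_divR _ _) (Holds.step (computes_logR _)
    (Holds.step (computes_mulR _ _) (Holds.step (computes_mulR _ _) (Holds.step (computes_mulR _ _)
    ?_))))))))))
  set ρ : ℝ := Real.exp (r * r / (2 * Real.sqrt d)) * rval *
    (Real.exp (r * r / (2 * Real.sqrt d)) * rval) with hρ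
  have hρe : ρ = Real.exp (r ^ 2 / Real.sqrt d) * rval ^ 2 := by
    rw [hρ, mul_mul_mul_comm, ← Real.exp_add]
    rw [← add_div, ← two_mul, ← pow_two r, ← pow_two rval, mul_div_mul_left _ _ two_ne_zero]
  have hρ0 : 0 < ρ := by positivity
  have hmain := holds_chooseSigns hs hρ0 hc hL C (r := r) (fun x hx => by
    rw [hρe]; exact KV.norm_sq_feature_le x (hC x hx).1 (hC x hx).2) q hq
  -- One factor `exp (r² / (2√d))` stems from `R`, the other from the norm of the feature of the
  -- query.
  have hsq : Real.sqrt (30 * Real.log (n / δ) * ρ * Real.exp (r ^ 2 / Real.sqrt d)) =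
      Real.sqrt (30 * Real.log (n / δ)) * (Real.exp (r ^ 2 / Real.sqrt d) * rval) := by
    have : 30 * Real.log (n / δ) * ρ * Real.exp (r ^ 2 / Real.sqrt d) =
        30 * Real.log (n / δ) * (Real.exp (r ^ 2 / Real.sqrt d) * rval) ^ 2 := by
      rw [hρe]; ring
    rw [this, Real.sqrt_mul (by linarith), Real.sqrt_sq (by positivity)]
  rw [hsq] at hmain
  rw [← add_zero (_ + _ : ℝ≥0∞)]
  refine Holds.bind (hmain.and_ensures (chooseSigns_ensures _ C [])) ?_
  rintro l ⟨hl, hl'⟩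
  rw [List.map_nil, List.nil_append] at hl'
  refine Holds.step (computes_doWork _) (Holds.skip (holds_allocW _) (Holds.skip (holds_freeW _)
    (Holds.pure fun j => ?_)))
  have := norm_two_smul_sub_smallerClass (q j) l
  rw [hl'] at this
  exact this.trans_le (hl j)


/-! ### MergeAndReduce -/

/-- The bound on the length of the `l`-th of `T` levels after `N` arrivals, for batch size `t`. -/
def LevelCap (t T N : ℕ) : ℕ → ℕ → Prop
  | 0, len => len ≤ if T = 0 then N else N % t
  | l + 1, len => 2 * len ≤ t * if l + 1 < T then N / (t * 2 ^ l) % 2 else N / (t * 2 ^ l)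

/-- The bound on the level at which the reduction loop stands, when the last arrival was the
`M + 1`-st. -/
def ActiveCap (t T M : ℕ) : ℕ → ℕ → Prop
  | 0, len => len ≤ if T = 0 then M + 1 else M % t + 1
  | l + 1, len => 2 * len ≤ t * if l + 1 < T then M / (t * 2 ^ l) % 2 + 1 else (M + 1) / (t * 2 ^ l)

theorem LevelCap.zero {t T N l : ℕ} : LevelCap t T N l 0 := by
  cases l <;> simp [LevelCap]

/-- Each output that reaches a level has at most `t / 2` pairs. An intermediate level keeps at most
one of them, as it is emptied at every second delivery; the top level is never emptied, but receives
at most two while `N ≤ t 2ᵀ`. -/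
theorem LevelCap.le {t T N l len : ℕ} (ht : 0 < t) (h : LevelCap t T N l len) (hl : l ≤ T)
    (hN : N ≤ t * 2 ^ T) : len ≤ t := by
  cases l with
  | zero =>
    simp only [LevelCap] at h
    split_ifs at h with hT
    · subst hT; simpa using h.trans hN
    · exact h.trans (Nat.mod_lt _ ht).le
  | succ l =>
    simp only [LevelCap] at h
    split_ifs at h with hT
    · have := Nat.mul_le_mul_left t (show N / (t * 2 ^ l) % 2 ≤ 1 by omega)
      omega
    · have hT : T = l + 1 := by omega
      subst hT
      have h2 : N / (t * 2 ^ l) ≤ 2 := by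
        refine Nat.div_le_of_le_mul ?_
        rw [pow_succ] at hN
        linarith
      have := Nat.mul_le_mul_left t h2
      omega

theorem ActiveCap.le {t T M i len : ℕ} (ht : 0 < t) (h : ActiveCap t T M i len) (hi : i < T) :
    len ≤ t := by
  cases i with
  | zero =>
    simp only [ActiveCap] at h
    rw [if_neg (by omega)] at h
    have := Nat.mod_lt M ht
    omega
  | succ l =>
    simp only [ActiveCap] at h
    rw [if_pos hi] at h
    have := Nat.mul_le_mul_left t (show M / (t * 2 ^ l) % 2 + 1 ≤ 2 by omega)
    omega

theorem LevelCap.active {t T M len : ℕ} (h : LevelCap t T M 0 len) :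
    ActiveCap t T M 0 (len + 1) := by
  simp only [LevelCap, ActiveCap] at h ⊢
  split_ifs at h ⊢ <;> omega

/-- The batch has at most `t` pairs, so its output has at most `t / 2`, which is the room of one
more unit in the count of level `i + 1`. -/
theorem ActiveCap.next {t T M i len len' out : ℕ} (ht : 0 < t) (h : ActiveCap t T M i len)
    (hi : i < T) (hd : t * 2 ^ i ∣ M + 1) (h' : LevelCap t T M (i + 1) len')
    (ho : 2 * out ≤ len) : ActiveCap t T M (i + 1) (len' + out) := by
  have hle := h.le ht hi
  simp only [LevelCap, ActiveCap] at h' ⊢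
  split_ifs at h' ⊢ with hT
  · rw [mul_add, mul_add]; omega
  · rw [Nat.succ_div, if_pos hd, mul_add, mul_add]; omega

/-- Where the loop stops at a level `l + 1 < T`, the number `t 2ˡ` divides `M + 1` but `t 2ˡ⁺¹` does
not. So the new quotient is odd and the old one even, and the level goes from no output to one. -/
theorem ActiveCap.final {t T M i len : ℕ} (h : ActiveCap t T M i len) (hi : i ≤ T)
    (hd : ∀ l < i, t * 2 ^ l ∣ M + 1) (hn : i < T → ¬ t * 2 ^ i ∣ M + 1) :
    LevelCap t T (M + 1) i len := by
  cases i with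
  | zero =>
    simp only [LevelCap, ActiveCap] at h ⊢
    split_ifs at h ⊢ with hT
    · exact h
    · have := hn (by omega)
      rw [pow_zero, mul_one] at this
      have h1 := Nat.div_add_mod M t
      have h2 := Nat.div_add_mod (M + 1) t
      rw [Nat.succ_div, if_neg this, add_zero] at h2
      omega
  | succ l =>
    simp only [LevelCap, ActiveCap] at h ⊢
    split_ifs at h ⊢ with hT
    · obtain ⟨y, hy⟩ := hd l (by omega)
      have hn := hn hT
      have hpos : 0 < t * 2 ^ l := Nat.pos_of_ne_zero fun h0 => by rw [h0] at hy; omega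
      have h1 : (M + 1) / (t * 2 ^ l) = y := by rw [hy]; exact Nat.mul_div_cancel_left _ hpos
      have h2 : (M + 1) / (t * 2 ^ l) = M / (t * 2 ^ l) + 1 := by
        rw [Nat.succ_div, if_pos (hd l (by omega))]
      have h3 : ¬ 2 ∣ y := by
        rintro ⟨z, rfl⟩
        exact hn ⟨z, by rw [hy, pow_succ]; ring⟩
      have h4 : y % 2 = 1 := by omega
      have h5 : M / (t * 2 ^ l) % 2 = 0 := by omega
      rw [h5] at h
      rw [h1, h4]
      exact h
    · exact h

/-- If `t 2ⁱ` does not divide the number of arrivals, no larger `t 2ˡ` does, and the quotients that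
govern the higher levels stand still. -/
theorem LevelCap.succ {t T M i l len : ℕ} (h : LevelCap t T M l len) (hl : i < l)
    (hn : ¬ t * 2 ^ i ∣ M + 1) : LevelCap t T (M + 1) l len := by
  obtain ⟨l, rfl⟩ : ∃ l', l = l' + 1 := ⟨l - 1, by omega⟩
  have : ¬ t * 2 ^ l ∣ M + 1 := fun h' =>
    hn ((Nat.mul_dvd_mul_left t (pow_dvd_pow 2 (by omega))).trans h')
  simp only [LevelCap] at h ⊢
  rwa [Nat.succ_div, if_neg this, add_zero]

/-- The invariant on the lengths of the levels. -/
def MR.SizeInv {d s : ℕ} (P : Params) (m : MR d s) : Prop :=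
  ∀ l ≤ P.T, LevelCap P.t P.T m.count l (m.level l).length

/-- The invariant of the reduction loop. -/
structure MR.LoopInv {d s : ℕ} (P : Params) (M i : ℕ) (m : MR d s) : Prop where
  count : m.count = M + 1
  dvd : ∀ l < i, P.t * 2 ^ l ∣ M + 1
  below : ∀ l < i, LevelCap P.t P.T (M + 1) l (m.level l).length
  active : ActiveCap P.t P.T M i (m.level i).length
  above : ∀ l, i < l → l ≤ P.T → LevelCap P.t P.T M l (m.level l).length

/-! ### Arrivals, promotions and the size invariant -/

theorem MR.sizeInv_empty {d s : ℕ} (P : Params) : (MR.empty : MR d s).SizeInv P :=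
  fun _ _ => LevelCap.zero

theorem MR.SizeInv.length_le {d s : ℕ} {P : Params} {m : MR d s} (h : m.SizeInv P) (ht : 0 < P.t)
    (hN : m.count ≤ P.t * 2 ^ P.T) {l : ℕ} (hl : l ≤ P.T) : (m.level l).length ≤ P.t :=
  (h l hl).le ht hl hN

theorem MR.SizeInv.size_le {d s : ℕ} {P : Params} {m : MR d s} (h : m.SizeInv P) (ht : 0 < P.t)
    (hN : m.count ≤ P.t * 2 ^ P.T) : m.size P ≤ (P.T + 1) * P.t := by
  refine (Finset.sum_le_card_nsmul _ _ P.t fun l hl => ?_).trans (by simp)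
  exact h.length_le ht hN (Nat.lt_succ_iff.1 (Finset.mem_range.1 hl))

/-- The state after the arrival of `x`, before the reduction. -/
def MR.push {d s : ℕ} (m : MR d s) (x : KV d s) : MR d s :=
  ⟨m.count + 1, Function.update m.level 0 (m.level 0 ++ [x])⟩

/-- The state after `out` has replaced the content of level `i`. -/
def MR.promote {d s : ℕ} (m : MR d s) (i : ℕ) (out : List (KV d s)) : MR d s :=
  ⟨m.count, Function.update (Function.update m.level (i + 1) (m.level (i + 1) ++ out)) i []⟩

theorem MR.promote_level_self {d s : ℕ} (m : MR d s) (i : ℕ) (out : List (KV d s)) :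
    (m.promote i out).level i = [] := by simp [MR.promote]

theorem MR.promote_level_succ {d s : ℕ} (m : MR d s) (i : ℕ) (out : List (KV d s)) :
    (m.promote i out).level (i + 1) = m.level (i + 1) ++ out := by simp [MR.promote]

theorem MR.promote_level_of_ne {d s : ℕ} (m : MR d s) {i l : ℕ} (out : List (KV d s))
    (h : l ≠ i) (h' : l ≠ i + 1) : (m.promote i out).level l = m.level l := by
  simp [MR.promote, h, h']

theorem MR.loopInv_push {d s : ℕ} {P : Params} {m : MR d s} (h : m.SizeInv P) (x : KV d s) :
    (m.push x).LoopInv P m.count 0 where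
  count := rfl
  dvd := by simp
  below := by simp
  active := by
    have := (h 0 (Nat.zero_le _)).active
    simpa [MR.push] using this
  above l hl hT := by
    have := h l hT
    simpa [MR.push, hl.ne'] using this

theorem MR.LoopInv.length_le {d s : ℕ} {P : Params} {M i : ℕ} {m : MR d s}
    (h : m.LoopInv P M i) (ht : 0 < P.t) (hi : i < P.T) : (m.level i).length ≤ P.t :=
  h.active.le ht hi

theorem MR.LoopInv.promote {d s : ℕ} {P : Params} {M i : ℕ} {m : MR d s}
    (h : m.LoopInv P M i) (ht : 0 < P.t) (hi : i < P.T) (hd : P.t * 2 ^ i ∣ M + 1)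
    {out : List (KV d s)} (ho : 2 * out.length ≤ (m.level i).length) :
    (m.promote i out).LoopInv P M (i + 1) where
  count := h.count
  dvd l hl := by
    rcases Nat.lt_succ_iff_lt_or_eq.1 hl with hl | rfl
    · exact h.dvd l hl
    · exact hd
  below l hl := by
    rcases Nat.lt_succ_iff_lt_or_eq.1 hl with hl | rfl
    · rw [m.promote_level_of_ne out (by omega) (by omega)]
      exact h.below l hl
    · rw [m.promote_level_self]
      exact LevelCap.zero
  active := by
    rw [m.promote_level_succ, List.length_append]
    exact h.active.next ht hi hd (h.above _ (by omega) hi) ho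
  above l hl hT := by
    rw [m.promote_level_of_ne out (by omega) (by omega)]
    exact h.above l (by omega) hT

theorem MR.LoopInv.final {d s : ℕ} {P : Params} {M i : ℕ} {m : MR d s}
    (h : m.LoopInv P M i) (hi : i ≤ P.T) (hn : i < P.T → ¬ P.t * 2 ^ i ∣ M + 1) :
    m.SizeInv P := by
  intro l hl
  rw [h.count]
  rcases lt_trichotomy l i with h1 | rfl | h1
  · exact h.below l h1
  · exact h.active.final hi h.dvd hn
  · exact (h.above l h1 hl).succ h1 (hn (by omega))

/-- Only levels `i` and `i + 1` change. The form without subtraction serves both the lengths in `ℕ`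
and the vector-valued estimates. -/
theorem MR.sum_promote {d s : ℕ} {A : Type*} [AddCommMonoid A] (P : Params) (m : MR d s) {i : ℕ}
    (hi : i < P.T) (out : List (KV d s)) (g : ℕ → List (KV d s) → A) :
    ∑ l ∈ Finset.range (P.T + 1), g l ((m.promote i out).level l) +
        (g i (m.level i) + g (i + 1) (m.level (i + 1))) =
      ∑ l ∈ Finset.range (P.T + 1), g l (m.level l) +
        (g i [] + g (i + 1) (m.level (i + 1) ++ out)) := by
  have h1 : i ∈ Finset.range (P.T + 1) := Finset.mem_range.2 (by omega)
  have h2 : i + 1 ∈ (Finset.range (P.T + 1)).erase i :=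
    Finset.mem_erase.2 ⟨by omega, Finset.mem_range.2 (by omega)⟩
  rw [← Finset.add_sum_erase _ _ h1, ← Finset.add_sum_erase _ _ h2,
    ← Finset.add_sum_erase (Finset.range (P.T + 1)) (fun l => g l (m.level l)) h1,
    ← Finset.add_sum_erase _ (fun l => g l (m.level l)) h2, m.promote_level_self,
    m.promote_level_succ]
  have : ∑ l ∈ ((Finset.range (P.T + 1)).erase i).erase (i + 1), g l ((m.promote i out).level l) =
      ∑ l ∈ ((Finset.range (P.T + 1)).erase i).erase (i + 1), g l (m.level l) := by
    refine Finset.sum_congr rfl fun l hl => ?_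
    rw [Finset.mem_erase, Finset.mem_erase] at hl
    rw [m.promote_level_of_ne out hl.2.1 hl.1]
  rw [this]
  abel

theorem MR.sum_push {d s : ℕ} {A : Type*} [AddCommMonoid A] (P : Params) (m : MR d s)
    (x : KV d s) (g : ℕ → List (KV d s) → A) :
    ∑ l ∈ Finset.range (P.T + 1), g l ((m.push x).level l) + g 0 (m.level 0) =
      ∑ l ∈ Finset.range (P.T + 1), g l (m.level l) + g 0 (m.level 0 ++ [x]) := by
  rw [Finset.sum_range_succ', Finset.sum_range_succ' (fun l => g l (m.level l))]
  simp only [MR.push, Function.update_self, ne_eq, Nat.add_eq_zero_iff, one_ne_zero, and_false,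
    not_false_eq_true, Function.update_of_ne]
  abel

theorem MR.size_promote {d s : ℕ} (P : Params) (m : MR d s) {i : ℕ} (hi : i < P.T)
    (out : List (KV d s)) :
    (m.promote i out).size P + (m.level i).length = m.size P + out.length := by
  have := m.sum_promote P hi out fun _ C => C.length
  simp only [List.length_append, List.length_nil] at this
  simp only [MR.size]
  omega

theorem MR.size_push {d s : ℕ} (P : Params) (m : MR d s) (x : KV d s) :
    (m.push x).size P = m.size P + 1 := by
  have := m.sum_push P x fun _ C => C.length
  simp only [List.length_append, List.length_singleton] at this
  simp only [MR.size]
  omega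

theorem MR.length_le_size {d s : ℕ} (P : Params) (m : MR d s) {i : ℕ} (hi : i ≤ P.T) :
    (m.level i).length ≤ m.size P :=
  Finset.single_le_sum (f := fun l => (m.level l).length) (fun _ _ => Nat.zero_le _)
    (Finset.mem_range.2 (by omega))

/-- The time bound for the work on one level. -/
def levelTime (t d s : ℕ) : ℕ := 16 + t * (t * (2 * d + 2 * s + 5) + 9 + (d + s))

/-- `b` stands for the words outside this instance's pairs. During a call the batch is still stored
while its signs and the copied output, at most `t + t (d + s)` words, come on top; hence the slack
in `hπ`. -/
theorem MR.reduce_runs {d s : ℕ} {P : Params} (ht : 0 < P.t) (rval : ℝ) (b π M : ℕ) (k i : ℕ)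
    (hk : k + i = P.T) (m : MR d s) (h : m.LoopInv P M i)
    (hπ : b + m.size P * (d + s) + P.t + P.t * (d + s) ≤ π) :
    Runs (b + m.size P * (d + s)) (k * levelTime P.t d s) π (MR.reduce P rval k i m)
      fun m' u' => u' = b + m'.size P * (d + s) ∧ m'.size P ≤ m.size P ∧ m'.count = M + 1 ∧
        m'.SizeInv P := by
  induction k generalizing i m with
  | zero => exact Runs.pure ⟨rfl, le_rfl, h.count, h.final (by omega) (by omega)⟩
  | succ k ih =>
    rw [MR.reduce]
    have hi : i < P.T := by omega
    have hle := h.length_le ht hi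
    have hle2 := Nat.mul_le_mul_right (d + s) hle
    have hle3 := Nat.mul_le_mul_right (d + s) (m.length_le_size P hi.le)
    refine Runs.mono (Runs.step (computes_doWork 3) (τ' := 13 +
      P.t * (P.t * (2 * d + 2 * s + 5) + 9 + (d + s)) + k * levelTime P.t d s) (π := π)
      (Q := fun m' u' => u' = b + m'.size P * (d + s) ∧ m'.size P ≤ m.size P ∧
        m'.count = M + 1 ∧ m'.SizeInv P) ?_) ?_ le_rfl (fun _ _ h => h)
    · split_ifs with hd
      · rw [h.count] at hd
        have hT : (m.level i).length * ((m.level i).length * (2 * d + 2 * s + 5) + 9 + (d + s)) ≤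
            P.t * (P.t * (2 * d + 2 * s + 5) + 9 + (d + s)) := by gcongr
        refine Runs.mono (Runs.bind (τ' := 1 + k * levelTime P.t d s)
          (softmaxBalance_runs P.n P.r rval P.δ (m.level i) _ π (by omega)) ?_)
          (by omega) le_rfl (fun _ _ h => h)
        rintro out u' ⟨rfl, hsub, ho⟩
        have hs := m.size_promote P hi out
        have hs2 : (m.promote i out).size P * (d + s) + (m.level i).length * (d + s) =
            m.size P * (d + s) + out.length * (d + s) := by rw [← add_mul, hs, add_mul]
        have hs3 := Nat.mul_le_mul_right (d + s) (show (m.promote i out).size P ≤ m.size P by omega)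
        refine Runs.free ?_
        -- The truncated subtraction is exact, because the words of level `i` are part of `m.size P
        -- * (d + s)`.
        have e : b + m.size P * (d + s) + out.length * (d + s) - (m.level i).length * (d + s) =
            b + (m.promote i out).size P * (d + s) := by omega
        rw [e]
        refine (ih (i + 1) (by omega) (m.promote i out) (h.promote ht hi hd ho)
          (by omega)).mono le_rfl le_rfl ?_
        rintro m' u' ⟨h1, h2, h3⟩
        exact ⟨h1, by omega, h3⟩
      · rw [h.count] at hd
        exact Runs.pure ⟨rfl, le_rfl, h.count, h.final (by omega) fun _ => hd⟩
    · rw [add_mul, one_mul, levelTime]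
      omega

theorem MR.step_runs {d s : ℕ} {P : Params} (ht : 0 < P.t) (rval : ℝ) (b π : ℕ) (m : MR d s)
    (h : m.SizeInv P) (x : KV d s)
    (hπ : b + (m.size P + 1) * (d + s) + P.t + P.t * (d + s) ≤ π) :
    Runs (b + m.size P * (d + s)) (d + s + 1 + P.T * levelTime P.t d s) π (MR.step P rval m x)
      fun m' u' => u' = b + m'.size P * (d + s) ∧ m'.size P ≤ m.size P + 1 ∧
        m'.count = m.count + 1 ∧ m'.SizeInv P := by
  rw [MR.step]
  have e : b + (m.size P + 1) * (d + s) = b + m.size P * (d + s) + (d + s) := by ring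
  refine Runs.mono (Runs.alloc (by omega) (Runs.step (computes_doWork 1) ?_))
    (τ := d + s + (1 + P.T * levelTime P.t d s)) (by omega) le_rfl (fun _ _ h => h)
  rw [← e, ← m.size_push P x]
  exact MR.reduce_runs ht rval b π m.count P.T 0 (by simp) (m.push x) (MR.loopInv_push h x)
    (by rw [m.size_push]; omega)


/-! ### The error of MergeAndReduce -/

/-- The accumulated weight of the reductions when the levels below `i` have `N + 1` and the others
`N` arrivals behind them. -/
def callWeight (t T N i : ℕ) : ℕ :=
  ∑ l ∈ Finset.range T, 2 ^ l * ((if l < i then N + 1 else N) / (t * 2 ^ l))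

/-- The divisibility that triggers the reduction is also what raises the quotient at level `i` by
one; the factor `2ⁱ` is the weight with which the error of this call enters the estimate. -/
theorem callWeight_succ {t T N i : ℕ} (hi : i < T) (hd : t * 2 ^ i ∣ N + 1) :
    callWeight t T N (i + 1) = callWeight t T N i + 2 ^ i := by
  have h1 : i ∈ Finset.range T := Finset.mem_range.2 hi
  rw [callWeight, callWeight, ← Finset.add_sum_erase _ _ h1,
    ← Finset.add_sum_erase (Finset.range T)
      (fun l => 2 ^ l * ((if l < i then N + 1 else N) / (t * 2 ^ l))) h1]
  have : ∑ l ∈ (Finset.range T).erase i, 2 ^ l * ((if l < i + 1 then N + 1 else N) / (t * 2 ^ l)) =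
      ∑ l ∈ (Finset.range T).erase i, 2 ^ l * ((if l < i then N + 1 else N) / (t * 2 ^ l)) := by
    refine Finset.sum_congr rfl fun l hl => ?_
    have : l < i + 1 ↔ l < i := by have := (Finset.mem_erase.1 hl).1; omega
    simp only [this]
  rw [this]
  simp only [lt_add_iff_pos_right, lt_irrefl, if_true, if_false, zero_lt_one]
  rw [Nat.succ_div, if_pos hd]
  ring

theorem callWeight_le (t T N i : ℕ) : callWeight t T N i ≤ callWeight t T (N + 1) 0 := by
  refine Finset.sum_le_sum fun l _ => Nat.mul_le_mul_left _ (Nat.div_le_div_right ?_)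
  split_ifs <;> omega

/-- The weight `2ˡ` compensates the rarity of reductions at level `l`: each level costs at most `N /
t`. -/
theorem callWeight_zero_le {t : ℕ} (ht : 0 < t) (T N : ℕ) :
    (callWeight t T N 0 : ℝ) ≤ T * (N / t) := by
  rw [callWeight]
  push_cast
  refine (Finset.sum_le_card_nsmul _ _ ((N : ℝ) / t) fun l _ => ?_).trans (by simp)
  rw [if_neg (by omega)]
  have h := @Nat.cast_div_le ℝ _ _ _ N (t * 2 ^ l)
  calc (2 : ℝ) ^ l * (N / (t * 2 ^ l) : ℕ) ≤ 2 ^ l * (N / (t * 2 ^ l : ℕ)) := by gcongr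
    _ = N / t := by
      have : (t : ℝ) ≠ 0 := by positivity
      push_cast
      field_simp

/-- The invariant on the accuracy of an instance that has received the pairs `pre`. -/
structure MR.ErrInv {d s : ℕ} (P : Params) {ι : Type} (q : ι → EuclideanSpace ℝ (Fin d))
    (r ρ err : ℝ) (pre : List (KV d s)) (m : MR d s) : Prop where
  bounded : ∀ l, ∀ x ∈ m.level l, ‖x.key‖ ≤ r ∧ ‖x.val‖ ≤ ρ
  error : ∀ j, ‖m.estimate P (q j) - pairSum (q j) pre‖ ≤ err

theorem MR.errInv_empty {d s : ℕ} (P : Params) {ι : Type} (q : ι → EuclideanSpace ℝ (Fin d))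
    (r ρ : ℝ) : MR.ErrInv P q r ρ 0 [] (MR.empty : MR d s) where
  bounded l x hx := by simp [MR.empty] at hx
  error j := by simp [MR.estimate, MR.empty, pairSum]

theorem MR.ErrInv.mono {d s : ℕ} {P : Params} {ι : Type} {q : ι → EuclideanSpace ℝ (Fin d)}
    {r ρ err err' : ℝ} {pre : List (KV d s)} {m : MR d s} (h : m.ErrInv P q r ρ err pre)
    (he : err ≤ err') : m.ErrInv P q r ρ err' pre :=
  ⟨h.bounded, fun j => (h.error j).trans he⟩

theorem MR.ErrInv.push {d s : ℕ} {P : Params} {ι : Type} {q : ι → EuclideanSpace ℝ (Fin d)}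
    {r ρ err : ℝ} {pre : List (KV d s)} {m : MR d s} (h : m.ErrInv P q r ρ err pre) (x : KV d s)
    (hx : ‖x.key‖ ≤ r ∧ ‖x.val‖ ≤ ρ) : (m.push x).ErrInv P q r ρ err (pre ++ [x]) where
  bounded l y hy := by
    rcases Nat.eq_zero_or_pos l with rfl | hl
    · simp only [MR.push, Function.update_self, List.mem_append, List.mem_singleton] at hy
      rcases hy with hy | rfl
      · exact h.bounded 0 y hy
      · exact hx
    · simp only [MR.push, Function.update_of_ne hl.ne'] at hy
      exact h.bounded l y hy
  error j := by
    have := m.sum_push P x fun l C => (2 : ℝ) ^ l • pairSum (q j) C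
    have e : (m.push x).estimate P (q j) = m.estimate P (q j) + pairSum (q j) [x] := by
      rw [pairSum_append, pow_zero, one_smul, one_smul, ← add_assoc, add_right_comm] at this
      exact add_right_cancel this
    rw [e, pairSum_append, add_sub_add_right_eq_sub]
    exact h.error j

/-- The batch leaves with weight `2ⁱ` and the output enters with weight `2ⁱ⁺¹`, so the estimate
moves by `2ⁱ` times the error of the halving. -/
theorem MR.ErrInv.promote {d s : ℕ} {P : Params} {ι : Type} {q : ι → EuclideanSpace ℝ (Fin d)}
    {r ρ err E : ℝ} {pre : List (KV d s)} {m : MR d s} (h : m.ErrInv P q r ρ err pre) {i : ℕ}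
    (hi : i < P.T) {out : List (KV d s)} (hsub : out ⊆ m.level i)
    (hE : ∀ j, ‖(2 : ℝ) • pairSum (q j) out - pairSum (q j) (m.level i)‖ ≤ E) :
    (m.promote i out).ErrInv P q r ρ (err + 2 ^ i * E) pre where
  bounded l y hy := by
    rcases eq_or_ne l i with rfl | h1
    · rw [m.promote_level_self] at hy; simp at hy
    rcases eq_or_ne l (i + 1) with rfl | h2
    · rw [m.promote_level_succ, List.mem_append] at hy
      rcases hy with hy | hy
      · exact h.bounded _ y hy
      · exact h.bounded _ y (hsub hy)
    · rw [m.promote_level_of_ne out h1 h2] at hy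
      exact h.bounded l y hy
  error j := by
    have := m.sum_promote P hi out fun l C => (2 : ℝ) ^ l • pairSum (q j) C
    have e : (m.promote i out).estimate P (q j) = m.estimate P (q j) +
        (2 : ℝ) ^ i • ((2 : ℝ) • pairSum (q j) out - pairSum (q j) (m.level i)) := by
      rw [pairSum_append, smul_add] at this
      have h0 : pairSum (q j) ([] : List (KV d s)) = 0 := rfl
      rw [h0, smul_zero, zero_add] at this
      rw [smul_sub, smul_smul, ← pow_succ]
      refine (eq_sub_of_add_eq this).trans ?_
      simp only [MR.estimate]
      abel
    rw [e, add_sub_right_comm]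
    refine (norm_add_le _ _).trans (add_le_add (h.error j) ?_)
    rw [norm_smul, norm_pow, Real.norm_ofNat]
    gcongr
    exact hE j

/-- The batch depends on earlier coins, but `hcall` is uniform over all admissible batches and the
queries are fixed. The failure probability is therefore at most `β` for each level that may be
reduced. -/
theorem MR.reduce_holds {d s : ℕ} {P : Params} (ht : 0 < P.t) {ι : Type}
    (q : ι → EuclideanSpace ℝ (Fin d)) {ρ E : ℝ} {β : ℝ≥0∞}
    (hcall : ∀ C : List (KV d s), C.length ≤ P.t → (∀ x ∈ C, ‖x.key‖ ≤ P.r ∧ ‖x.val‖ ≤ ρ) →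
      Holds β (softmaxBalance P.n P.r ρ P.δ C) fun out =>
        ∀ j, ‖(2 : ℝ) • pairSum (q j) out - pairSum (q j) C‖ ≤ E) (hE : 0 ≤ E)
    (pre : List (KV d s)) (M k i : ℕ) (hk : k + i = P.T) (m : MR d s) (h : m.LoopInv P M i)
    (he : m.ErrInv P q P.r ρ (E * callWeight P.t P.T M i) pre) :
    Holds (k * β) (MR.reduce P ρ k i m) fun m' => m'.count = M + 1 ∧ m'.SizeInv P ∧
      m'.ErrInv P q P.r ρ (E * callWeight P.t P.T (M + 1) 0) pre := by
  have hw : ∀ i, E * callWeight P.t P.T M i ≤ E * callWeight P.t P.T (M + 1) 0 := fun i =>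
    mul_le_mul_of_nonneg_left (by exact_mod_cast callWeight_le _ _ _ _) hE
  induction k generalizing i m with
  | zero => exact Holds.pure ⟨h.count, h.final (by omega) (by omega), he.mono (hw i)⟩
  | succ k ih =>
    rw [MR.reduce]
    have hi : i < P.T := by omega
    refine Holds.step (computes_doWork 3) ?_
    split_ifs with hd
    · rw [h.count] at hd
      rw [Nat.cast_succ, add_mul, one_mul, add_comm]
      refine Holds.bind ((hcall (m.level i) (h.length_le ht hi) (he.bounded i)).and_ensures
        (softmaxBalance_ensures _ _ _ _ _)) ?_
      rintro out ⟨hgood, hsub, ho⟩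
      refine Holds.skip (holds_freeW _) (ih (i + 1) (by omega) (m.promote i out)
        (h.promote ht hi hd ho) ?_)
      refine (he.promote hi hsub hgood).mono (le_of_eq ?_)
      rw [callWeight_succ hi hd]
      push_cast
      ring
    · rw [h.count] at hd
      exact Holds.pure ⟨h.count, h.final (by omega) fun _ => hd, he.mono (hw i)⟩

theorem MR.step_holds {d s : ℕ} {P : Params} (ht : 0 < P.t) {ι : Type}
    (q : ι → EuclideanSpace ℝ (Fin d)) {ρ E : ℝ} {β : ℝ≥0∞}
    (hcall : ∀ C : List (KV d s), C.length ≤ P.t → (∀ x ∈ C, ‖x.key‖ ≤ P.r ∧ ‖x.val‖ ≤ ρ) →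
      Holds β (softmaxBalance P.n P.r ρ P.δ C) fun out =>
        ∀ j, ‖(2 : ℝ) • pairSum (q j) out - pairSum (q j) C‖ ≤ E) (hE : 0 ≤ E)
    (pre : List (KV d s)) (m : MR d s) (h : m.SizeInv P)
    (he : m.ErrInv P q P.r ρ (E * callWeight P.t P.T m.count 0) pre) (x : KV d s)
    (hx : ‖x.key‖ ≤ P.r ∧ ‖x.val‖ ≤ ρ) :
    Holds (P.T * β) (MR.step P ρ m x) fun m' => m'.count = m.count + 1 ∧ m'.SizeInv P ∧
      m'.ErrInv P q P.r ρ (E * callWeight P.t P.T m'.count 0) (pre ++ [x]) := by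
  rw [MR.step]
  refine Holds.skip (holds_allocW _) (Holds.step (computes_doWork 1) ?_)
  refine (MR.reduce_holds ht q hcall hE (pre ++ [x]) m.count P.T 0 (by simp) (m.push x)
    (MR.loopInv_push h x) (he.push x hx)).mono le_rfl ?_
  rintro m' ⟨h1, h2, h3⟩
  rw [h1]
  exact ⟨rfl, h2, h3⟩


/-! ### Buckets -/

/-- `2 ^ i` in the form in which the machine computes it. -/
def radius (i : ℤ) : ℝ := (2 : ℝ) ^ (i : ℝ)

theorem radius_pos (i : ℤ) : 0 < radius i := Real.rpow_pos_of_pos two_pos _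

theorem radius_sub_one (i : ℤ) : radius (i - 1) = radius i / 2 := by
  rw [radius, radius, Int.cast_sub, Int.cast_one, Real.rpow_sub_one two_ne_zero]

/-- The index `i` with `2 ^ (i - 1) < y ≤ 2 ^ i`. -/
def bucketIndex (y : ℝ) : ℤ := ⌈Real.log y / Real.log 2⌉

theorem le_radius_bucketIndex {y : ℝ} (hy : 0 < y) : y ≤ radius (bucketIndex y) := by
  have h := Int.le_ceil (Real.log y / Real.log 2)
  rw [div_le_iff₀ (Real.log_pos one_lt_two), ← Real.log_rpow two_pos] at h
  exact (Real.log_le_log_iff hy (radius_pos _)).1 h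

theorem radius_bucketIndex_lt {y : ℝ} (hy : 0 < y) : radius (bucketIndex y) < 2 * y := by
  have h := Int.ceil_lt_add_one (Real.log y / Real.log 2)
  rw [← sub_lt_iff_lt_add, lt_div_iff₀ (Real.log_pos one_lt_two)] at h
  have h2 : radius (bucketIndex y - 1) < y := by
    rw [radius, ← Real.log_lt_log_iff (Real.rpow_pos_of_pos two_pos _) hy,
      Real.log_rpow two_pos]
    simpa [bucketIndex] using h
  rw [radius_sub_one] at h2
  linarith

/-- `l'` arises from `l` when one instance with index `i` receives a pair; `N` and `Q` describe what
happens to a fresh and to an existing instance. -/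
inductive Sent {d : ℕ} (i : ℤ) (N : MR d d → Prop) (Q : MR d d → MR d d → Prop) :
    List (ℤ × MR d d) → List (ℤ × MR d d) → Prop
  | new {m : MR d d} : N m → Sent i N Q [] [(i, m)]
  | here {m m' : MR d d} {l : List (ℤ × MR d d)} : Q m m' → Sent i N Q ((i, m) :: l) ((i, m') :: l)
  | there {p : ℤ × MR d d} {l l' : List (ℤ × MR d d)} : p.1 ≠ i → Sent i N Q l l' →
      Sent i N Q (p :: l) (p :: l')

theorem Sent.keys {d : ℕ} {i : ℤ} {N : MR d d → Prop} {Q : MR d d → MR d d → Prop}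
    {l l' : List (ℤ × MR d d)} (h : Sent i N Q l l') :
    l'.map Prod.fst = l.map Prod.fst ∧ i ∈ l.map Prod.fst ∨
      l'.map Prod.fst = l.map Prod.fst ++ [i] ∧ i ∉ l.map Prod.fst := by
  induction h with
  | new _ => simp
  | here _ => simp
  | there hne _ ih =>
    rcases ih with ⟨h1, h2⟩ | ⟨h1, h2⟩
    · left
      simp only [List.map_cons, h1, List.mem_cons]
      exact ⟨trivial, Or.inr h2⟩
    · right
      simp only [List.map_cons, h1, List.mem_cons, not_or, List.cons_append]
      exact ⟨trivial, hne.symm, h2⟩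

theorem Sent.nodup {d : ℕ} {i : ℤ} {N : MR d d → Prop} {Q : MR d d → MR d d → Prop}
    {l l' : List (ℤ × MR d d)} (h : Sent i N Q l l') (hl : (l.map Prod.fst).Nodup) :
    (l'.map Prod.fst).Nodup := by
  rcases h.keys with ⟨h1, -⟩ | ⟨h1, h2⟩
  · rwa [h1]
  · rw [h1]
    exact List.Nodup.append hl (List.nodup_singleton i) (by simpa using h2)

theorem Sent.mem_keys {d : ℕ} {i : ℤ} {N : MR d d → Prop} {Q : MR d d → MR d d → Prop}
    {l l' : List (ℤ × MR d d)} (h : Sent i N Q l l') : i ∈ l'.map Prod.fst := by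
  rcases h.keys with ⟨h1, h2⟩ | ⟨h1, h2⟩
  · rwa [h1]
  · simp [h1]

theorem Sent.subset_keys {d : ℕ} {i : ℤ} {N : MR d d → Prop} {Q : MR d d → MR d d → Prop}
    {l l' : List (ℤ × MR d d)} (h : Sent i N Q l l') : l.map Prod.fst ⊆ l'.map Prod.fst := by
  rcases h.keys with ⟨h1, h2⟩ | ⟨h1, h2⟩ <;> simp [h1]

theorem Sent.length_le {d : ℕ} {i : ℤ} {N : MR d d → Prop} {Q : MR d d → MR d d → Prop}
    {l l' : List (ℤ × MR d d)} (h : Sent i N Q l l') : l'.length ≤ l.length + 1 := by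
  rw [← List.length_map (as := l') (f := Prod.fst), ← List.length_map (as := l) (f := Prod.fst)]
  rcases h.keys with ⟨h1, h2⟩ | ⟨h1, h2⟩ <;> rw [h1] <;> simp

theorem Sent.sum_le {d : ℕ} {i : ℤ} {N : MR d d → Prop} {Q : MR d d → MR d d → Prop}
    {l l' : List (ℤ × MR d d)} (h : Sent i N Q l l') (f : MR d d → ℕ) (hN : ∀ m, N m → f m ≤ 1)
    (hQ : ∀ m m', Q m m' → f m' ≤ f m + 1) :
    (l'.map fun p => f p.2).sum ≤ (l.map fun p => f p.2).sum + 1 := by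
  induction h with
  | new h => simpa using hN _ h
  | here h =>
    have := hQ _ _ h
    simp only [List.map_cons, List.sum_cons]
    omega
  | there hne _ ih =>
    simp only [List.map_cons, List.sum_cons]
    omega

/-- Only the first entry with index `i` is touched; distinct indices exclude an untouched second
one. -/
theorem Sent.mem {d : ℕ} {i : ℤ} {N : MR d d → Prop} {Q : MR d d → MR d d → Prop}
    {l l' : List (ℤ × MR d d)} (h : Sent i N Q l l') (hl : (l.map Prod.fst).Nodup)
    {p : ℤ × MR d d} (hp : p ∈ l') :
    (p ∈ l ∧ p.1 ≠ i) ∨ (p.1 = i ∧ i ∉ l.map Prod.fst ∧ N p.2) ∨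
      (p.1 = i ∧ ∃ m, (i, m) ∈ l ∧ Q m p.2) := by
  induction h with
  | new h =>
    rw [List.mem_singleton] at hp
    subst hp
    exact Or.inr (Or.inl ⟨rfl, by simp, h⟩)
  | @here m m' l h =>
    rw [List.mem_cons] at hp
    rcases hp with rfl | hp
    · exact Or.inr (Or.inr ⟨rfl, m, List.mem_cons_self, h⟩)
    · refine Or.inl ⟨List.mem_cons_of_mem _ hp, ?_⟩
      rintro rfl
      rw [List.map_cons, List.nodup_cons] at hl
      exact hl.1 (List.mem_map.2 ⟨p, hp, rfl⟩)
  | @there p' l l' hne _ ih =>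
    rw [List.mem_cons] at hp
    rw [List.map_cons, List.nodup_cons] at hl
    rcases hp with rfl | hp
    · exact Or.inl ⟨List.mem_cons_self, hne⟩
    · rcases ih hl.2 hp with ⟨h1, h2⟩ | ⟨h1, h2, h3⟩ | ⟨h1, m, h2, h3⟩
      · exact Or.inl ⟨List.mem_cons_of_mem _ h1, h2⟩
      · refine Or.inr (Or.inl ⟨h1, ?_, h3⟩)
        rw [List.map_cons, List.mem_cons, not_or]
        exact ⟨hne.symm, h2⟩
      · exact Or.inr (Or.inr ⟨h1, m, List.mem_cons_of_mem _ h2, h3⟩)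

/-- Words occupied by the numerator instances. -/
def numWords {d : ℕ} (P : Params) (l : List (ℤ × MR d d)) : ℕ := (l.map fun p => p.2.words P).sum

/-- Pairs stored in the numerator instances. -/
def numSize {d : ℕ} (P : Params) (l : List (ℤ × MR d d)) : ℕ := (l.map fun p => p.2.size P).sum

theorem numWords_eq {d : ℕ} (P : Params) (l : List (ℤ × MR d d)) :
    numWords P l = l.length * (P.T + 3) + numSize P l * (d + d) := by
  induction l with
  | nil => simp [numWords, numSize]
  | cons p l ih =>
    have h1 : numWords P (p :: l) = p.2.words P + numWords P l := by simp [numWords]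
    have h2 : numSize P (p :: l) = p.2.size P + numSize P l := by simp [numSize]
    rw [h1, h2, ih, MR.words_eq, List.length_cons]
    ring

/-! ### Sending a pair and erasing buckets -/

theorem MR.size_empty {d s : ℕ} (P : Params) : (MR.empty : MR d s).size P = 0 := by
  simp [MR.size, MR.empty]

/-- What a step does to the size of an instance. -/
def MR.Grows {d s : ℕ} (P : Params) (m m' : MR d s) : Prop :=
  m'.size P ≤ m.size P + 1 ∧ m'.count = m.count + 1 ∧ m'.SizeInv P

/-- Extra words and time of sending one pair. -/
def sendTime (P : Params) (d : ℕ) : ℕ := P.T + 3 + (1 + (d + d + 1 + P.T * levelTime P.t d d))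

theorem sendNum_runs {d : ℕ} {P : Params} (ht : 0 < P.t) (i : ℤ) (x : KV d d)
    (l : List (ℤ × MR d d)) (hl : ∀ p ∈ l, p.2.SizeInv P) (b π : ℕ)
    (hπ : b + numWords P l + (P.T + 3) + (d + d) + P.t + P.t * (d + d) ≤ π) :
    Runs (b + numWords P l) (l.length + sendTime P d) π (sendNum P i x l) fun l' u' =>
      u' = b + numWords P l' ∧ Sent i (MR.Grows P MR.empty) (MR.Grows P) l l' := by
  induction l generalizing b with
  | nil =>
    have h0 : numWords P ([] : List (ℤ × MR d d)) = 0 := rfl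
    rw [h0] at hπ ⊢
    rw [sendNum]
    have h1 := MR.size_empty (d := d) (s := d) P
    have hstep := MR.step_runs ht ((2 : ℝ) ^ (i : ℝ)) (b + 0 + MR.overhead P) π MR.empty
      (MR.sizeInv_empty P) x (by rw [h1, MR.overhead, zero_add, one_mul]; omega)
    rw [h1, zero_mul] at hstep
    refine Runs.mono (Runs.alloc (by rw [MR.overhead]; omega) (Runs.step (computes_powR _ _)
      (Runs.bind hstep (τ' := 0) ?_))) ?_ le_rfl (fun _ _ h => h)
    · rintro m' u' ⟨rfl, h2, h3, h4⟩
      refine Runs.pure ⟨?_, Sent.new ⟨by rw [h1]; omega, h3, h4⟩⟩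
      have h5 : numWords P [(i, m')] = m'.words P := by simp [numWords]
      rw [h5, MR.words_eq, MR.overhead]
      ring
    · rw [sendTime, MR.overhead]
      omega
  | cons p l ih =>
    obtain ⟨i', m⟩ := p
    have h0 : ∀ (m : MR d d) l, numWords P ((i', m) :: l) = m.words P + numWords P l := by
      intro m l; simp [numWords]
    rw [h0] at hπ ⊢
    rw [sendNum]
    have hm : m.SizeInv P := hl (i', m) List.mem_cons_self
    refine Runs.mono (Runs.step (computes_doWork 1) (τ' := l.length + sendTime P d) (π := π)
      (Q := fun l' u' => u' = b + numWords P l' ∧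
        Sent i (MR.Grows P MR.empty) (MR.Grows P) ((i', m) :: l) l') ?_) ?_ le_rfl
        (fun _ _ h => h)
    · split_ifs with hi
      · subst hi
        have hw := m.words_eq P
        have hstep := MR.step_runs ht ((2 : ℝ) ^ (i' : ℝ)) (b + numWords P l + (P.T + 3)) π m hm x
          (by rw [add_mul, one_mul]; omega)
        have e : b + (m.words P + numWords P l) =
          b + numWords P l + (P.T + 3) + m.size P * (d + d) := by omega
        rw [e]
        refine Runs.mono (Runs.step (computes_powR _ _) (Runs.bind hstep (τ' := 0) ?_)) ?_ le_rfl
          (fun _ _ h => h)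
        · rintro m' u' ⟨rfl, h2⟩
          refine Runs.pure ⟨?_, Sent.here h2⟩
          rw [h0, MR.words_eq]
          ring
        · rw [sendTime]
          omega
      -- The recursion passes over the head, whose words are counted with the surroundings `b`.
      · have := ih (fun p hp => hl p (List.mem_cons_of_mem _ hp)) (b + m.words P) (by omega)
        rw [add_assoc] at this
        refine Runs.mono (Runs.bind this (τ' := 0) ?_) le_rfl le_rfl (fun _ _ h => h)
        rintro l' u' ⟨rfl, h2⟩
        refine Runs.pure ⟨?_, Sent.there hi h2⟩
        rw [h0]
        ring
    · rw [List.length_cons]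
      omega

theorem sendNum_holds {d : ℕ} {P : Params} (i : ℤ) (x : KV d d) {β : ℝ≥0∞}
    {N : MR d d → Prop} {Q : MR d d → MR d d → Prop} (l : List (ℤ × MR d d))
    (hN : Holds β (MR.step P (radius i) MR.empty x) N)
    (hQ : ∀ m, (i, m) ∈ l → Holds β (MR.step P (radius i) m x) (Q m)) :
    Holds β (sendNum P i x l) (Sent i N Q l) := by
  induction l with
  | nil =>
    rw [sendNum]
    refine Holds.skip (holds_allocW _) (Holds.step (computes_powR _ _) ?_)
    rw [← add_zero β]
    exact Holds.bind hN fun m' hm' => Holds.pure (Sent.new hm')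
  | cons p l ih =>
    obtain ⟨i', m⟩ := p
    rw [sendNum]
    refine Holds.step (computes_doWork 1) ?_
    rw [← add_zero β]
    split_ifs with hi
    · subst hi
      exact Holds.step (computes_powR _ _) (Holds.bind (hQ m List.mem_cons_self)
        fun m' hm' => Holds.pure (Sent.here hm'))
    · exact Holds.bind (ih fun m hm => hQ m (List.mem_cons_of_mem _ hm))
        fun l' hl' => Holds.pure (Sent.there hi hl')

theorem bucketAndSend_runs {d : ℕ} {P : Params} (ht : 0 < P.t) (x : KV d d) (nv : ℝ)
    (l : List (ℤ × MR d d)) (hl : ∀ p ∈ l, p.2.SizeInv P) (b π : ℕ)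
    (hπ : b + numWords P l + (P.T + 3) + (d + d) + P.t + P.t * (d + d) ≤ π) :
    Runs (b + numWords P l) (5 + (l.length + sendTime P d)) π (bucketAndSend P x nv l) fun l' u' =>
      u' = b + numWords P l' ∧ ((nv ≤ 0 ∧ l' = l) ∨
        (0 < nv ∧ Sent (bucketIndex nv) (MR.Grows P MR.empty) (MR.Grows P) l l')) := by
  rw [bucketAndSend]
  refine Runs.mono (Runs.step (computes_leR _ _) (τ' := 4 + (l.length + sendTime P d)) (π := π)
    (Q := fun l' u' => u' = b + numWords P l' ∧ ((nv ≤ 0 ∧ l' = l) ∨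
      (0 < nv ∧ Sent (bucketIndex nv) (MR.Grows P MR.empty) (MR.Grows P) l l'))) ?_) (by omega)
      le_rfl (fun _ _ h => h)
  split_ifs with hz
  · exact Runs.pure ⟨rfl, Or.inl ⟨by simpa using hz, rfl⟩⟩
  · have hz : 0 < nv := by simpa using hz
    refine Runs.mono (Runs.step (computes_logR _) (Runs.step (computes_logR _)
      (Runs.step (computes_divR _ _) (Runs.step (computes_ceilR _)
      (sendNum_runs ht (bucketIndex nv) x l hl b π hπ))))) (by omega) le_rfl ?_
    rintro l' u' ⟨h1, h2⟩
    exact ⟨h1, Or.inr ⟨hz, h2⟩⟩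

theorem bucketAndSend_holds {d : ℕ} {P : Params} (x : KV d d) (nv : ℝ) {β : ℝ≥0∞}
    {N : MR d d → Prop} {Q : MR d d → MR d d → Prop} (l : List (ℤ × MR d d))
    (hN : 0 < nv → Holds β (MR.step P (radius (bucketIndex nv)) MR.empty x) N)
    (hQ : 0 < nv → ∀ m, (bucketIndex nv, m) ∈ l →
      Holds β (MR.step P (radius (bucketIndex nv)) m x) (Q m)) :
    Holds β (bucketAndSend P x nv l) fun l' => (nv ≤ 0 ∧ l' = l) ∨
        (0 < nv ∧ Sent (bucketIndex nv) N Q l l') := by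
  rw [bucketAndSend]
  refine Holds.step (computes_leR _ _) ?_
  split_ifs with hz
  · exact Holds.pure (Or.inl ⟨by simpa using hz, rfl⟩)
  · have hz : 0 < nv := by simpa using hz
    refine Holds.step (computes_logR _) (Holds.step (computes_logR _)
      (Holds.step (computes_divR _ _) (Holds.step (computes_ceilR _) ?_)))
    exact (sendNum_holds (bucketIndex nv) x l (hN hz) (hQ hz)).mono le_rfl
      fun l' h => Or.inr ⟨hz, h⟩

open Classical in
/-- The instances that survive the erasure. -/
def survivors {d : ℕ} (θ : ℝ) (l : List (ℤ × MR d d)) : List (ℤ × MR d d) :=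
  l.filter fun p => decide (θ < radius p.1)

theorem mem_survivors {d : ℕ} {θ : ℝ} {l : List (ℤ × MR d d)} {p : ℤ × MR d d} :
    p ∈ survivors θ l ↔ p ∈ l ∧ θ < radius p.1 := by
  simp [survivors]

theorem survivors_cons_of_le {d : ℕ} {θ : ℝ} (l : List (ℤ × MR d d)) {p : ℤ × MR d d}
    (h : radius p.1 ≤ θ) : survivors θ (p :: l) = survivors θ l := by
  simp [survivors, h]

theorem survivors_cons_of_lt {d : ℕ} {θ : ℝ} (l : List (ℤ × MR d d)) {p : ℤ × MR d d}
    (h : θ < radius p.1) : survivors θ (p :: l) = p :: survivors θ l := by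
  simp [survivors, h]

theorem eraseSmall_runs {d : ℕ} (P : Params) (θ : ℝ) (l : List (ℤ × MR d d)) (b π : ℕ) :
    Runs (b + numWords P l) (3 * l.length) π (eraseSmall P θ l) fun l' u' =>
      u' = b + numWords P l' ∧ l' = survivors θ l := by
  induction l generalizing b with
  | nil => exact Runs.pure ⟨rfl, rfl⟩
  | cons p l ih =>
    obtain ⟨i, m⟩ := p
    have h0 : ∀ l : List (ℤ × MR d d), numWords P ((i, m) :: l) = m.words P + numWords P l := by
      intro l; simp [numWords]
    rw [h0, eraseSmall]
    have := ih (b + m.words P)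
    rw [add_assoc] at this
    refine Runs.mono (Runs.step (computes_powR _ _) (Runs.step (computes_leR _ _)
      (Runs.bind this (τ' := 1) (Q' := fun l' u' => u' = b + numWords P l' ∧
        l' = survivors θ ((i, m) :: l)) ?_))) ?_ le_rfl (fun _ _ h => h)
    · rintro l' u' ⟨rfl, rfl⟩
      split_ifs with hb
      · have hb : radius i ≤ θ := of_decide_eq_true hb
        have e := survivors_cons_of_le (p := (i, m)) l hb
        rw [e]
        exact Runs.free (τ := 0) (Runs.pure ⟨by omega, rfl⟩)
      · have hb : θ < radius i := not_le.1 fun h => hb (decide_eq_true h)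
        have e := survivors_cons_of_lt (p := (i, m)) l hb
        rw [e]
        exact Runs.pure ⟨by rw [h0]; ring, rfl⟩
    · rw [List.length_cons]
      omega

theorem eraseSmall_holds {d : ℕ} (P : Params) (θ : ℝ) (l : List (ℤ × MR d d)) :
    Holds 0 (eraseSmall P θ l) fun l' => l' = survivors θ l := by
  induction l with
  | nil => exact Holds.pure rfl
  | cons p l ih =>
    obtain ⟨i, m⟩ := p
    rw [eraseSmall]
    refine Holds.step (computes_powR _ _) (Holds.step (computes_leR _ _) ?_)
    rw [← add_zero (0 : ℝ≥0∞)]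
    refine Holds.bind ih ?_
    rintro l' rfl
    split_ifs with hb
    · have hb : radius i ≤ θ := of_decide_eq_true hb
      exact Holds.skip (holds_freeW _) (Holds.pure (survivors_cons_of_le _ hb).symm)
    · have hb : θ < radius i := not_le.1 fun h => hb (decide_eq_true h)
      exact Holds.pure (by rw [survivors_cons_of_lt _ hb])


/-! ### Memory and time of one step of BalanceKV -/

/-- The invariant of the state after `j` tokens that controls its size. -/
structure State.SizeInv {d : ℕ} (P : Params) (j : ℕ) (S : State d) : Prop where
  den_count : S.den.count = j
  den_size : S.den.SizeInv P
  num_size : ∀ p ∈ S.num, p.2.SizeInv P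
  nodup : (S.num.map Prod.fst).Nodup
  counts : (S.num.map fun p => p.2.count).sum ≤ j
  length : S.num.length ≤ j
  vmax_nonneg : 0 ≤ S.vmax
  lower : ∀ p ∈ S.num, thresholdVal d P S.vmax < radius p.1
  upper : ∀ p ∈ S.num, radius p.1 < 2 * S.vmax

/-- The conditions on the parameters that the bounds on memory and time depend on. -/
structure Params.Wf (P : Params) (d : ℕ) (b : ℕ) : Prop where
  d_pos : 0 < d
  t_pos : 0 < P.t
  eps_nonneg : 0 ≤ P.ε
  n_le : P.n ≤ P.t * 2 ^ P.T
  b_pos : 0 < b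
  buckets : P.T = 0 ∨ ∀ (v : ℝ) (K : List ℤ), K.Nodup →
    (∀ i ∈ K, thresholdVal d P v < radius i ∧ radius i < 2 * v) → K.length ≤ b

theorem thresholdVal_mono {d : ℕ} {P : Params} (hε : 0 ≤ P.ε) {v w : ℝ} (h : v ≤ w) :
    thresholdVal d P v ≤ thresholdVal d P w := by
  unfold thresholdVal
  have : 0 ≤ P.ε / (2 * P.n) := by positivity
  gcongr

theorem list_sum_map_le_length_mul {α : Type} (l : List α) (f : α → ℕ) (c : ℕ)
    (h : ∀ a ∈ l, f a ≤ c) : (l.map f).sum ≤ l.length * c := by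
  have := List.sum_le_card_nsmul (l.map f) c (by simpa using h)
  simpa using this

/-- There are two regimes. For `T = 0` nothing is compressed, an instance stores at most what it
received, and all instances together received at most `n ≤ t` pairs. Otherwise the radii of the
living buckets lie between the threshold and `2 vmax`, which leaves room for `b` indices with at
most `(T + 1) t` pairs each. -/
theorem State.SizeInv.bounds {d b j : ℕ} {P : Params} (hP : P.Wf d b) {S : State d}
    (h : S.SizeInv P j) (hj : j ≤ P.n) :
    S.num.length ≤ b * P.t ∧ numSize P S.num ≤ b * (P.T + 1) * P.t ∧
      S.den.size P ≤ b * (P.T + 1) * P.t := by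
  have hb := hP.b_pos
  have ht := hP.t_pos
  have hcount : ∀ p ∈ S.num, p.2.count ≤ P.t * 2 ^ P.T := by
    intro p hp
    have h1 : p.2.count ≤ (S.num.map fun p => p.2.count).sum :=
      List.le_sum_of_mem (List.mem_map_of_mem (f := fun p : ℤ × MR d d => p.2.count) hp)
    exact (h1.trans h.counts).trans (hj.trans hP.n_le)
  have hden : S.den.size P ≤ b * (P.T + 1) * P.t := by
    refine (h.den_size.size_le ht (by rw [h.den_count]; exact hj.trans hP.n_le)).trans ?_
    rw [mul_assoc]
    exact Nat.le_mul_of_pos_left _ hb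
  rcases hP.buckets with hT | hB
  · have hn := hP.n_le
    rw [hT, pow_zero, mul_one] at hn
    have h1 : P.t ≤ b * P.t := Nat.le_mul_of_pos_left _ hb
    refine ⟨(h.length.trans (hj.trans hn)).trans h1, ?_, hden⟩
    rw [hT, zero_add, mul_one]
    refine le_trans ?_ ((h.counts.trans (hj.trans hn)).trans h1)
    refine List.sum_le_sum fun p hp => ?_
    have := h.num_size p hp 0 (Nat.zero_le _)
    rw [LevelCap, if_pos hT] at this
    simpa [MR.size, hT] using this
  · have h1 : S.num.length ≤ b := by
      have := hB S.vmax (S.num.map Prod.fst) h.nodup ?_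
      · simpa using this
      · intro i hi
        obtain ⟨p, hp, rfl⟩ := List.mem_map.1 hi
        exact ⟨h.lower p hp, h.upper p hp⟩
    refine ⟨h1.trans (Nat.le_mul_of_pos_right _ ht), ?_, hden⟩
    refine (list_sum_map_le_length_mul _ _ ((P.T + 1) * P.t) fun p hp =>
      (h.num_size p hp).size_le ht (hcount p hp)).trans ?_
    rw [mul_assoc]
    exact Nat.mul_le_mul_right _ h1

/-- `N` and `Q` are abstract so that the lemma serves both the resource analysis and the accuracy
analysis. -/
theorem State.SizeInv.next {d j : ℕ} {P : Params} {S : State d}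
    (h : S.SizeInv P j) {y : ℝ} {num : List (ℤ × MR d d)} {den : MR d 1} {N : MR d d → Prop}
    {Q : MR d d → MR d d → Prop} (hN : ∀ m, N m → m.count = 1 ∧ m.SizeInv P)
    (hQ : ∀ m m', Q m m' → m'.count = m.count + 1 ∧ m'.SizeInv P)
    (hnum : (y ≤ 0 ∧ num = S.num) ∨ (0 < y ∧ Sent (bucketIndex y) N Q S.num num))
    (hden : den.count = S.den.count + 1 ∧ den.SizeInv P) :
    State.SizeInv P (j + 1) ⟨max S.vmax y, survivors (thresholdVal d P (max S.vmax y)) num,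
      den⟩ := by
  have hsub : (survivors (thresholdVal d P (max S.vmax y)) num).Sublist num := List.filter_sublist
  have hlen := hsub.length_le
  have hnod : (num.map Prod.fst).Nodup := by
    rcases hnum with ⟨-, rfl⟩ | ⟨-, hs⟩
    · exact h.nodup
    · exact hs.nodup h.nodup
  refine ⟨by rw [hden.1, h.den_count], hden.2, ?_, (hsub.map _).nodup hnod, ?_, ?_,
    le_max_of_le_left h.vmax_nonneg, fun p hp => (mem_survivors.1 hp).2, ?_⟩
  · intro p hp
    have hp := hsub.subset hp
    rcases hnum with ⟨-, rfl⟩ | ⟨-, hs⟩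
    · exact h.num_size p hp
    · rcases hs.mem h.nodup hp with ⟨h1, -⟩ | ⟨-, -, h1⟩ | ⟨-, m, -, h1⟩
      · exact h.num_size p h1
      · exact (hN _ h1).2
      · exact (hQ _ _ h1).2
  · have h1 := (hsub.map fun p => p.2.count).sum_le_sum (by simp)
    refine h1.trans ?_
    rcases hnum with ⟨-, rfl⟩ | ⟨-, hs⟩
    · exact h.counts.trans (Nat.le_succ j)
    · have := hs.sum_le (fun m => m.count) (fun m hm => (hN m hm).1.le)
        (fun m m' hm => (hQ m m' hm).1.le)
      exact this.trans (Nat.succ_le_succ h.counts)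
  · refine hlen.trans ?_
    rcases hnum with ⟨-, rfl⟩ | ⟨-, hs⟩
    · exact h.length.trans (Nat.le_succ j)
    · exact hs.length_le.trans (Nat.succ_le_succ h.length)
  · intro p hp
    have hp := hsub.subset hp
    have hv : 2 * S.vmax ≤ 2 * max S.vmax y :=
      mul_le_mul_of_nonneg_left (le_max_left _ _) two_pos.le
    have hy : 2 * y ≤ 2 * max S.vmax y :=
      mul_le_mul_of_nonneg_left (le_max_right _ _) two_pos.le
    rcases hnum with ⟨-, rfl⟩ | ⟨hy0, hs⟩
    · exact (h.upper p hp).trans_le hv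
    · have hlt := (radius_bucketIndex_lt hy0).trans_le hy
      rcases hs.mem h.nodup hp with ⟨h1, -⟩ | ⟨h1, -⟩ | ⟨h1, -⟩
      · exact (h.upper p h1).trans_le hv
      · rw [h1]; exact hlt
      · rw [h1]; exact hlt

theorem output_runs {d : ℕ} (P : Params) (S : State d) (q : EuclideanSpace ℝ (Fin d)) (u π : ℕ)
    (hπ : u + (d + 1) ≤ π) :
    Runs u (d + 1 + (S.num.length * (P.T + 1) + numSize P S.num * (4 * d + 4) +
      (P.T + 1 + S.den.size P * (2 * d + 2 + 4) + (d + 2)))) π (output P S q) fun _ u' => u' = u := by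
  rw [output]
  refine Runs.alloc hπ (Runs.step (computes_addBuckets P q S.num 0)
    (Runs.step (computes_estimate P q S.den 0) (Runs.mono (Runs.step (computes_leR _ _)
    (τ' := d + 1) (π := π) (Q := fun _ u' => u' = u) ?_) (by omega) le_rfl (fun _ _ h => h))))
  split_ifs
  · exact Runs.abort
  · exact Runs.step (computes_divAll _ _) (Runs.free (τ := 0) (Runs.pure (by omega)))

/-- Words in use between two steps. -/
def State.words {d : ℕ} (P : Params) (S : State d) : ℕ :=
  64 + (P.T + 3) + S.den.size P * (d + 1) + numWords P S.num

theorem sqrt_inner_self {d : ℕ} (v : EuclideanSpace ℝ (Fin d)) :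
    Real.sqrt (inner ℝ v v) = ‖v‖ := by
  rw [real_inner_self_eq_norm_sq, Real.sqrt_sq (norm_nonneg v)]

theorem ite_decide_le_eq_max (y v : ℝ) :
    (if (@decide (y ≤ v) (Classical.dec _)) = true then v else y) = max v y := by
  split_ifs with h
  · exact (max_eq_left (of_decide_eq_true h)).symm
  · exact (max_eq_right (le_of_not_ge fun h' => h (decide_eq_true h'))).symm

/-- The time bound for one step. -/
def stepTime (P : Params) (d b : ℕ) : ℕ :=
  2 * (P.T * levelTime P.t d d) + 100 * (d * (b * (P.T + 1) * P.t))

/-- The space bound. -/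
def spaceBound (P : Params) (d b : ℕ) : ℕ := 120 * (d * (b * (P.T + 1) * P.t))

theorem levelTime_mono {t d s s' : ℕ} (h : s ≤ s') : levelTime t d s ≤ levelTime t d s' := by
  unfold levelTime
  gcongr

theorem step_runs {d b j : ℕ} {P : Params} (hP : P.Wf d b) {S : State d}
    (h : S.SizeInv P j) (hj : j < P.n) (x : Token d) :
    Runs (S.words P) (stepTime P d b) (spaceBound P d b) (step P S x) fun y u' =>
      u' = y.1.words P ∧ y.1.SizeInv P (j + 1) := by
  obtain ⟨hb1, hb2, hb3⟩ := h.bounds hP hj.le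
  have ht := hP.t_pos
  have hd := hP.d_pos
  have hb := hP.b_pos
  -- Up to constants, `G` bounds the stored pairs and `X = d G` their words; every cost except the
  -- quadratic work inside the reductions is a multiple of `X`.
  set G := b * (P.T + 1) * P.t with hG
  set X := d * G with hX
  have hbt : b * P.t * (P.T + 1) = G := by rw [hG]; ring
  have hG0 : 0 < G := by positivity
  have hGX : G ≤ X := Nat.le_mul_of_pos_left _ hd
  have hdX : d ≤ X := Nat.le_mul_of_pos_right _ hG0
  have htG : P.t ≤ G := Nat.le_mul_of_pos_left _ (by positivity)
  have hTG : P.T + 1 ≤ G := by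
    rw [← hbt]; exact Nat.le_mul_of_pos_left _ (by positivity)
  have hbG : b * P.t ≤ G := by rw [← hbt]; exact Nat.le_mul_of_pos_right _ (by omega)
  have htd : P.t * d ≤ X := by rw [mul_comm]; exact Nat.mul_le_mul_left d htG
  -- Between arrival and erasure there may be one bucket and one pair more than the invariant
  -- allows.
  have hnw : ∀ l : List (ℤ × MR d d), l.length ≤ b * P.t + 1 → numSize P l ≤ G + 1 →
      numWords P l ≤ 10 * X := by
    intro l h1 h2
    rw [numWords_eq]
    have h3 : l.length * (P.T + 3) ≤ (b * P.t + 1) * (3 * (P.T + 1)) :=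
      Nat.mul_le_mul h1 (by omega)
    have h4 : (b * P.t + 1) * (3 * (P.T + 1)) = 3 * G + 3 * (P.T + 1) := by rw [← hbt]; ring
    have h5 : numSize P l * (d + d) ≤ (G + 1) * (d + d) := Nat.mul_le_mul_right _ h2
    have h6 : (G + 1) * (d + d) = 2 * X + 2 * d := by rw [hX]; ring
    omega
  have hdw : ∀ m : MR d 1, m.size P ≤ G + 1 → m.size P * (d + 1) ≤ 4 * X := by
    intro m hm
    refine (Nat.mul_le_mul_right _ hm).trans ?_
    have : (G + 1) * (d + 1) = X + d + G + 1 := by rw [hX]; ring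
    omega
  have hnw0 := hnw S.num (by omega) (by omega)
  have hdw0 := hdw S.den (by omega)
  have hdw1 : (S.den.size P + 1) * (d + 1) ≤ 4 * X := by
    refine (Nat.mul_le_mul_right _ (show S.den.size P + 1 ≤ G + 1 by omega)).trans ?_
    have : (G + 1) * (d + 1) = X + d + G + 1 := by rw [hX]; ring
    omega
  have hlt := Nat.mul_le_mul_left P.T (levelTime_mono (t := P.t) (d := d) (s := 1) (s' := d) hd)
  have hmul2 : P.t * (d + d) = 2 * (P.t * d) := by ring
  have hmul1 : P.t * (d + 1) = P.t * d + P.t := by ring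
  have hspace : spaceBound P d b = 120 * X := rfl
  have htime : stepTime P d b = 2 * (P.T * levelTime P.t d d) + 100 * X := rfl
  rw [step]
  refine Runs.mono (τ := 3 * d + (2 * d + (1 + (5 + (S.num.length + sendTime P d) +
    (1 + (9 + (3 * (b * P.t + 1) + (d + 1 + 1 + P.T * levelTime P.t d d +
      (d + 1 + (G + G * (4 * d + 4) + (P.T + 1 + G * (2 * d + 2 + 4) + (d + 2))) + 1)))))))))
    (Runs.alloc (by rw [State.words]; omega) (Runs.step (computes_dot _ _)
    (Runs.step (computes_sqrtR _) (Runs.bind (Q := fun num u' =>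
      u' = 64 + (P.T + 3) + S.den.size P * (d + 1) + 3 * d + numWords P num ∧
        ((‖x.val‖ ≤ 0 ∧ num = S.num) ∨ (0 < ‖x.val‖ ∧ Sent (bucketIndex ‖x.val‖)
          (MR.Grows P MR.empty) (MR.Grows P) S.num num))) ?_ ?_)))) ?_ le_rfl (fun _ _ h => h)
  · rw [sqrt_inner_self]
    have e : S.words P + 3 * d =
      64 + (P.T + 3) + S.den.size P * (d + 1) + 3 * d + numWords P S.num := by
      rw [State.words]; ring
    rw [e]
    exact bucketAndSend_runs ht _ _ _ h.num_size _ _ (by omega)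
  · rintro num u' ⟨rfl, hnum⟩
    have hnumlen : num.length ≤ S.num.length + 1 := by
      rcases hnum with ⟨-, rfl⟩ | ⟨-, hs⟩
      · omega
      · exact hs.length_le
    rw [sqrt_inner_self]
    refine Runs.step (computes_leR _ _) ?_
    rw [ite_decide_le_eq_max]
    refine Runs.step (computes_threshold _ _ _) (Runs.bind
      ((eraseSmall_runs P _ num _ _).mono (by omega) le_rfl (fun _ _ h => h)) ?_)
    rintro num' u' ⟨rfl, rfl⟩
    set num' := survivors (thresholdVal d P (max S.vmax ‖x.val‖)) num with hnum'
    have hsub : num'.Sublist num := List.filter_sublist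
    have hnumsize : numSize P num ≤ numSize P S.num + 1 := by
      rcases hnum with ⟨-, rfl⟩ | ⟨-, hs⟩
      · omega
      · have h1 := MR.size_empty (d := d) (s := d) P
        exact hs.sum_le (fun m => m.size P) (fun m hm => by have := hm.1; omega)
          (fun m m' hm => hm.1)
    have hnumsize' : numSize P num' ≤ numSize P num :=
      (hsub.map fun p => p.2.size P).sum_le_sum (by simp)
    have hnw1 := hnw num' (hsub.length_le.trans (by omega)) (by omega)
    have e : 64 + (P.T + 3) + S.den.size P * (d + 1) + 3 * d + numWords P num' =
        64 + (P.T + 3) + 3 * d + numWords P num' + S.den.size P * (d + 1) := by ring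
    rw [e]
    refine Runs.bind (MR.step_runs ht 1 (64 + (P.T + 3) + 3 * d + numWords P num')
      (spaceBound P d b) S.den h.den_size _ (by omega)|>.mono (by omega) le_rfl
        (fun _ _ h => h)) ?_
    rintro den u' ⟨rfl, hden⟩
    -- After the erasure and the update of the denominator the invariant for `j + 1` is in force, so
    -- the output is charged without that slack.
    have hnext := h.next (fun m hm => hm.2) (fun m m' hm => hm.2) hnum hden.2
    obtain ⟨hb1', hb2', hb3'⟩ := hnext.bounds hP hj
    simp only [← hnum'] at hnext hb1' hb2' hb3'
    have hdw2 := hdw den (by omega)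
    have h1 : num'.length * (P.T + 1) ≤ G := by
      rw [← hbt]; exact Nat.mul_le_mul_right _ hb1'
    refine Runs.bind ((output_runs P _ _ _ _ (by omega)).mono ?_ le_rfl (fun _ _ h => h)) ?_
    · simp only
      gcongr
    · rintro z u' rfl
      refine Runs.free (τ := 0) (Runs.pure ⟨?_, hnext⟩)
      simp only [State.words]
      omega
  · rw [htime, sendTime]
    have h1 : G * (4 * d + 4) = 4 * X + 4 * G := by rw [hX]; ring
    have h2 : G * (2 * d + 2 + 4) = 2 * X + 6 * G := by rw [hX]; ring
    omega


/-! ### Memory and time of a whole run -/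

/-- `A` bounds the time already on the clock: the initialization before the first token, nothing
afterwards, as the clock is reset after each token. The peak is carried along. -/
theorem runFrom_reports {d b : ℕ} {P : Params} (hP : P.Wf d b) (A : ℕ) (xs : List (Token d)) (j : ℕ)
    (hj : j + xs.length ≤ P.n) (S : State d) (h : S.SizeInv P j) (m : Meter)
    (hu : m.used = S.words P) (ht : m.time ≤ A) (hp : m.peak ≤ spaceBound P d b) :
    ∀ ρ ∈ (runFrom P xs S m).support, ∀ rep ∈ ρ,
      rep.space ≤ spaceBound P d b ∧ rep.time ≤ A + stepTime P d b := by
  induction xs generalizing j S m with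
  | nil =>
    intro ρ hρ
    rw [runFrom, PMF.mem_support_pure_iff] at hρ
    subst hρ
    simp
  | cons x xs ih =>
    rw [List.length_cons] at hj
    intro ρ hρ rep hrep
    rw [runFrom, PMF.mem_support_bind_iff] at hρ
    obtain ⟨⟨o, m'⟩, hy, hρ⟩ := hρ
    obtain ⟨h1, h2, h3⟩ := step_runs hP h (by omega) x m hu _ hy
    simp only at h1 h2 h3
    rw [max_eq_right hp] at h2
    cases o with
    | none =>
      simp only [PMF.mem_support_pure_iff] at hρ
      subst hρ
      rw [List.mem_cons, List.mem_map] at hrep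
      rcases hrep with rfl | ⟨-, -, rfl⟩
      · exact ⟨h2, by simp only; omega⟩
      · exact ⟨h2, Nat.zero_le _⟩
    | some y =>
      obtain ⟨S', z⟩ := y
      simp only [PMF.support_map, Set.mem_image] at hρ
      obtain ⟨ρ', hρ', rfl⟩ := hρ
      obtain ⟨h4, h5⟩ := h3 _ rfl
      rw [List.mem_cons] at hrep
      rcases hrep with rfl | hrep
      · exact ⟨h2, by simp only; omega⟩
      · exact ih (j + 1) (by omega) S' h5 { m' with time := 0 } h4 (Nat.zero_le _) h2 ρ' hρ' rep
          hrep

/-- The meter after the initialization. -/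
def startMeter (P : Params) : Meter := ⟨64 + (P.T + 3), 64 + (P.T + 3), 64 + (P.T + 3)⟩

theorem run_eq {d : ℕ} (P : Params) (stream : List (Token d)) :
    run P stream = runFrom P stream ⟨0, [], MR.empty⟩ (startMeter P) := by
  have : (start d P).exec ⟨0, 0, 0⟩ = PMF.pure (some ⟨0, [], MR.empty⟩, startMeter P) := by
    change PMF.pure _ = _
    congr 2
    simp [Meter.alloc, startMeter, MR.overhead]
  rw [run, this, PMF.pure_bind]

theorem State.sizeInv_init (d : ℕ) (P : Params) :
    (⟨0, [], MR.empty⟩ : State d).SizeInv P 0 where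
  den_count := rfl
  den_size := MR.sizeInv_empty P
  num_size := by simp
  nodup := by simp
  counts := by simp
  length := by simp
  vmax_nonneg := le_rfl
  lower := by simp
  upper := by simp

theorem run_reports {d b : ℕ} {P : Params} (hP : P.Wf d b) (stream : List (Token d))
    (hn : stream.length ≤ P.n) : ∀ ρ ∈ (run P stream).support, ∀ rep ∈ ρ,
      rep.space ≤ spaceBound P d b ∧ rep.time ≤ 67 + P.T + stepTime P d b := by
  rw [run_eq]
  have h0 := MR.size_empty (d := d) (s := 1) P
  refine runFrom_reports hP (67 + P.T) stream 0 (by omega) _ (State.sizeInv_init d P) _ ?_ ?_ ?_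
  · simp [startMeter, State.words, h0, numWords]
  · simp only [startMeter]; omega
  · have hd := hP.d_pos
    have hT : P.T + 1 ≤ d * (b * (P.T + 1) * P.t) := by
      calc P.T + 1 = 1 * (1 * (P.T + 1) * 1) := by ring
        _ ≤ d * (b * (P.T + 1) * P.t) := by
          gcongr
          · exact hd
          · exact hP.b_pos
          · exact hP.t_pos
    simp only [startMeter, spaceBound]
    omega

/-! ### The state in a successful run -/

open Classical in
/-- The bucket of a value; `0` belongs to no bucket. -/
def bucketOf {d : ℕ} (v : EuclideanSpace ℝ (Fin d)) : Option ℤ :=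
  if v = 0 then none else some (bucketIndex ‖v‖)

theorem bucketOf_of_pos {d : ℕ} {v : EuclideanSpace ℝ (Fin d)} (h : 0 < ‖v‖) :
    bucketOf v = some (bucketIndex ‖v‖) := by
  rw [bucketOf, if_neg (norm_pos_iff.1 h)]

theorem bucketOf_of_le {d : ℕ} {v : EuclideanSpace ℝ (Fin d)} (h : ‖v‖ ≤ 0) :
    bucketOf v = none := by
  rw [bucketOf, if_pos (norm_le_zero_iff.1 h)]

theorem bucketOf_eq_some {d : ℕ} {v : EuclideanSpace ℝ (Fin d)} {i : ℤ}
    (h : bucketOf v = some i) : ‖v‖ ≤ radius i ∧ radius i < 2 * ‖v‖ := by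
  rcases (norm_nonneg v).lt_or_eq with h0 | h0
  · rw [bucketOf_of_pos h0, Option.some.injEq] at h
    rw [← h]
    exact ⟨le_radius_bucketIndex h0, radius_bucketIndex_lt h0⟩
  · rw [bucketOf_of_le h0.ge] at h
    cases h

/-- The key of a token with its value. -/
def Token.kv {d : ℕ} (x : Token d) : KV d d := ⟨x.key, x.val⟩

/-- The key of a token with the value `1`. -/
def Token.unit {d : ℕ} (x : Token d) : KV d 1 := ⟨x.key, !₂[1]⟩

/-- The pairs of the `i`-th bucket. -/
def bucketPairs {d : ℕ} (i : ℤ) (pre : List (Token d)) : List (KV d d) :=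
  (pre.filter fun x => decide (bucketOf x.val = some i)).map Token.kv

theorem bucketPairs_snoc_of_ne {d : ℕ} {i : ℤ} (pre : List (Token d)) {x : Token d}
    (h : bucketOf x.val ≠ some i) : bucketPairs i (pre ++ [x]) = bucketPairs i pre := by
  simp [bucketPairs, h]

theorem bucketPairs_snoc_of_eq {d : ℕ} {i : ℤ} (pre : List (Token d)) {x : Token d}
    (h : bucketOf x.val = some i) :
    bucketPairs i (pre ++ [x]) = bucketPairs i pre ++ [x.kv] := by
  simp [bucketPairs, h]

/-- The invariant on the accuracy of the state after the tokens `pre`, for the error bounds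
`E₀ 2ⁱ` and `E₁` on one call of SoftmaxBalance in the numerator and in the denominator. -/
structure State.GoodInv {d : ℕ} (P : Params) {ι : Type} (q : ι → EuclideanSpace ℝ (Fin d))
    (E₀ E₁ : ℝ) (pre : List (Token d)) (S : State d) : Prop where
  size : S.SizeInv P pre.length
  vmax_sq : S.vmax ^ 2 ≤ (pre.map fun x => ‖x.val‖ ^ 2).sum
  den : S.den.ErrInv P q P.r 1 (E₁ * callWeight P.t P.T S.den.count 0) (pre.map Token.unit)
  num : ∀ p ∈ S.num, p.2.count = (bucketPairs p.1 pre).length ∧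
    p.2.ErrInv P q P.r (radius p.1) (E₀ * radius p.1 * callWeight P.t P.T p.2.count 0)
      (bucketPairs p.1 pre)
  missing : ∀ x ∈ pre, ∀ i, bucketOf x.val = some i → i ∉ S.num.map Prod.fst →
    radius i ≤ thresholdVal d P S.vmax

theorem State.goodInv_init {d : ℕ} (P : Params) {ι : Type} (q : ι → EuclideanSpace ℝ (Fin d))
    (E₀ E₁ : ℝ) : (⟨0, [], MR.empty⟩ : State d).GoodInv P q E₀ E₁ [] where
  size := State.sizeInv_init d P
  vmax_sq := by simp
  den := (MR.errInv_empty P q P.r 1).mono (by simp [MR.empty, callWeight])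
  num := by simp
  missing := by simp

/-- What a successful call of MergeAndReduce does to the instance with index `i`. -/
def MR.Good {d : ℕ} (P : Params) {ι : Type} (q : ι → EuclideanSpace ℝ (Fin d)) (E₀ : ℝ) (i : ℤ)
    (pre : List (KV d d)) (x : KV d d) (m m' : MR d d) : Prop :=
  m'.count = m.count + 1 ∧ m'.SizeInv P ∧
    m'.ErrInv P q P.r (radius i) (E₀ * radius i * callWeight P.t P.T m'.count 0) (pre ++ [x])

/-- The delicate case is a bucket that was erased and is created anew, whose earlier pairs are lost.
By `missing` its radius is at most the old threshold, and thresholds only grow, so it is erased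
again in the same step. A new instance that survives has no earlier pairs. -/
theorem State.GoodInv.next {d : ℕ} {P : Params} (hε : 0 ≤ P.ε) {ι : Type}
    {q : ι → EuclideanSpace ℝ (Fin d)} {E₀ E₁ : ℝ} {pre : List (Token d)} {S : State d}
    (h : S.GoodInv P q E₀ E₁ pre) {x : Token d} {num : List (ℤ × MR d d)} {den : MR d 1}
    (hnum : (‖x.val‖ ≤ 0 ∧ num = S.num) ∨ (0 < ‖x.val‖ ∧ Sent (bucketIndex ‖x.val‖)
      (MR.Good P q E₀ (bucketIndex ‖x.val‖) [] x.kv MR.empty)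
      (MR.Good P q E₀ (bucketIndex ‖x.val‖) (bucketPairs (bucketIndex ‖x.val‖) pre) x.kv)
      S.num num))
    (hden : den.count = S.den.count + 1 ∧ den.SizeInv P ∧
      den.ErrInv P q P.r 1 (E₁ * callWeight P.t P.T den.count 0)
        (pre.map Token.unit ++ [x.unit])) :
    State.GoodInv P q E₀ E₁ (pre ++ [x]) ⟨max S.vmax ‖x.val‖,
      survivors (thresholdVal d P (max S.vmax ‖x.val‖)) num, den⟩ := by
  have hθ : thresholdVal d P S.vmax ≤ thresholdVal d P (max S.vmax ‖x.val‖) :=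
    thresholdVal_mono hε (le_max_left _ _)
  have hsum0 : 0 ≤ (pre.map fun x => ‖x.val‖ ^ 2).sum :=
    (sq_nonneg _).trans h.vmax_sq
  have hsize := h.size.next (fun m hm => ⟨hm.1, hm.2.1⟩) (fun m m' hm => ⟨hm.1, hm.2.1⟩) hnum
    ⟨hden.1, hden.2.1⟩
  refine ⟨by simpa using hsize, ?_, by simpa using hden.2.2, ?_, ?_⟩
  · rw [List.map_append, List.sum_append, List.map_singleton, List.sum_singleton]
    rcases max_choice S.vmax ‖x.val‖ with h1 | h1
    · simp only [h1]
      linarith [h.vmax_sq, sq_nonneg ‖x.val‖]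
    · simp only [h1]
      linarith
  · intro p hp
    rw [mem_survivors] at hp
    obtain ⟨hp, hlt⟩ := hp
    rcases hnum with ⟨h0, rfl⟩ | ⟨h0, hs⟩
    · rw [bucketPairs_snoc_of_ne pre (by rw [bucketOf_of_le h0]; simp)]
      exact h.num p hp
    · rcases hs.mem h.size.nodup hp with ⟨h1, h2⟩ | ⟨h1, h2, h3⟩ | ⟨h1, m, h2, h3⟩
      · rw [bucketPairs_snoc_of_ne pre (by rw [bucketOf_of_pos h0]; simpa using h2.symm)]
        exact h.num p h1
      · rw [← h1] at h2 h3
        -- An earlier pair would force the radius below the old threshold, against its survival of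
        -- the new one.
        have hnil : bucketPairs p.1 pre = [] := by
          rw [bucketPairs, List.map_eq_nil_iff, List.filter_eq_nil_iff]
          intro y hy hb
          have := h.missing y hy p.1 (of_decide_eq_true hb) h2
          linarith
        rw [bucketPairs_snoc_of_eq pre (by rw [bucketOf_of_pos h0, h1]), hnil]
        exact ⟨by rw [h3.1]; rfl, h3.2.2⟩
      · rw [← h1] at h2 h3
        rw [bucketPairs_snoc_of_eq pre (by rw [bucketOf_of_pos h0, h1])]
        exact ⟨by rw [h3.1, (h.num _ h2).1]; simp, h3.2.2⟩
  · intro y hy i hi hmem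
    by_contra hlt
    rw [not_le] at hlt
    have hmem' : i ∉ num.map Prod.fst := by
      intro hm
      obtain ⟨p, hp, rfl⟩ := List.mem_map.1 hm
      exact hmem (List.mem_map.2 ⟨p, mem_survivors.2 ⟨hp, hlt⟩, rfl⟩)
    rw [List.mem_append, List.mem_singleton] at hy
    rcases hnum with ⟨h0, rfl⟩ | ⟨h0, hs⟩
    · rcases hy with hy | rfl
      · exact absurd (h.missing y hy i hi hmem') (not_le.2 (hθ.trans_lt hlt))
      · rw [bucketOf_of_le h0] at hi
        cases hi
    · rcases hy with hy | rfl
      · exact absurd (h.missing y hy i hi fun hm => hmem' (hs.subset_keys hm))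
          (not_le.2 (hθ.trans_lt hlt))
      · rw [bucketOf_of_pos h0, Option.some.injEq] at hi
        exact hmem' (hi ▸ hs.mem_keys)

/-- The estimate that is computed from a state. -/
def State.estimate {d : ℕ} (P : Params) (S : State d) (q : EuclideanSpace ℝ (Fin d)) :
    EuclideanSpace ℝ (Fin d) :=
  (S.den.estimate P q 0)⁻¹ • (S.num.map fun p => p.2.estimate P q).sum

theorem output_holds {d : ℕ} (P : Params) (S : State d) (q : EuclideanSpace ℝ (Fin d))
    (h : 0 < S.den.estimate P q 0) : Holds 0 (output P S q) fun z => z = S.estimate P q := by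
  rw [output]
  refine Holds.skip (holds_allocW _) (Holds.step (computes_addBuckets P q S.num 0)
    (Holds.step (computes_estimate P q S.den 0) (Holds.step (computes_leR _ _) ?_)))
  rw [if_neg (by simpa using h)]
  refine Holds.step (computes_divAll _ _) (Holds.skip (holds_freeW _) (Holds.pure ?_))
  simp [State.estimate]
  rfl

/-- One arrival feeds at most one numerator instance and the denominator; each makes at most `T`
calls, whence `2 (T β)`. Success also requires a positive denominator, which `hpos` draws from the
accuracy of the new state. -/
theorem step_holds {d b : ℕ} {P : Params} (hP : P.Wf d b) {ι : Type}
    {q : ι → EuclideanSpace ℝ (Fin d)} {E₀ E₁ : ℝ} {β : ℝ≥0∞} (hE₀ : 0 ≤ E₀) (hE₁ : 0 ≤ E₁)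
    (hcall : ∀ (i : ℤ) (C : List (KV d d)), C.length ≤ P.t →
      (∀ x ∈ C, ‖x.key‖ ≤ P.r ∧ ‖x.val‖ ≤ radius i) →
      Holds β (softmaxBalance P.n P.r (radius i) P.δ C) fun out =>
        ∀ j, ‖(2 : ℝ) • pairSum (q j) out - pairSum (q j) C‖ ≤ E₀ * radius i)
    (hcall1 : ∀ C : List (KV d 1), C.length ≤ P.t →
      (∀ x ∈ C, ‖x.key‖ ≤ P.r ∧ ‖x.val‖ ≤ 1) →
      Holds β (softmaxBalance P.n P.r 1 P.δ C) fun out =>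
        ∀ j, ‖(2 : ℝ) • pairSum (q j) out - pairSum (q j) C‖ ≤ E₁)
    {pre : List (Token d)} {S : State d} (h : S.GoodInv P q E₀ E₁ pre)
    (x : Token d) (hx : ‖x.key‖ ≤ P.r)
    (hpos : ∀ S' : State d, S'.GoodInv P q E₀ E₁ (pre ++ [x]) →
      0 < S'.den.estimate P x.query 0) :
    Holds (2 * (P.T * β)) (step P S x) fun y => y.1.GoodInv P q E₀ E₁ (pre ++ [x]) ∧
      y.2 = y.1.estimate P x.query := by
  have ht := hP.t_pos
  have hR : ∀ i, 0 ≤ E₀ * radius i := fun i => mul_nonneg hE₀ (radius_pos i).le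
  rw [step, two_mul]
  refine Holds.skip (holds_allocW _) (Holds.step (computes_dot _ _)
    (Holds.step (computes_sqrtR _) ?_))
  rw [sqrt_inner_self]
  have hbucket : 0 < ‖x.val‖ → ‖x.kv.key‖ ≤ P.r ∧ ‖x.kv.val‖ ≤ radius (bucketIndex ‖x.val‖) :=
    fun h0 => ⟨hx, le_radius_bucketIndex h0⟩
  have hsend : Holds (P.T * β) (bucketAndSend P x.kv ‖x.val‖ S.num) fun num =>
      (‖x.val‖ ≤ 0 ∧ num = S.num) ∨ (0 < ‖x.val‖ ∧ Sent (bucketIndex ‖x.val‖)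
        (MR.Good P q E₀ (bucketIndex ‖x.val‖) [] x.kv MR.empty)
        (MR.Good P q E₀ (bucketIndex ‖x.val‖) (bucketPairs (bucketIndex ‖x.val‖) pre) x.kv)
        S.num num) := by
    refine bucketAndSend_holds _ _ _ (fun h0 => ?_) (fun h0 m hm => ?_)
    · exact MR.step_holds ht q (hcall _) (hR _) [] MR.empty (MR.sizeInv_empty P)
        ((MR.errInv_empty P q P.r _).mono (by simp [MR.empty, callWeight])) x.kv (hbucket h0)
    · exact MR.step_holds ht q (hcall _) (hR _) _ m (h.size.num_size _ hm) (h.num _ hm).2 x.kv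
        (hbucket h0)
  refine Holds.bind hsend fun num hnum => Holds.step (computes_leR _ _) ?_
  rw [ite_decide_le_eq_max]
  refine Holds.step (computes_threshold _ _ _) ?_
  rw [← zero_add (P.T * β)]
  refine Holds.bind (eraseSmall_holds P _ num) ?_
  rintro num' rfl
  rw [← add_zero (P.T * β)]
  have hunit : ‖x.unit.key‖ ≤ P.r ∧ ‖x.unit.val‖ ≤ 1 := ⟨hx, by
    simp [Token.unit, EuclideanSpace.norm_eq]⟩
  refine Holds.bind (MR.step_holds ht q hcall1 hE₁ _ S.den h.size.den_size h.den x.unit hunit) ?_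
  intro den hden
  have hgood := h.next hP.eps_nonneg hnum hden
  rw [← add_zero (0 : ℝ≥0∞)]
  refine Holds.bind (output_holds P _ _ (hpos _ hgood)) ?_
  rintro z rfl
  exact Holds.skip (holds_freeW _) (Holds.pure ⟨hgood, rfl⟩)


/-! ### The accuracy of the estimate -/

theorem norm_sum_map_le {α E : Type} [SeminormedAddCommGroup E] (l : List α) (f : α → E)
    (g : α → ℝ) (h : ∀ a ∈ l, ‖f a‖ ≤ g a) : ‖(l.map f).sum‖ ≤ (l.map g).sum := by
  induction l with
  | nil => simp
  | cons a l ih =>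
    rw [List.map_cons, List.sum_cons, List.map_cons, List.sum_cons]
    exact (norm_add_le _ _).trans (add_le_add (h a List.mem_cons_self)
      (ih fun b hb => h b (List.mem_cons_of_mem _ hb)))

-- Every element has at most one colour, so a sum over distinct colours counts it at most once.
open Classical in
theorem sum_map_filter_eq {α A : Type} [AddCommMonoid A] (K : List ℤ) (hK : K.Nodup)
    (l : List α) (c : α → Option ℤ) (g : α → A) :
    (K.map fun i => ((l.filter fun x => decide (c x = some i)).map g).sum).sum =
      (l.map fun x => if ∃ i ∈ K, c x = some i then g x else 0).sum := by
  induction l with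
  | nil => simp
  | cons x l ih =>
    have h1 : ∀ i, (((x :: l).filter fun x => decide (c x = some i)).map g).sum =
        (if c x = some i then g x else 0) +
          ((l.filter fun x => decide (c x = some i)).map g).sum := by
      intro i
      by_cases h : c x = some i <;> simp [h]
    simp only [h1, List.sum_map_add, ih, List.map_cons, List.sum_cons]
    congr 1
    rw [← List.sum_toFinset _ hK]
    cases hc : c x with
    | none => simp
    | some i₀ => simp

theorem kernel_bounds {d : ℕ} {r : ℝ} {x y : EuclideanSpace ℝ (Fin d)} (hx : ‖x‖ ≤ r)
    (hy : ‖y‖ ≤ r) : Real.exp (-(r ^ 2 / Real.sqrt d)) ≤ kernel x y := by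
  have h := abs_real_inner_le_norm x y
  have h2 : ‖x‖ * ‖y‖ ≤ r ^ 2 := by
    rw [pow_two]
    exact mul_le_mul hx hy (norm_nonneg _) ((norm_nonneg _).trans hx)
  rw [kernel, Real.exp_le_exp, ← neg_div]
  gcongr
  exact (abs_le.1 (h.trans h2)).1

/-- There are two sources of error. A living bucket of radius `2ⁱ` costs `E₀ 2ⁱ T / t` for each of
its pairs, and `2ⁱ < 2 ‖v‖` makes this proportional to `∑ ‖v‖`. A pair whose bucket is missing has
`‖v‖ ≤ 2ⁱ`, at most the threshold, and costs at most the threshold times its kernel weight. -/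
theorem State.GoodInv.num_error {d : ℕ} {P : Params} {ι : Type}
    {q : ι → EuclideanSpace ℝ (Fin d)} {E₀ E₁ : ℝ} (hE₀ : 0 ≤ E₀) (ht : 0 < P.t)
    {pre : List (Token d)} {S : State d} (hε : 0 ≤ P.ε)
    (h : S.GoodInv P q E₀ E₁ pre) (j : ι) :
    ‖(S.num.map fun p => p.2.estimate P (q j)).sum - pairSum (q j) (pre.map Token.kv)‖ ≤
      2 * (E₀ * (P.T / P.t)) * (pre.map fun x => ‖x.val‖).sum +
        thresholdVal d P S.vmax * (pre.map fun x => kernel x.key (q j)).sum := by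
  classical
  have hθ0 : 0 ≤ thresholdVal d P S.vmax := by
    have := h.size.vmax_nonneg
    unfold thresholdVal
    positivity
  have hnum : ‖(S.num.map fun p => p.2.estimate P (q j) -
      pairSum (q j) (bucketPairs p.1 pre)).sum‖ ≤
      2 * (E₀ * (P.T / P.t)) * (pre.map fun x => ‖x.val‖).sum := by
    have ha : 0 ≤ E₀ * (P.T / P.t) := by positivity
    have h1 : ∀ p ∈ S.num, ‖p.2.estimate P (q j) - pairSum (q j) (bucketPairs p.1 pre)‖ ≤
        ((pre.filter fun x => decide (bucketOf x.val = some p.1)).map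
          fun x => 2 * (E₀ * (P.T / P.t)) * ‖x.val‖).sum := by
      intro p hp
      obtain ⟨h2, h3⟩ := h.num p hp
      have hr := radius_pos p.1
      calc _ ≤ E₀ * radius p.1 * callWeight P.t P.T p.2.count 0 := h3.error j
        _ ≤ E₀ * radius p.1 * (P.T * (p.2.count / P.t)) := by
            gcongr
            exact callWeight_zero_le ht _ _
        _ = p.2.count * (E₀ * (P.T / P.t) * radius p.1) := by ring
        _ = ((pre.filter fun x => decide (bucketOf x.val = some p.1)).map
              fun _ => E₀ * (P.T / P.t) * radius p.1).sum := by
            rw [h2, List.map_const', List.sum_replicate, nsmul_eq_mul, bucketPairs,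
              List.length_map]
        _ ≤ _ := by
            refine List.sum_le_sum fun x hx => ?_
            have hx := of_decide_eq_true (List.mem_filter.1 hx).2
            have := (bucketOf_eq_some hx).2.le
            calc E₀ * (P.T / P.t) * radius p.1 ≤ E₀ * (P.T / P.t) * (2 * ‖x.val‖) := by gcongr
              _ = _ := by ring
    refine (norm_sum_map_le _ _ _ h1).trans ?_
    have h2 := sum_map_filter_eq (S.num.map Prod.fst) h.size.nodup pre
      (fun x => bucketOf x.val) (fun x => 2 * (E₀ * (P.T / P.t)) * ‖x.val‖)
    rw [List.map_map] at h2
    rw [← List.sum_map_mul_left]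
    refine (le_of_eq h2).trans (List.sum_le_sum fun x _ => ?_)
    split_ifs
    · exact le_rfl
    · positivity
  have hmiss : ‖(S.num.map fun p => pairSum (q j) (bucketPairs p.1 pre)).sum -
      pairSum (q j) (pre.map Token.kv)‖ ≤
      thresholdVal d P S.vmax * (pre.map fun x => kernel x.key (q j)).sum := by
    have h2 := sum_map_filter_eq (S.num.map Prod.fst) h.size.nodup pre
      (fun x => bucketOf x.val) (fun x => kernel x.key (q j) • x.val)
    rw [List.map_map] at h2
    have h3 : (S.num.map fun p => pairSum (q j) (bucketPairs p.1 pre)).sum =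
        (pre.map fun x => if ∃ i ∈ S.num.map Prod.fst, bucketOf x.val = some i then
          kernel x.key (q j) • x.val else 0).sum := by
      rw [← h2]
      congr 1
      refine List.map_congr_left fun p _ => ?_
      simp only [pairSum, bucketPairs, List.map_map]
      rfl
    have h4 : (pre.map fun x => if ∃ i ∈ S.num.map Prod.fst, bucketOf x.val = some i then
          kernel x.key (q j) • x.val else 0).sum - pairSum (q j) (pre.map Token.kv) =
        -(pre.map fun x => if ∃ i ∈ S.num.map Prod.fst, bucketOf x.val = some i then 0 else
          kernel x.key (q j) • x.val).sum := by
      rw [sub_eq_iff_eq_add, neg_add_eq_sub, eq_sub_iff_add_eq, ← List.sum_map_add, pairSum,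
        List.map_map]
      congr 1
      refine List.map_congr_left fun x _ => ?_
      split_ifs <;> simp [Token.kv]
    rw [h3, h4, norm_neg, ← List.sum_map_mul_left]
    refine norm_sum_map_le _ _ _ fun x hx => ?_
    have hk := kernel_pos x.key (q j)
    split_ifs with hex
    · rw [norm_zero]
      positivity
    · rw [norm_smul, Real.norm_eq_abs, abs_of_pos hk, mul_comm]
      refine mul_le_mul_of_nonneg_right ?_ hk.le
      rcases (norm_nonneg x.val).lt_or_eq with h0 | h0
      · have hb := bucketOf_of_pos h0
        refine (le_radius_bucketIndex h0).trans (h.missing x hx _ hb fun hm => hex ⟨_, hm, hb⟩)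
      · rw [← h0]; exact hθ0
  calc _ = ‖(S.num.map fun p => p.2.estimate P (q j) -
        pairSum (q j) (bucketPairs p.1 pre)).sum +
        ((S.num.map fun p => pairSum (q j) (bucketPairs p.1 pre)).sum -
          pairSum (q j) (pre.map Token.kv))‖ := by
        rw [← add_sub_assoc, ← List.sum_map_add]
        simp
    _ ≤ _ := (norm_add_le _ _).trans (add_le_add hnum hmiss)

/-- The difference is `(D')⁻¹ ((N' - N) + ((D - D') / D) N)`. Its bracket is at most `(5/8 + 1/8) ε
A` and `D' ≥ 7/8 D`, which gives the factor `6/7 < 1`. -/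
theorem norm_quotient_sub_le {E : Type} [NormedAddCommGroup E] [NormedSpace ℝ E] {N N' : E}
    {D D' ε A : ℝ} (hD : 0 < D) (hε : 0 ≤ ε) (hε1 : ε ≤ 1) (hN : ‖N‖ ≤ A)
    (hN' : ‖N' - N‖ ≤ 5 / 8 * ε * A) (hD' : |D' - D| ≤ ε / 8 * D) :
    0 < D' ∧ ‖D'⁻¹ • N' - D⁻¹ • N‖ ≤ ε * (A / D) := by
  have hA : 0 ≤ A := (norm_nonneg _).trans hN
  have h1 : 7 / 8 * D ≤ D' := by
    have := (abs_le.1 hD').1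
    nlinarith
  have hD'0 : 0 < D' := by linarith
  refine ⟨hD'0, ?_⟩
  have e : D'⁻¹ • N' - D⁻¹ • N = D'⁻¹ • ((N' - N) + ((D - D') / D) • N) := by
    rw [smul_add, smul_sub, smul_smul, sub_add, sub_right_inj, ← sub_smul]
    congr 1
    field_simp
    ring
  rw [e, norm_smul, Real.norm_eq_abs, abs_of_pos (inv_pos.2 hD'0)]
  have h2 : ‖((D - D') / D) • N‖ ≤ ε / 8 * A := by
    rw [norm_smul, Real.norm_eq_abs, abs_div, abs_of_pos hD, abs_sub_comm]
    refine mul_le_mul ?_ hN (norm_nonneg _) (by positivity)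
    rwa [div_le_iff₀ hD]
  have h3 : ‖N' - N + ((D - D') / D) • N‖ ≤ 3 / 4 * ε * A :=
    (norm_add_le _ _).trans (by linarith)
  calc D'⁻¹ * ‖N' - N + ((D - D') / D) • N‖ ≤ (7 / 8 * D)⁻¹ * (3 / 4 * ε * A) := by gcongr
    _ = 6 / 7 * (ε * (A / D)) := by field_simp; ring
    _ ≤ _ := by
      have : 0 ≤ ε * (A / D) := by positivity
      linarith

/-- The share `5/8` of the numerator error in `norm_quotient_sub_le` splits into `1/8` for the
halvings and `1/2` for the missing buckets. -/
theorem State.GoodInv.accuracy {d m : ℕ} {P : Params} {ι : Type}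
    {q : ι → EuclideanSpace ℝ (Fin d)} {E₀ E₁ : ℝ} (hE₀ : 0 ≤ E₀) (hE₁ : 0 ≤ E₁) (ht : 0 < P.t)
    (hε : 0 ≤ P.ε) (hε1 : P.ε ≤ 1)
    (h₀ : 2 * (E₀ * (P.T / P.t)) ≤ P.ε / 8 * Real.exp (-(P.r ^ 2 / Real.sqrt d)))
    (h₁ : E₁ * (P.T / P.t) ≤ P.ε / 8 * Real.exp (-(P.r ^ 2 / Real.sqrt d)))
    (tok : Fin m → Token d) (hm : 0 < m) (hmn : m ≤ P.n) (hkey : ∀ i, ‖(tok i).key‖ ≤ P.r)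
    {S : State d} (h : S.GoodInv P q E₀ E₁ (List.ofFn tok)) (j : ι) (hq : ‖q j‖ ≤ P.r) :
    0 < S.den.estimate P (q j) 0 ∧
    ‖S.estimate P (q j) - (∑ i, kernel (tok i).key (q j))⁻¹ •
        ∑ i, kernel (tok i).key (q j) • (tok i).val‖ ≤
      P.ε * (Real.sqrt (∑ i, kernel (tok i).key (q j) ^ 2) *
        Real.sqrt (∑ i, ‖(tok i).val‖ ^ 2) / ∑ i, kernel (tok i).key (q j)) := by
  set W : Fin m → ℝ := fun i => kernel (tok i).key (q j) with hW
  set e : ℝ := Real.exp (-(P.r ^ 2 / Real.sqrt d)) with he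
  have he0 : 0 < e := Real.exp_pos _
  have he1 : e ≤ 1 := by
    rw [he, Real.exp_le_one_iff]
    have : 0 ≤ P.r ^ 2 / Real.sqrt d := by positivity
    linarith
  have hWe : ∀ i, e ≤ W i := fun i => kernel_bounds (hkey i) hq
  have hW0 : ∀ i, 0 < W i := fun i => kernel_pos _ _
  have : Nonempty (Fin m) := ⟨⟨0, hm⟩⟩
  have hD : 0 < ∑ i, W i := Finset.sum_pos (fun i _ => hW0 i) Finset.univ_nonempty
  have hn0 : (0 : ℝ) < P.n := by exact_mod_cast hm.trans_le hmn
  set V : ℝ := Real.sqrt (∑ i, ‖(tok i).val‖ ^ 2) with hV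
  set w : ℝ := Real.sqrt (∑ i, W i ^ 2) with hw
  have hV0 : 0 ≤ V := Real.sqrt_nonneg _
  have hw0 : 0 ≤ w := Real.sqrt_nonneg _
  have hcs : ∑ i, W i * ‖(tok i).val‖ ≤ w * V :=
    Real.sum_mul_le_sqrt_mul_sqrt _ _ _
  have hden : |S.den.estimate P (q j) 0 - ∑ i, W i| ≤ P.ε / 8 * ∑ i, W i := by
    have h2 : pairSum (q j) ((List.ofFn tok).map Token.unit) 0 = ∑ i, W i := by
      rw [pairSum, List.map_map, List.map_ofFn, List.sum_ofFn, WithLp.ofLp_sum, Finset.sum_apply]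
      simp [Token.unit, hW]
    have h3 := (PiLp.norm_apply_le _ (0 : Fin 1)).trans (h.den.error j)
    rw [PiLp.sub_apply, h2, Real.norm_eq_abs] at h3
    refine h3.trans ?_
    have h4 : S.den.count = m := by rw [h.size.den_count, List.length_ofFn]
    rw [h4]
    -- The lower bound on the kernel turns an error proportional to the number of pairs into one
    -- relative to `D`.
    have h5 : m * e ≤ ∑ i, W i := by
      have := Finset.card_nsmul_le_sum Finset.univ W e fun i _ => hWe i
      simpa using this
    calc E₁ * callWeight P.t P.T m 0 ≤ E₁ * (P.T * (m / P.t)) := by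
          gcongr
          exact callWeight_zero_le ht _ _
      _ = E₁ * (P.T / P.t) * m := by ring
      _ ≤ P.ε / 8 * e * m := by gcongr
      _ = P.ε / 8 * (m * e) := by ring
      _ ≤ _ := by gcongr
  have hpair : pairSum (q j) ((List.ofFn tok).map Token.kv) = ∑ i, W i • (tok i).val := by
    rw [pairSum, List.map_map, List.map_ofFn, List.sum_ofFn]
    rfl
  have hN : ‖∑ i, W i • (tok i).val‖ ≤ w * V := by
    refine (norm_sum_le _ _).trans (le_trans (le_of_eq ?_) hcs)
    refine Finset.sum_congr rfl fun i _ => ?_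
    rw [norm_smul, Real.norm_eq_abs, abs_of_pos (hW0 i)]
  have hN' : ‖(S.num.map fun p => p.2.estimate P (q j)).sum - ∑ i, W i • (tok i).val‖ ≤
      5 / 8 * P.ε * (w * V) := by
    have h2 := h.num_error hE₀ ht hε j
    rw [hpair, List.map_ofFn, List.map_ofFn, List.sum_ofFn, List.sum_ofFn] at h2
    refine h2.trans ?_
    -- Again `e ≤ W i`: the unweighted sum of norms becomes `∑ W i ‖v i‖`, to which Cauchy–Schwarz
    -- applies.
    have h3 : 2 * (E₀ * (P.T / P.t)) * ∑ i, ‖(tok i).val‖ ≤ P.ε / 8 * (w * V) := by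
      calc _ ≤ P.ε / 8 * e * ∑ i, ‖(tok i).val‖ := by gcongr
        _ = P.ε / 8 * ∑ i, e * ‖(tok i).val‖ := by rw [mul_assoc, Finset.mul_sum]
        _ ≤ P.ε / 8 * ∑ i, W i * ‖(tok i).val‖ := by
            gcongr with i
            exact hWe i
        _ ≤ _ := by gcongr
    have hvmax : S.vmax ≤ V := by
      refine Real.le_sqrt_of_sq_le ?_
      have := h.vmax_sq
      rwa [List.map_ofFn, List.sum_ofFn] at this
    -- Cauchy–Schwarz against the constant `1`. The factor `n` is cancelled by the `2n` in the
    -- threshold, whose exponential factor is simply bounded by `1`.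
    have hsum : ∑ i, W i ≤ P.n * w := by
      have h5 : ∑ i, 1 * W i ≤ _ := Real.sum_mul_le_sqrt_mul_sqrt Finset.univ (fun _ => 1) W
      simp only [one_mul, one_pow, Finset.sum_const, Finset.card_univ, Fintype.card_fin,
        nsmul_eq_mul, mul_one] at h5
      refine h5.trans ?_
      have h6 : Real.sqrt m ≤ P.n := by
        rw [Real.sqrt_le_left hn0.le]
        have : (m : ℝ) ≤ P.n := by exact_mod_cast hmn
        have h1n : (1 : ℝ) ≤ P.n := by exact_mod_cast hm.trans_le hmn
        nlinarith
      gcongr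
    have h4 : thresholdVal d P S.vmax * ∑ i, W i ≤ P.ε / 2 * (w * V) := by
      have := h.size.vmax_nonneg
      rw [thresholdVal, ← he]
      calc P.ε / (2 * P.n) * e * S.vmax * ∑ i, W i ≤
            P.ε / (2 * P.n) * 1 * V * (P.n * w) := by gcongr
        _ = _ := by field_simp
    have h3' : 2 * (E₀ * (P.T / P.t)) * ∑ i, ((fun x : Token d => ‖x.val‖) ∘ tok) i ≤
      P.ε / 8 * (w * V) := h3
    have h4' : thresholdVal d P S.vmax *
      ∑ i, ((fun x : Token d => kernel x.key (q j)) ∘ tok) i ≤ P.ε / 2 * (w * V) := h4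
    linarith
  exact norm_quotient_sub_le hD hε hε1 hN hN' hden

/-! ### The probability of a successful run -/

/-- A union bound over the tokens: each step preserves `GoodInv` except with probability `2 (T β)`,
and `hacc` reads positivity and accuracy off the invariant at every prefix. -/
theorem runFrom_failure {d b : ℕ} {P : Params} (hP : P.Wf d b) {ι : Type}
    {q : ι → EuclideanSpace ℝ (Fin d)} {E₀ E₁ : ℝ} {β : ℝ≥0∞} (hE₀ : 0 ≤ E₀) (hE₁ : 0 ≤ E₁)
    (hcall : ∀ (i : ℤ) (C : List (KV d d)), C.length ≤ P.t →
      (∀ x ∈ C, ‖x.key‖ ≤ P.r ∧ ‖x.val‖ ≤ radius i) →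
      Holds β (softmaxBalance P.n P.r (radius i) P.δ C) fun out =>
        ∀ j, ‖(2 : ℝ) • pairSum (q j) out - pairSum (q j) C‖ ≤ E₀ * radius i)
    (hcall1 : ∀ C : List (KV d 1), C.length ≤ P.t →
      (∀ x ∈ C, ‖x.key‖ ≤ P.r ∧ ‖x.val‖ ≤ 1) →
      Holds β (softmaxBalance P.n P.r 1 P.δ C) fun out =>
        ∀ j, ‖(2 : ℝ) • pairSum (q j) out - pairSum (q j) C‖ ≤ E₁)
    (A : List (Token d) → EuclideanSpace ℝ (Fin d) → Prop) (stream : List (Token d))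
    (hkey : ∀ x ∈ stream, ‖x.key‖ ≤ P.r)
    (hacc : ∀ pre x post, stream = pre ++ x :: post → ∀ S : State d,
      S.GoodInv P q E₀ E₁ (pre ++ [x]) → 0 < S.den.estimate P x.query 0 ∧
        A (pre ++ [x]) (S.estimate P x.query))
    (xs pre : List (Token d)) (hs : stream = pre ++ xs) (S : State d)
    (h : S.GoodInv P q E₀ E₁ pre) (m : Meter) :
    (runFrom P xs S m).toOuterMeasure {ρ | ¬ ∀ i < xs.length, ∃ rep z, ρ[i]? = some rep ∧
      rep.estimate = some z ∧ A (pre ++ xs.take (i + 1)) z} ≤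
      xs.length * (2 * (P.T * β)) := by
  induction xs generalizing pre S m with
  | nil =>
    rw [runFrom, PMF.toOuterMeasure_pure_apply, if_neg (by simp)]
    exact zero_le
  | cons x xs ih =>
    have hx : x ∈ stream := by rw [hs]; simp
    have hstep := step_holds hP hE₀ hE₁ hcall hcall1 h x (hkey x hx)
      (fun S' hS' => (hacc pre x xs hs S' hS').1) m
    have e : ((x :: xs).length : ℝ≥0∞) * (2 * (P.T * β)) =
        2 * (P.T * β) + xs.length * (2 * (P.T * β)) := by
      rw [List.length_cons]; push_cast; ring
    rw [runFrom, e]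
    refine (PMF.toOuterMeasure_bind_le _ _ _ _ (xs.length * (2 * (P.T * β))) ?_).trans
      (add_le_add_left hstep _)
    rintro ⟨o, m'⟩ - hgood
    simp only [Set.mem_ofPred_eq, not_not] at hgood
    obtain ⟨⟨S', z⟩, rfl, hS', hz⟩ := hgood
    simp only at hS' hz
    subst hz
    simp only [PMF.toOuterMeasure_map_apply]
    refine le_trans ((PMF.toOuterMeasure _).mono ?_)
      (ih (pre ++ [x]) (by rw [hs]; simp) S' hS' { m' with time := 0 })
    intro ρ hρ hall
    refine hρ fun i hi => ?_
    cases i with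
    | zero =>
      refine ⟨_, _, List.getElem?_cons_zero, rfl, ?_⟩
      simpa using (hacc pre x xs hs S' hS').2
    | succ i =>
      obtain ⟨rep, z, h1, h2, h3⟩ := hall i (by simpa using hi)
      refine ⟨rep, z, by simpa using h1, h2, ?_⟩
      simpa using h3


/-! ### Attention -/

theorem attnWeights_apply {m d : ℕ} (q : EuclideanSpace ℝ (Fin d))
    (k : Fin m → EuclideanSpace ℝ (Fin d)) (i : Fin m) :
    attnWeights q (Matrix.of fun i c => k i c) i = kernel (k i) q / ∑ l, kernel (k l) q := by
  have h : ∀ i, ((Matrix.of fun i c => k i c) *ᵥ q.ofLp) i = inner ℝ (k i) q := by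
    intro i
    simp [Matrix.mulVec, dotProduct, PiLp.inner_apply, mul_comm]
  simp only [attnWeights, softmax, h, kernel]

theorem attn_eq {m d : ℕ} (q : EuclideanSpace ℝ (Fin d))
    (k v : Fin m → EuclideanSpace ℝ (Fin d)) :
    attn q (Matrix.of fun i c => k i c) (Matrix.of fun i c => v i c) =
      (∑ i, kernel (k i) q)⁻¹ • ∑ i, kernel (k i) q • v i := by
  ext c
  simp only [attn, Matrix.vecMul, dotProduct, attnWeights_apply, Matrix.of_apply, PiLp.smul_apply,
    WithLp.ofLp_sum, Finset.sum_apply, smul_eq_mul, Finset.mul_sum]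
  exact Finset.sum_congr rfl fun i _ => by ring

theorem norm_attnWeights {m d : ℕ} (q : EuclideanSpace ℝ (Fin d))
    (k : Fin m → EuclideanSpace ℝ (Fin d)) :
    ‖attnWeights q (Matrix.of fun i c => k i c)‖ =
      Real.sqrt (∑ i, kernel (k i) q ^ 2) / ∑ i, kernel (k i) q := by
  have h0 : 0 ≤ ∑ i, kernel (k i) q := Finset.sum_nonneg fun i _ => (kernel_pos _ _).le
  rw [EuclideanSpace.norm_eq]
  simp only [attnWeights_apply, Real.norm_eq_abs, sq_abs, div_pow, ← Finset.sum_div]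
  rw [Real.sqrt_div' _ (sq_nonneg _), Real.sqrt_sq h0]

theorem frobenius_eq {m d : ℕ} (v : Fin m → EuclideanSpace ℝ (Fin d)) :
    frobenius (Matrix.of fun i c => v i c) = Real.sqrt (∑ i, ‖v i‖ ^ 2) := by
  simp [frobenius, EuclideanSpace.norm_sq_eq]

/-! ### The parameters -/

/-- The sizes of the quantities that `params` computes. -/
structure ParamBounds (C : ℝ) (n t T : ℕ) (Z : ℝ) : Prop where
  t_pos : 0 < t
  le_t : C * (1 + Real.log n) ^ 3 * Z ≤ t
  t_le : t ≤ 2 * (C * (1 + Real.log n) ^ 3 * Z)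
  n_le : n ≤ t * 2 ^ T
  T_le : (T : ℝ) ≤ 2 * (1 + Real.log n)
  t_lt : T ≠ 0 → t < n

theorem half_le_log_two : (1 / 2 : ℝ) ≤ Real.log 2 := by
  have := Real.log_two_gt_d9
  linarith

theorem paramBounds {C Z : ℝ} (hC : 1 ≤ C) (hZ : 1 ≤ Z) {n : ℕ} (hn : 0 < n) :
    ParamBounds C n ⌈C * (1 + Real.log n) ^ 3 * Z⌉₊
      ⌈Real.logb 2 ((n : ℝ) / ⌈C * (1 + Real.log n) ^ 3 * Z⌉₊)⌉₊ Z := by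
  have hn1 : (1 : ℝ) ≤ n := by exact_mod_cast hn
  have hlog : 0 ≤ Real.log n := Real.log_nonneg hn1
  set Y : ℝ := C * (1 + Real.log n) ^ 3 * Z with hY
  have hY1 : 1 ≤ Y := by
    have h3 : 1 ≤ (1 + Real.log n) ^ 3 := one_le_pow₀ (by linarith)
    exact one_le_mul_of_one_le_of_one_le (one_le_mul_of_one_le_of_one_le hC h3) hZ
  set t : ℕ := ⌈Y⌉₊ with ht
  have ht0 : 0 < t := Nat.ceil_pos.2 (by linarith)
  have ht1 : (1 : ℝ) ≤ t := by exact_mod_cast ht0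
  have hnt : 0 < (n : ℝ) / t := by positivity
  refine ⟨ht0, Nat.le_ceil Y, ?_, ?_, ?_, ?_⟩
  · have := Nat.ceil_lt_add_one (show 0 ≤ Y by linarith)
    linarith
  · have h := Nat.le_ceil (Real.logb 2 ((n : ℝ) / t))
    rw [Real.logb_le_iff_le_rpow one_lt_two hnt, Real.rpow_natCast,
      div_le_iff₀ (by linarith)] at h
    have h' : (n : ℝ) ≤ ((t * 2 ^ ⌈Real.logb 2 ((n : ℝ) / t)⌉₊ : ℕ) : ℝ) := by
      push_cast
      linarith
    exact_mod_cast h'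
  · have h1 : Real.logb 2 ((n : ℝ) / t) ≤ 2 * Real.log n := by
      rw [Real.logb, div_le_iff₀ (Real.log_pos one_lt_two)]
      have h2 : Real.log ((n : ℝ) / t) ≤ Real.log n :=
        Real.log_le_log hnt (div_le_self (by linarith) ht1)
      nlinarith [half_le_log_two]
    have h3 : ⌈Real.logb 2 ((n : ℝ) / t)⌉₊ ≤ ⌈2 * Real.log n⌉₊ := Nat.ceil_le_ceil h1
    have h4 := Nat.ceil_lt_add_one (show 0 ≤ 2 * Real.log n by linarith)
    have h5 : (⌈Real.logb 2 ((n : ℝ) / t)⌉₊ : ℝ) ≤ ⌈2 * Real.log n⌉₊ := by exact_mod_cast h3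
    linarith
  · intro hT
    have h := Nat.ceil_pos.1 (Nat.pos_of_ne_zero hT)
    rw [Real.logb_pos_iff one_lt_two hnt, one_lt_div (by linarith)] at h
    exact_mod_cast h

/-- A bound on the number of living buckets. -/
def bucketBound (n : ℕ) : ℕ := ⌈4 * (1 + Real.log n)⌉₊ + 1

theorem bucketBound_le {n : ℕ} (hn : 0 < n) : (bucketBound n : ℝ) ≤ 6 * (1 + Real.log n) := by
  have hlog : 0 ≤ Real.log n := Real.log_nonneg (by exact_mod_cast hn)
  have h := Nat.ceil_lt_add_one (show 0 ≤ 4 * (1 + Real.log n) by linarith)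
  rw [bucketBound]
  push_cast
  linarith

/-- All radii lie within a ratio of `4n²`, so the indices span at most `log₂ (4n²) = 2 + 2 log₂ n`;
`log 2 ≥ 1/2` replaces this by `4 (1 + log n)`. -/
theorem length_le_bucketBound {n : ℕ} (hn : 0 < n) {θ v : ℝ}
    (hθ : 0 < v → 2 * v ≤ 4 * (n : ℝ) ^ 2 * θ)
    (K : List ℤ) (hK : K.Nodup) (h : ∀ i ∈ K, θ < radius i ∧ radius i < 2 * v) :
    K.length ≤ bucketBound n := by
  have hn0 : (0 : ℝ) < n := by exact_mod_cast hn
  rcases K.eq_nil_or_concat with rfl | ⟨K', i, hK'⟩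
  · simp
  have hmem : i ∈ K := by rw [hK']; simp
  have hne : K.toFinset.Nonempty := ⟨i, List.mem_toFinset.2 hmem⟩
  set i₀ := K.toFinset.min' hne with hi₀
  have hi₀m : i₀ ∈ K := List.mem_toFinset.1 (K.toFinset.min'_mem hne)
  have hsub : K.toFinset ⊆ Finset.Icc i₀ (i₀ + ⌈4 * (1 + Real.log n)⌉₊) := by
    intro i hi
    refine Finset.mem_Icc.2 ⟨K.toFinset.min'_le i hi, ?_⟩
    obtain ⟨h1, h2⟩ := h i (List.mem_toFinset.1 hi)
    obtain ⟨h3, -⟩ := h i₀ hi₀m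
    have hv : 0 < v := by linarith [radius_pos i]
    have h5 : radius i < 4 * (n : ℝ) ^ 2 * radius i₀ :=
      h2.trans_le ((hθ hv).trans (by gcongr))
    have h6 := Real.log_lt_log (radius_pos i) h5
    rw [Real.log_mul (by positivity) (radius_pos i₀).ne', Real.log_mul (by norm_num) (by positivity),
      Real.log_pow, radius, radius, Real.log_rpow two_pos, Real.log_rpow two_pos] at h6
    have h7 : Real.log 4 = 2 * Real.log 2 := by
      rw [show (4 : ℝ) = 2 ^ 2 by norm_num, Real.log_pow]; norm_num
    have hl2 := half_le_log_two
    have hlog : 0 ≤ Real.log n := Real.log_nonneg (by exact_mod_cast hn)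
    have h8 : (i : ℝ) - i₀ ≤ 4 * (1 + Real.log n) := by
      by_contra hcon
      push Not at hcon
      rw [h7] at h6
      push_cast at h6
      nlinarith
    have h9 := Nat.le_ceil (4 * (1 + Real.log n))
    have h10 : (i : ℝ) ≤ ((i₀ + ⌈4 * (1 + Real.log n)⌉₊ : ℤ) : ℝ) := by
      push_cast
      linarith
    exact_mod_cast h10
  have := Finset.card_le_card hsub
  rw [List.toFinset_card_of_nodup hK, Int.card_Icc] at this
  rw [bucketBound]
  omega

/-- If `T ≠ 0` then `baseSize ≤ t < n`, hence `exp (r² / √d) / ε ≤ n`. This removes `r` and `ε` from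
the threshold, which is at least `v / (2n²)`. -/
theorem params_wf {C : ℝ} (hC : 1 ≤ C) (b : ℕ) {n d : ℕ} {r ε : ℝ} (hn : 0 < n) (hd : 0 < d)
    (hε : 0 < ε) (hZ : 1 ≤ baseSize d r ε) :
    (params C 3 b n d r ε).Wf d (bucketBound n) := by
  have hp := paramBounds hC hZ hn
  refine ⟨hd, hp.t_pos, hε.le, hp.n_le, Nat.succ_pos _, ?_⟩
  by_cases hT : (params C 3 b n d r ε).T = 0
  · exact Or.inl hT
  refine Or.inr fun v K hK h => ?_
  have htn : ((params C 3 b n d r ε).t : ℝ) < n := by exact_mod_cast hp.t_lt hT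
  have hn0 : (0 : ℝ) < n := by exact_mod_cast hn
  have hn1 : (1 : ℝ) ≤ n := by exact_mod_cast hn
  have hd1 : 1 ≤ Real.sqrt d := by
    rw [Real.one_le_sqrt]; exact_mod_cast hd
  have hlog : 0 ≤ Real.log n := Real.log_nonneg hn1
  have hx : 0 ≤ r ^ 2 / Real.sqrt d := by positivity
  have hbase : baseSize d r ε < n := by
    refine lt_of_le_of_lt ?_ (hp.le_t.trans_lt htn)
    have h3 : 1 ≤ (1 + Real.log n) ^ 3 := one_le_pow₀ (by linarith)
    exact le_mul_of_one_le_left (by linarith) (one_le_mul_of_one_le_of_one_le hC h3)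
  have hexp : Real.exp (r ^ 2 / Real.sqrt d) / ε ≤ n := by
    refine le_trans ?_ hbase.le
    rw [baseSize]
    gcongr
    calc Real.exp (r ^ 2 / Real.sqrt d) ≤ Real.exp (2 * r ^ 2 / Real.sqrt d) := by
          rw [Real.exp_le_exp, mul_div_assoc]; linarith
      _ ≤ _ := le_mul_of_one_le_left (Real.exp_pos _).le hd1
  refine length_le_bucketBound hn (θ := thresholdVal d (params C 3 b n d r ε) v) (v := v)
    ?_ K hK h
  · intro hv
    change 2 * v ≤ 4 * (n : ℝ) ^ 2 * (ε / (2 * n) * Real.exp (-(r ^ 2 / Real.sqrt d)) * v)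
    rw [Real.exp_neg]
    rw [div_le_iff₀ hε] at hexp
    have he := Real.exp_pos (r ^ 2 / Real.sqrt d)
    have h1 : 4 * (n : ℝ) ^ 2 * (ε / (2 * n) * (Real.exp (r ^ 2 / Real.sqrt d))⁻¹ * v) =
        2 * v * ((n * ε) / Real.exp (r ^ 2 / Real.sqrt d)) := by field_simp; ring
    rw [h1]
    exact le_mul_of_one_le_right (by linarith) ((one_le_div he).2 hexp)

/-! ### Calibration of the parameters -/

theorem log_succ_le {n : ℕ} (hn : 0 < n) : Real.log ((n : ℝ) + 1) ≤ 1 + Real.log n := by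
  have hn1 : (1 : ℝ) ≤ n := by exact_mod_cast hn
  have h := Real.log_le_log (by positivity) (show (n : ℝ) + 1 ≤ 2 * n by linarith)
  rw [Real.log_mul two_ne_zero (by positivity)] at h
  have := Real.log_two_lt_d9
  linarith

theorem log_failure_eq (b : ℕ) {n : ℕ} (hn : 0 < n) :
    Real.log ((n : ℝ) / (1 / ((n : ℝ) + 1) ^ b)) = Real.log n + b * Real.log ((n : ℝ) + 1) := by
  have hn0 : (0 : ℝ) < n := by exact_mod_cast hn
  rw [div_div_eq_mul_div, div_one, Real.log_mul hn0.ne' (by positivity), Real.log_pow]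

theorem one_le_log_failure {b n : ℕ} (hb : 1 ≤ b) (hn : 0 < n) :
    1 ≤ 30 * Real.log ((n : ℝ) / (1 / ((n : ℝ) + 1) ^ b)) := by
  have hn1 : (1 : ℝ) ≤ n := by exact_mod_cast hn
  have hb1 : (1 : ℝ) ≤ b := by exact_mod_cast hb
  rw [log_failure_eq b hn]
  have h := Real.log_le_log two_pos (show (2 : ℝ) ≤ n + 1 by linarith)
  have := half_le_log_two
  have := Real.log_nonneg hn1
  nlinarith

theorem sqrt_log_failure_le (b : ℕ) {n : ℕ} (hn : 0 < n) :
    Real.sqrt (30 * Real.log ((n : ℝ) / (1 / ((n : ℝ) + 1) ^ b))) ≤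
      30 * (b + 1) * (1 + Real.log n) := by
  have hn1 : (1 : ℝ) ≤ n := by exact_mod_cast hn
  have hlog := Real.log_nonneg hn1
  have hb0 : (0 : ℝ) ≤ b := by positivity
  have h := log_succ_le hn
  have h1 : 1 ≤ 30 * ((b : ℝ) + 1) * (1 + Real.log n) := by nlinarith
  refine Real.sqrt_le_iff.2 ⟨by linarith, ?_⟩
  -- The square root is bounded by the same expression as its argument, since that expression is at
  -- least `1`. This is crude but costs only logarithms.
  refine le_trans ?_ (le_self_pow₀ h1 two_ne_zero)
  rw [log_failure_eq b hn]
  nlinarith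

theorem exp_neg_log_failure_le (b : ℕ) {n : ℕ} (hn : 0 < n) :
    Real.exp (-(30 * Real.log ((n : ℝ) / (1 / ((n : ℝ) + 1) ^ b))) / 2) ≤
      (((n : ℝ) + 1) ^ b)⁻¹ := by
  have hn1 : (1 : ℝ) ≤ n := by exact_mod_cast hn
  have hlog := Real.log_nonneg hn1
  have hlog' := Real.log_nonneg (show (1 : ℝ) ≤ n + 1 by linarith)
  have h : (0 : ℝ) ≤ b * Real.log ((n : ℝ) + 1) := by positivity
  rw [← Real.exp_log (show 0 < (((n : ℝ) + 1) ^ b)⁻¹ by positivity), Real.log_inv, Real.log_pow,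
    Real.exp_le_exp, log_failure_eq b hn]
  linarith

theorem exp_half_div_cosh_le (b n : ℕ) :
    Real.exp (1 / 2) / Real.cosh (b * Real.log ((n : ℝ) + 1)) ≤ 4 * (((n : ℝ) + 1) ^ b)⁻¹ := by
  have hN : (0 : ℝ) < n + 1 := by positivity
  have h2 : Real.exp (1 / 2) ≤ 2 := by
    refine le_trans (Real.exp_le_exp.2 ?_) (Real.exp_log two_pos).le
    exact half_le_log_two
  have hL : Real.exp (b * Real.log ((n : ℝ) + 1)) = ((n : ℝ) + 1) ^ b := by
    rw [← Real.log_pow, Real.exp_log (by positivity)]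
  have hc : ((n : ℝ) + 1) ^ b / 2 ≤ Real.cosh (b * Real.log ((n : ℝ) + 1)) := by
    rw [Real.cosh_eq, hL]
    have := Real.exp_pos (-(b * Real.log ((n : ℝ) + 1)))
    linarith
  calc _ ≤ 2 / (((n : ℝ) + 1) ^ b / 2) := by gcongr
    _ = _ := by field_simp; norm_num

/-- The failure probability of one call of SoftmaxBalance, for `n` queries and batches of length at
most `t`. -/
def callFailure (b n t : ℕ) : ℝ≥0∞ :=
  t * ENNReal.ofReal (2 * Real.exp (-(30 * Real.log ((n : ℝ) / (1 / ((n : ℝ) + 1) ^ b))) / 2)) +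
    n * ENNReal.ofReal (Real.exp (1 / 2) / Real.cosh (b * Real.log ((n : ℝ) + 1)))

/-- There are `n` tokens, two instances and `T ≤ 2n` levels; a call fails with probability at most
`6n (n + 1)^(-κ-8)`. The product is `24 n³ (n + 1)^(-κ-8)`, and `24 n³ ≤ (n + 1)⁸` because `n + 1 ≥
2`. For `T = 0` no call is made, so `t` need not be below `n`. -/
theorem total_failure_le {κ n t T : ℕ} (hn : 0 < n) (ht : T ≠ 0 → t < n)
    (hT : (T : ℝ) ≤ 2 * (1 + Real.log n)) :
    (n : ℝ≥0∞) * (2 * (T * callFailure (κ + 8) n t)) ≤ ENNReal.ofReal (1 / (n : ℝ) ^ κ) := by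
  rcases eq_or_ne T 0 with rfl | hT0
  · simp
  have hn0 : (0 : ℝ) < n := by exact_mod_cast hn
  have htn : (t : ℝ) ≤ n := by exact_mod_cast (ht hT0).le
  have hTn : (T : ℝ) ≤ 2 * n := by
    have := Real.log_le_sub_one_of_pos hn0
    linarith
  set x : ℝ := (((n : ℝ) + 1) ^ (κ + 8))⁻¹ with hx
  have hx0 : 0 ≤ x := by positivity
  have hcall : callFailure (κ + 8) n t ≤ ENNReal.ofReal (6 * n * x) := by
    have h1 := exp_neg_log_failure_le (κ + 8) hn
    have h2 := exp_half_div_cosh_le (κ + 8) n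
    rw [callFailure, ← ENNReal.ofReal_natCast t, ← ENNReal.ofReal_natCast n,
      ← ENNReal.ofReal_mul (by positivity), ← ENNReal.ofReal_mul (by positivity),
      ← ENNReal.ofReal_add (by positivity)
        (mul_nonneg hn0.le (div_nonneg (Real.exp_pos _).le (Real.cosh_pos _).le))]
    refine ENNReal.ofReal_le_ofReal ?_
    calc _ ≤ (n : ℝ) * (2 * x) + n * (4 * x) := by gcongr
      _ = _ := by ring
  calc (n : ℝ≥0∞) * (2 * (T * callFailure (κ + 8) n t))
      ≤ n * (2 * (T * ENNReal.ofReal (6 * n * x))) := by gcongr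
    _ = ENNReal.ofReal (n * (2 * (T * (6 * n * x)))) := by
        rw [ENNReal.ofReal_mul hn0.le, ENNReal.ofReal_mul zero_le_two,
          ENNReal.ofReal_mul (Nat.cast_nonneg T), ENNReal.ofReal_natCast, ENNReal.ofReal_natCast,
          ENNReal.ofReal_ofNat]
    _ ≤ ENNReal.ofReal (1 / (n : ℝ) ^ κ) := by
        refine ENNReal.ofReal_le_ofReal ?_
        have h24 : 24 * (n : ℝ) ^ 3 ≤ ((n : ℝ) + 1) ^ 8 := by
          have hn1 : (1 : ℝ) ≤ n := by exact_mod_cast hn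
          calc 24 * (n : ℝ) ^ 3 ≤ (1 + 1) ^ 5 * ((n : ℝ) + 1) ^ 3 := by
                have : (n : ℝ) ^ 3 ≤ (n + 1) ^ 3 := by gcongr; linarith
                nlinarith [pow_pos hn0 3]
            _ ≤ (n + 1) ^ 5 * ((n : ℝ) + 1) ^ 3 := by gcongr
            _ = _ := by ring
        calc (n : ℝ) * (2 * (T * (6 * n * x))) ≤ n * (2 * (2 * n * (6 * n * x))) := by gcongr
          _ = 24 * (n : ℝ) ^ 3 * x := by ring
          _ ≤ ((n : ℝ) + 1) ^ 8 * x := by gcongr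
          _ = 1 / ((n : ℝ) + 1) ^ κ := by rw [hx, pow_add]; field_simp
          _ ≤ 1 / (n : ℝ) ^ κ := by gcongr; linarith

/-- The accuracy of one call of SoftmaxBalance, relative to the radius of the values. -/
def callError (b n d s : ℕ) (r : ℝ) : ℝ :=
  Real.sqrt s * (b * Real.log ((n : ℝ) + 1) *
    (Real.sqrt (30 * Real.log ((n : ℝ) / (1 / ((n : ℝ) + 1) ^ b))) *
      Real.exp (r ^ 2 / Real.sqrt d)))

theorem callError_nonneg (b n d s : ℕ) (r : ℝ) : 0 ≤ callError b n d s r := by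
  have := Real.log_nonneg (show (1 : ℝ) ≤ n + 1 by linarith [Nat.cast_nonneg (α := ℝ) n])
  rw [callError]
  positivity

/-- The three logarithmic factors in `t` come from `L`, from the bound on `√c` and from `T`. One
exponential comes from the error of a call and the other from the right-hand side; `1000 = 8 · 125`
with `120 b (b + 1) ≤ 125 (b + 1)²`. -/
theorem total_error_le {b n d s t T : ℕ} {r ε : ℝ} (hn : 0 < n) (hs : s ≤ d) (hε : 0 < ε)
    (ht : 0 < t) (hle : 1000 * (b + 1) ^ 2 * (1 + Real.log n) ^ 3 * baseSize d r ε ≤ t)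
    (hT : (T : ℝ) ≤ 2 * (1 + Real.log n)) :
    2 * (callError b n d s r * (T / t)) ≤ ε / 8 * Real.exp (-(r ^ 2 / Real.sqrt d)) := by
  have ht0 : (0 : ℝ) < t := by exact_mod_cast ht
  have hlog : 0 ≤ Real.log n := Real.log_nonneg (by exact_mod_cast hn)
  have hlog' := Real.log_nonneg (show (1 : ℝ) ≤ n + 1 by linarith [Nat.cast_nonneg (α := ℝ) n])
  have hsd : Real.sqrt s ≤ Real.sqrt d := Real.sqrt_le_sqrt (by exact_mod_cast hs)
  have h1 := log_succ_le hn
  have h2 := sqrt_log_failure_le b hn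
  set x := r ^ 2 / Real.sqrt d with hx
  set Λ := 1 + Real.log n with hΛ
  have hΛ1 : 1 ≤ Λ := by linarith
  have hee : Real.exp (2 * r ^ 2 / Real.sqrt d) = Real.exp x * Real.exp x := by
    rw [← Real.exp_add, hx]; congr 1; ring
  have hE : callError b n d s r ≤
      Real.sqrt d * (b * Λ * (30 * (b + 1) * Λ * Real.exp x)) := by
    rw [callError]
    gcongr
  rw [← mul_div_assoc, ← mul_div_assoc, div_le_iff₀ ht0]
  calc 2 * (callError b n d s r * T)
      ≤ 2 * (Real.sqrt d * (b * Λ * (30 * (b + 1) * Λ * Real.exp x)) * (2 * Λ)) := by gcongr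
    _ = 120 * (b * (b + 1)) * (Real.sqrt d * Λ ^ 3 * Real.exp x) := by ring
    _ ≤ 125 * (b + 1) ^ 2 * (Real.sqrt d * Λ ^ 3 * Real.exp x) := by
        refine mul_le_mul_of_nonneg_right ?_ (by positivity)
        nlinarith [Nat.cast_nonneg (α := ℝ) b]
    _ = ε / 8 * Real.exp (-x) * (1000 * (b + 1) ^ 2 * Λ ^ 3 * baseSize d r ε) := by
        rw [baseSize, hee, Real.exp_neg]
        field_simp
        ring
    _ ≤ _ := by gcongr

theorem softmaxBalance_call {b n d s t : ℕ} (hb : 1 ≤ b) (hn : 0 < n) (hs : 0 < s) {r ρ : ℝ}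
    (hρ : 0 < ρ) (C : List (KV d s)) (hlen : C.length ≤ t)
    (hC : ∀ x ∈ C, ‖x.key‖ ≤ r ∧ ‖x.val‖ ≤ ρ) (q : Fin n → EuclideanSpace ℝ (Fin d))
    (hq : ∀ j, ‖q j‖ ≤ r) :
    Holds (callFailure b n t) (softmaxBalance n r ρ (1 / ((n : ℝ) + 1) ^ b) C) fun out =>
      ∀ j, ‖(2 : ℝ) • pairSum (q j) out - pairSum (q j) C‖ ≤ callError b n d s r * ρ := by
  have hn1 : (1 : ℝ) ≤ n := by exact_mod_cast hn
  have hL : 0 < (b : ℝ) * Real.log ((n : ℝ) + 1) :=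
    mul_pos (by exact_mod_cast hb) (Real.log_pos (by linarith))
  refine (holds_softmaxBalance hs n hρ (one_le_log_failure hb hn) hL C hC q hq).mono ?_ ?_
  · rw [Fintype.card_fin, callFailure]
    gcongr
  · intro out h j
    refine (h j).trans_eq ?_
    rw [callError]
    ring

theorem one_le_baseSize {d : ℕ} {r ε : ℝ} (hd : 0 < d) (hε : 0 < ε) (hε1 : ε ≤ 1) :
    1 ≤ baseSize d r ε := by
  have h1 : 1 ≤ Real.sqrt d := by
    rw [Real.one_le_sqrt]; exact_mod_cast hd
  have h2 : 1 ≤ Real.exp (2 * r ^ 2 / Real.sqrt d) := Real.one_le_exp (by positivity)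
  rw [baseSize, one_le_div hε]
  exact hε1.trans (one_le_mul_of_one_le_of_one_le h1 h2)

theorem le_toOuterMeasure_of_compl_le {α : Type} (p : PMF α) (A : Set α) {x : ℝ} (hx : 0 ≤ x)
    (h : p.toOuterMeasure Aᶜ ≤ ENNReal.ofReal x) : ENNReal.ofReal (1 - x) ≤ p.toOuterMeasure A := by
  have h1 : (1 : ℝ≥0∞) ≤ p.toOuterMeasure A + p.toOuterMeasure Aᶜ := by
    refine le_trans (le_of_eq ?_) (MeasureTheory.measure_union_le A Aᶜ)
    rw [Set.union_compl_self]
    exact ((p.toOuterMeasure_apply_eq_one_iff _).2 (Set.subset_univ _)).symm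
  rw [ENNReal.ofReal_sub 1 hx, ENNReal.ofReal_one]
  exact tsub_le_iff_right.2 (h1.trans (by gcongr))

/-- Memory is `d` times the number of buckets, levels and `t`, which gives `Λ · Λ · Λ³`. The
dominant time term `T d t²` gives `Λ · (Λ³)²` and `C²`, the reason for the exponents `7` and `2`. -/
theorem resources_le {C : ℝ} (hC : 1 ≤ C) {b n d : ℕ} {r ε : ℝ} (hn : 0 < n) (hd : 0 < d)
    (hZ : 1 ≤ baseSize d r ε) {P : Params} (hP : P = params C 3 b n d r ε) :
    (spaceBound P d (bucketBound n) : ℝ) ≤ polylog (10000 * C ^ 2) 7 n * (d * baseSize d r ε) ∧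
      ((67 + P.T + stepTime P d (bucketBound n) : ℕ) : ℝ) ≤
        polylog (10000 * C ^ 2) 7 n * (d * baseSize d r ε ^ 2) := by
  have hp := paramBounds hC hZ hn
  have hT : (P.T : ℝ) ≤ 2 * (1 + Real.log n) := by rw [hP]; exact hp.T_le
  have ht : (P.t : ℝ) ≤ 2 * (C * (1 + Real.log n) ^ 3 * baseSize d r ε) := by
    rw [hP]; exact hp.t_le
  have ht1 : (1 : ℝ) ≤ P.t := by rw [hP]; exact_mod_cast hp.t_pos
  have hB := bucketBound_le hn
  have hd1 : (1 : ℝ) ≤ d := by exact_mod_cast hd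
  have hlog : 0 ≤ Real.log n := Real.log_nonneg (by exact_mod_cast hn)
  set Λ := 1 + Real.log n with hΛ
  set Z := baseSize d r ε with hZdef
  have hΛ1 : 1 ≤ Λ := by linarith
  have hT1 : (P.T : ℝ) + 1 ≤ 3 * Λ := by linarith
  have hcells : (d : ℝ) * (bucketBound n * (P.T + 1) * P.t) ≤ 36 * C * Λ ^ 5 * (d * Z) := by
    calc (d : ℝ) * (bucketBound n * (P.T + 1) * P.t)
        ≤ d * (6 * Λ * (3 * Λ) * (2 * (C * Λ ^ 3 * Z))) := by gcongr
      _ = _ := by ring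
  have hΛ57 : Λ ^ 5 ≤ Λ ^ 7 := pow_le_pow_right₀ hΛ1 (by norm_num)
  have hC2 : C ≤ C ^ 2 := le_self_pow₀ hC two_ne_zero
  have hcells' : (d : ℝ) * (bucketBound n * (P.T + 1) * P.t) ≤ 36 * C ^ 2 * Λ ^ 7 * (d * Z) :=
    hcells.trans (by gcongr)
  constructor
  · rw [spaceBound, polylog]
    push_cast
    have : 0 ≤ C ^ 2 * Λ ^ 7 * (d * Z) := by positivity
    nlinarith
  · have hlevel : (levelTime P.t d d : ℝ) ≤ 36 * (d * P.t ^ 2) := by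
      rw [levelTime]
      push_cast
      have h1 : (1 : ℝ) ≤ d * P.t := one_le_mul_of_one_le_of_one_le hd1 ht1
      have h2 : (d : ℝ) * P.t ≤ d * P.t ^ 2 := by gcongr; exact le_self_pow₀ ht1 two_ne_zero
      have h3 : (P.t : ℝ) ≤ d * P.t := le_mul_of_one_le_left (by linarith) hd1
      have h4 : (P.t : ℝ) ^ 2 ≤ d * P.t ^ 2 := le_mul_of_one_le_left (by positivity) hd1
      nlinarith
    have hlevels : (P.T : ℝ) * levelTime P.t d d ≤ 288 * C ^ 2 * Λ ^ 7 * (d * Z ^ 2) := by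
      calc (P.T : ℝ) * levelTime P.t d d
          ≤ 2 * Λ * (36 * (d * (2 * (C * Λ ^ 3 * Z)) ^ 2)) := by
            refine mul_le_mul hT (hlevel.trans ?_) (by positivity) (by positivity)
            gcongr
        _ = _ := by ring
    have hZ2 : Z ≤ Z ^ 2 := le_self_pow₀ hZ two_ne_zero
    have hcells2 : (d : ℝ) * (bucketBound n * (P.T + 1) * P.t) ≤
        36 * C ^ 2 * Λ ^ 7 * (d * Z ^ 2) := hcells'.trans (by gcongr)
    have hsmall : Λ ≤ C ^ 2 * Λ ^ 7 * (d * Z ^ 2) := by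
      calc Λ ≤ Λ ^ 7 := le_self_pow₀ hΛ1 (by norm_num)
        _ = 1 * Λ ^ 7 * (1 * 1) := by ring
        _ ≤ C ^ 2 * Λ ^ 7 * (d * Z ^ 2) := by
          gcongr
          · exact one_le_pow₀ hC
          · exact one_le_pow₀ hZ
    rw [stepTime, polylog]
    push_cast
    nlinarith

/-! ### The guarantees of BalanceKV -/

theorem State.GoodInv.accuracy_params {b n d : ℕ} {r ε : ℝ} (hn : 0 < n) (hd : 0 < d) (hε : 0 < ε)
    (hε1 : ε ≤ 1) {P : Params} (hP : P = params (1000 * ((b : ℝ) + 1) ^ 2) 3 b n d r ε)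
    (q k v : Fin n → EuclideanSpace ℝ (Fin d)) (hq : ∀ j, ‖q j‖ ≤ r) (hk : ∀ j, ‖k j‖ ≤ r)
    (j : Fin n) {S : State d}
    (h : S.GoodInv P q (callError b n d d r) (callError b n d 1 r)
      (List.ofFn fun i : Fin (j + 1) => ⟨q (Fin.castLE j.isLt i), k (Fin.castLE j.isLt i),
        v (Fin.castLE j.isLt i)⟩)) :
    0 < S.den.estimate P (q j) 0 ∧
      ‖S.estimate P (q j) - attn (q j) (prefixMatrix k j) (prefixMatrix v j)‖ ≤
        ε * ‖attnWeights (q j) (prefixMatrix k j)‖ * frobenius (prefixMatrix v j) := by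
  have hC : (1 : ℝ) ≤ 1000 * ((b : ℝ) + 1) ^ 2 := by nlinarith [Nat.cast_nonneg (α := ℝ) b]
  have hp := paramBounds hC (one_le_baseSize (r := r) hd hε hε1) hn
  have hPt : 0 < P.t := by rw [hP]; exact hp.t_pos
  have hPε : P.ε = ε := by rw [hP]; rfl
  have hPr : P.r = r := by rw [hP]; rfl
  have hPn : P.n = n := by rw [hP]; rfl
  have herr : ∀ s ≤ d, 2 * (callError b n d s r * (P.T / P.t)) ≤
      P.ε / 8 * Real.exp (-(P.r ^ 2 / Real.sqrt d)) := by
    intro s hs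
    rw [hP]
    exact total_error_le hn hs hε hp.t_pos hp.le_t hp.T_le
  -- The factor `2` in `herr`, due to rounding norms up to powers of two, is not needed for the
  -- denominator, whose values all have norm `1`.
  have h1 := herr 1 hd
  have hnn : 0 ≤ callError b n d 1 r * (P.T / P.t) :=
    mul_nonneg (callError_nonneg ..) (by positivity)
  have key := State.GoodInv.accuracy (callError_nonneg b n d d r) (callError_nonneg b n d 1 r) hPt
    (by rw [hPε]; exact hε.le) (by rwa [hPε]) (herr d le_rfl) (by linarith) _ (Nat.succ_pos _)
    (by rw [hPn]; exact j.isLt) (fun i => by rw [hPr]; exact hk _) h j (by rw [hPr]; exact hq j)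
  refine ⟨key.1, ?_⟩
  rw [prefixMatrix, prefixMatrix, attn_eq, norm_attnWeights, frobenius_eq]
  refine key.2.trans_eq ?_
  rw [hPε]
  ring

theorem take_succ_ofFn {α : Type} {n : ℕ} (f : Fin n → α) (j : Fin n) :
    (List.ofFn f).take (j + 1) = List.ofFn fun i : Fin (j + 1) => f (Fin.castLE j.isLt i) := by
  refine List.ext_getElem ?_ fun i h1 h2 => ?_
  · simp
  · rw [List.getElem_take, List.getElem_ofFn, List.getElem_ofFn]
    rfl

theorem accuracy_probability {κ b n d : ℕ} (hb : b = κ + 8) {r ε : ℝ} (hn : 0 < n) (hd : 0 < d)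
    (hε : 0 < ε) (hε1 : ε ≤ 1) {P : Params}
    (hP : P = params (1000 * ((b : ℝ) + 1) ^ 2) 3 b n d r ε)
    (q k v : Fin n → EuclideanSpace ℝ (Fin d)) (hq : ∀ j, ‖q j‖ ≤ r) (hk : ∀ j, ‖k j‖ ≤ r) :
    ENNReal.ofReal (1 - 1 / (n : ℝ) ^ κ) ≤
      (run P (List.ofFn fun j => ⟨q j, k j, v j⟩)).toOuterMeasure
        {ρ | ∀ j : Fin n, ∃ rep z, ρ[(j : ℕ)]? = some rep ∧ rep.estimate = some z ∧
          ‖z - attn (q j) (prefixMatrix k j) (prefixMatrix v j)‖ ≤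
            ε * ‖attnWeights (q j) (prefixMatrix k j)‖ * frobenius (prefixMatrix v j)} := by
  have hC : (1 : ℝ) ≤ 1000 * ((b : ℝ) + 1) ^ 2 := by nlinarith [Nat.cast_nonneg (α := ℝ) b]
  have hZ := one_le_baseSize (r := r) hd hε hε1
  have hp := paramBounds hC hZ hn
  have hwf : P.Wf d (bucketBound n) := by rw [hP]; exact params_wf hC b hn hd hε hZ
  have hb1 : 1 ≤ b := by omega
  have hPn : P.n = n := by rw [hP]; rfl
  have hPr : P.r = r := by rw [hP]; rfl
  have hPδ : P.δ = 1 / ((n : ℝ) + 1) ^ b := by rw [hP]; rfl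
  set tok : Fin n → Token d := fun j => ⟨q j, k j, v j⟩ with htok
  set stream := List.ofFn tok with hstream
  -- The length of a prefix determines the step `j`, so `A` need not mention the tokens.
  let A : List (Token d) → EuclideanSpace ℝ (Fin d) → Prop := fun l z =>
    ∀ j : Fin n, l.length = j + 1 →
      ‖z - attn (q j) (prefixMatrix k j) (prefixMatrix v j)‖ ≤
        ε * ‖attnWeights (q j) (prefixMatrix k j)‖ * frobenius (prefixMatrix v j)
  have hlen : stream.length = n := List.length_ofFn
  have hkey : ∀ x ∈ stream, ‖x.key‖ ≤ P.r := by
    intro x hx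
    obtain ⟨i, rfl⟩ := (List.mem_ofFn' _ _).1 hx
    rw [hPr]
    exact hk i
  have hacc : ∀ pre x post, stream = pre ++ x :: post → ∀ S : State d,
      S.GoodInv P q (callError b n d d r) (callError b n d 1 r) (pre ++ [x]) →
        0 < S.den.estimate P x.query 0 ∧ A (pre ++ [x]) (S.estimate P x.query) := by
    intro pre x post hs S hS
    have hj : pre.length < n := by
      rw [← hlen, hs]; simp
    have hx : x = tok ⟨pre.length, hj⟩ := by
      have h1 : stream[pre.length]? = some x := by rw [hs]; simp
      have h2 : stream[pre.length]? = some (tok ⟨pre.length, hj⟩) := by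
        rw [hstream]; simp [hj]
      exact Option.some_injective _ (h1.symm.trans h2)
    have hpre : pre ++ [x] = List.ofFn fun i : Fin (pre.length + 1) => tok (Fin.castLE hj i) := by
      rw [← take_succ_ofFn tok ⟨pre.length, hj⟩, ← hstream, hs, List.take_append]
      simp
    have key := State.GoodInv.accuracy_params hn hd hε hε1 hP q k v hq hk ⟨pre.length, hj⟩ (S := S)
      (by rw [hpre] at hS; exact hS)
    rw [hx]
    refine ⟨key.1, fun j hjl => ?_⟩
    have hjj : j = ⟨pre.length, hj⟩ := Fin.ext (by simpa using hjl.symm)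
    rw [hjj]
    exact key.2
  have hfail := runFrom_failure hwf (q := q) (β := callFailure b n P.t)
    (callError_nonneg b n d d r) (callError_nonneg b n d 1 r)
    (fun i C hC hx => by
      rw [hPn, hPr, hPδ]
      exact softmaxBalance_call hb1 hn hd (radius_pos i) C hC (hPr ▸ hx) q hq)
    (fun C hC hx => by
      rw [hPn, hPr, hPδ]
      have := softmaxBalance_call hb1 hn one_pos one_pos C hC (hPr ▸ hx) q hq
      rwa [mul_one] at this)
    A stream hkey hacc stream [] rfl ⟨0, [], MR.empty⟩ (State.goodInv_init P q _ _) (startMeter P)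
  rw [← run_eq, hlen] at hfail
  refine le_toOuterMeasure_of_compl_le _ _ (by positivity) (le_trans ?_ (hfail.trans ?_))
  · refine (run P stream).toOuterMeasure.mono fun ρ hρ hgood => hρ fun j => ?_
    obtain ⟨rep, z, h1, h2, h3⟩ := hgood j j.isLt
    refine ⟨rep, z, h1, h2, h3 j ?_⟩
    rw [List.nil_append, List.length_take, hlen]
    omega
  · rw [hb]
    refine total_failure_le hn ?_ ?_
    · rw [hP]; exact hp.t_lt
    · rw [hP]; exact hp.T_le

theorem report_bounds {C : ℝ} (hC : 1 ≤ C) {b n d : ℕ} {r ε : ℝ} (hn : 0 < n) (hd : 0 < d)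
    (hε : 0 < ε) (hε1 : ε ≤ 1) (tok : Fin n → Token d) :
    ∀ ρ ∈ (run (params C 3 b n d r ε) (List.ofFn tok)).support, ∀ rep ∈ ρ,
      (rep.space : ℝ) ≤ polylog (10000 * C ^ 2) 7 n *
        (d * Real.sqrt d * Real.exp (2 * r ^ 2 / Real.sqrt d) / ε) ∧
      (rep.time : ℝ) ≤ polylog (10000 * C ^ 2) 7 n *
        ((d : ℝ) ^ 2 * Real.exp (4 * r ^ 2 / Real.sqrt d) / ε ^ 2) := by
  intro ρ hρ rep hrep
  have hZ := one_le_baseSize (r := r) hd hε hε1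
  obtain ⟨h1, h2⟩ := run_reports (params_wf hC b hn hd hε hZ) (List.ofFn tok)
    (List.length_ofFn).le ρ hρ rep hrep
  obtain ⟨h3, h4⟩ := resources_le hC (b := b) hn hd hZ rfl
  have e1 : d * Real.sqrt d * Real.exp (2 * r ^ 2 / Real.sqrt d) / ε = d * baseSize d r ε := by
    rw [baseSize]; ring
  have e2 : (d : ℝ) ^ 2 * Real.exp (4 * r ^ 2 / Real.sqrt d) / ε ^ 2 =
      d * baseSize d r ε ^ 2 := by
    rw [baseSize, div_pow, mul_pow, Real.sq_sqrt (Nat.cast_nonneg d), ← Real.exp_nat_mul]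
    rw [show ((2 : ℕ) : ℝ) * (2 * r ^ 2 / Real.sqrt d) = 4 * r ^ 2 / Real.sqrt d by push_cast; ring]
    ring
  rw [e1, e2]
  exact ⟨le_trans (by exact_mod_cast h1) h3, le_trans (by exact_mod_cast h2) h4⟩

end BalanceKV

end

/-! ### Choice of the constants -/

theorem theorem1 (κ : ℕ) :
    ∃ (C C' : ℝ) (a a' b : ℕ), 0 < C ∧ 0 < C' ∧
      ∀ (n d : ℕ) (r ε : ℝ), 0 < n → 0 < d → 0 < r → 0 < ε → ε ≤ 1 →
      ∀ (q k v : Fin n → EuclideanSpace ℝ (Fin d)), (∀ j, ‖q j‖ ≤ r ∧ ‖k j‖ ≤ r) →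
        ENNReal.ofReal (1 - 1 / (n : ℝ) ^ κ) ≤
            (BalanceKV.run (BalanceKV.params C a b n d r ε)
                (List.ofFn fun j => ⟨q j, k j, v j⟩)).toOuterMeasure
              {ρ | ∀ j : Fin n, ∃ rep z, ρ[(j : ℕ)]? = some rep ∧ rep.estimate = some z ∧
                ‖z - BalanceKV.attn (q j) (BalanceKV.prefixMatrix k j)
                      (BalanceKV.prefixMatrix v j)‖ ≤
                  ε * ‖BalanceKV.attnWeights (q j) (BalanceKV.prefixMatrix k j)‖ *
                    BalanceKV.frobenius (BalanceKV.prefixMatrix v j)} ∧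
        ∀ ρ ∈ (BalanceKV.run (BalanceKV.params C a b n d r ε)
            (List.ofFn fun j => ⟨q j, k j, v j⟩)).support, ∀ rep ∈ ρ,
          (rep.space : ℝ) ≤ BalanceKV.polylog C' a' n *
            (d * Real.sqrt d * Real.exp (2 * r ^ 2 / Real.sqrt d) / ε) ∧
          (rep.time : ℝ) ≤ BalanceKV.polylog C' a' n *
            ((d : ℝ) ^ 2 * Real.exp (4 * r ^ 2 / Real.sqrt d) / ε ^ 2) := by
  have hC : (1 : ℝ) ≤ 1000 * (((κ + 8 : ℕ) : ℝ) + 1) ^ 2 := by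
    nlinarith [Nat.cast_nonneg (α := ℝ) (κ + 8)]
  -- With `b = κ + 8` for the union bound, `1000 (b + 1)²` and the exponent `3` are what
  -- `total_error_le` asks of `t`; `10000 C²` and `7` come from `resources_le`.
  refine ⟨1000 * (((κ + 8 : ℕ) : ℝ) + 1) ^ 2, 10000 * (1000 * (((κ + 8 : ℕ) : ℝ) + 1) ^ 2) ^ 2, 3, 7,
    κ + 8, by positivity, by positivity, ?_⟩
  intro n d r ε hn hd _ hε hε1 q k v hqk
  exact ⟨BalanceKV.accuracy_probability rfl hn hd hε hε1 rfl q k v (fun j => (hqk j).1)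
    fun j => (hqk j).2, BalanceKV.report_bounds hC hn hd hε hε1 _⟩
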